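/- Let $D\subseteq\mathbb R^n$ be open with $0\in D$, let $f_1,\dots,f_m\in C^3(D;\mathbb R^n)$, and consider the system $\dot x=g(t,x)+\sum_{k=1}^m f_k(x)u_k$ with drift $g:[0,\infty)\times D\to\mathbb R^n$. Let $\|\cdot\|$ be the Euclidean norm (for matrices, the induced operator norm), $B_r(0)$ the open ball, and $[f,g](x)=Dg(x)f(x)-Df(x)g(x)$. Let $S_1\subseteq\{1,\dots,m\}$, $S_2\subseteq\{1,\dots,m\}^2$, $S_3\subseteq\{1,\dots,m\}^3$ satisfy $|S_1|+|S_2|+|S_3|=n$, and let $\mathcal F(x)$ be the $n\times n$ matrix with columns $f_i(x)$ $(i\in S_1)$, $[f_{j_1},f_{j_2}](x)$ $((j_1,j_2)\in S_2)$, $[[f_{\ell_1},f_{\ell_2}],f_{\ell_3}](x)$ $((\ell_1,\ell_2,\ell_3)\in S_3)$. Assume that for every $x\in D$ these columns span $\mathbb R^n$ and $\|\mathcal F^{-1}(x)\|\le\alpha$, with a constant $\alpha>0$. Assume that $g$ is measurable in $t$ and continuous in $x$ (Carathéodory), and that for each compact $K\subseteq D$ there are $\tau>0$ and $M\ge0$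 such that, for every $t_0\ge0$, $\|g(t,x)\|\le M$ for all $t\in[t_0,t_0+\tau]$, $x\in K$. Assume further that there are $M_g,L_g\ge0$ and $\delta_0>0$ such that $\|g(t,x)\|\le M_g\|x\|^3$ and $\|g(t,x)-g(t,y)\|\le L_g\|x-y\|$ for all $t\ge0$ and $x,y\in B_{\delta_0}(0)\cap D$. Let integers $\kappa_j$ $(j\in S_2)$ and $\kappa_{1\ell},\kappa_{2\ell}$ $(\ell\in S_3)$ be given, and put $\kappa_{3\ell}=\kappa_{1\ell}+\kappa_{2\ell}$, $\kappa_{4\ell}=\kappa_{2\ell}-\kappa_{1\ell}$. Assume that all the numbers $\kappa_j,\kappa_{1\ell},\dots,\kappa_{4\ell}$ are positive and pairwise distinct, and that, up to sign, the only relations $\sum_{s,\ell}c_{s\ell}\kappa_{s\ell}=0$ with relatively prime integers $c_{s\ell}$ and $\sum_{s,\ell}|c_{s\ell}|=3$ are $\kappa_{1\ell}+\kappa_{2\ell}-\kappa_{3\ell}=0$ and $\kappa_{2\ell}-\kappa_{1\ell}-\kappa_{4\ell}=0$. For $\gamma,\varepsilon>0$ put $a(x)=-\gamma\mathcal F^{-1}(x)x$,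 with components indexed by $S_1,S_2,S_3$ as the columns of $\mathcal F(x)$, and, for $k=1,\dots,m$, $$h_k^\varepsilon(t,x)=\sum_{i\in S_1}a_i(x)\delta_{ki}+\varepsilon^{-1/2}\sum_{j\in S_2}\sqrt{|a_j(x)|}\,2\sqrt{\pi\kappa_j}\Big(\delta_{kj_1}\operatorname{sign}(a_j(x))\cos\tfrac{2\pi\kappa_jt}{\varepsilon}+\delta_{kj_2}\sin\tfrac{2\pi\kappa_jt}{\varepsilon}\Big)$$ $$+\varepsilon^{-2/3}\sum_{\ell\in S_3}\sqrt[3]{a_\ell(x)}\,2\sqrt[3]{2\pi^2\kappa_{3\ell}\kappa_{4\ell}}\Big(\delta_{k\ell_1}\cos\tfrac{2\pi\kappa_{1\ell}t}{\varepsilon}+\delta_{k\ell_2}\sin\tfrac{2\pi\kappa_{2\ell}t}{\varepsilon}+\delta_{k\ell_3}\cos\tfrac{2\pi\kappa_{1\ell}t}{\varepsilon}\sin\tfrac{2\pi\kappa_{2\ell}t}{\varepsilon}\Big).$$ A $\pi_\varepsilon$-solution with initial value $x^0$ is a locally absolutely continuous $x:[0,\infty)\to D$ with $x(0)=x^0$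 and, for each $j=0,1,2,\dots$, $\dot x(t)=g(t,x(t))+\sum_k f_k(x(t))\,h_k^\varepsilon(t,x(\varepsilon j))$ for almost every $t\in[\varepsilon j,\varepsilon(j+1))$; solutions on $[0,T)$ are defined in the same way. Then for every $\delta>0$ with $\overline{B_\delta(0)}\subseteq D$ there exist $\gamma,\bar\varepsilon,\lambda>0$ such that for every $\varepsilon\in(0,\bar\varepsilon]$: (i) for every $x^0\in B_\delta(0)$ a $\pi_\varepsilon$-solution with $x(0)=x^0$ exists, and every solution on an interval $[0,T)$, $T>0$, with $x(0)=x^0$ extends to a $\pi_\varepsilon$-solution on $[0,\infty)$; (ii) all these $\pi_\varepsilon$-solutions satisfy $\|x(t)\|=O(e^{-\lambda t})$; more precisely, there is a $C$ with $\|x(t)\|\le Ce^{-\lambda t}$ for all $t\ge0$, all $x^0\in B_\delta(0)$ and all $\pi_\varepsilon$-solutions with $x(0)=x^0$; (iii) the origin is stable: for every $\eta>0$ there is an $r>0$ such that $\|x(t)\|<\eta$ for all $t\ge0$ and all $\pi_\varepsilon$-solutions with $x^0\in B_\delta(0)$, $\|x^0\|<r$. -/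

import Mathlib

open MeasureTheory Set

noncomputable section

namespace DriftStab

/-- The state space `ℝⁿ` with the Euclidean norm. -/
abbrev State (n : ℕ) := EuclideanSpace ℝ (Fin n)

variable {n m : ℕ}

/-- The disjoint union `S₁ ⊔ S₂ ⊔ S₃`: the index set of the columns of `𝓕(x)` and of the
components of `a(x)`. -/
abbrev Idx (S₁ : Finset (Fin m)) (S₂ : Finset (Fin m × Fin m))
    (S₃ : Finset (Fin m × Fin m × Fin m)) := ↥S₁ ⊕ ↥S₂ ⊕ ↥S₃

variable {S₁ : Finset (Fin m)} {S₂ : Finset (Fin m × Fin m)}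
  {S₃ : Finset (Fin m × Fin m × Fin m)}

/-- The columns of `𝓕`: `f_i` for `i ∈ S₁`, the brackets `[f_{j₁}, f_{j₂}]` for `(j₁, j₂) ∈ S₂`
and `[[f_{ℓ₁}, f_{ℓ₂}], f_{ℓ₃}]` for `(ℓ₁, ℓ₂, ℓ₃) ∈ S₃`.
Here `[f, g](x) = Dg(x) f(x) - Df(x) g(x)`. -/
def column (f : Fin m → State n → State n) : Idx S₁ S₂ S₃ → State n → State n
  | .inl i => f i
  | .inr (.inl j) => VectorField.lieBracket ℝ (f j.1.1) (f j.1.2)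
  | .inr (.inr l) => VectorField.lieBracket ℝ
      (VectorField.lieBracket ℝ (f l.1.1) (f l.1.2.1)) (f l.1.2.2)

/-- The rank condition on `D`: `|S₁| + |S₂| + |S₃| = n` and the columns span `ℝⁿ` at every point
of `D`. -/
def RankCondition (D : Set (State n)) (f : Fin m → State n → State n) (S₁ : Finset (Fin m))
    (S₂ : Finset (Fin m × Fin m)) (S₃ : Finset (Fin m × Fin m × Fin m)) : Prop :=
  S₁.card + S₂.card + S₃.card = n ∧
    ∀ x ∈ D, Submodule.span ℝ (range fun i : Idx S₁ S₂ S₃ => column f i x) = ⊤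

/-- The matrix `𝓕(x)` as the linear map `c ↦ ∑ᵢ cᵢ columnᵢ(x)`. -/
def matF (f : Fin m → State n → State n) (S₁ : Finset (Fin m)) (S₂ : Finset (Fin m × Fin m))
    (S₃ : Finset (Fin m × Fin m × Fin m)) (x : State n) :
    EuclideanSpace ℝ (Idx S₁ S₂ S₃) →L[ℝ] State n :=
  ∑ i : Idx S₁ S₂ S₃,
    (EuclideanSpace.proj i : EuclideanSpace ℝ (Idx S₁ S₂ S₃) →L[ℝ] ℝ).smulRight (column f i x)

/-- The inverse matrix `𝓕⁻¹(x)`; its norm is the operator norm for the Euclidean norms. -/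
def matFInv (f : Fin m → State n → State n) (S₁ : Finset (Fin m)) (S₂ : Finset (Fin m × Fin m))
    (S₃ : Finset (Fin m × Fin m × Fin m)) (x : State n) :
    State n →L[ℝ] EuclideanSpace ℝ (Idx S₁ S₂ S₃) :=
  (matF f S₁ S₂ S₃ x).inverse

/-- The coefficients `a(x) = -γ 𝓕⁻¹(x) x`. -/
def coeffA (f : Fin m → State n → State n) (S₁ : Finset (Fin m)) (S₂ : Finset (Fin m × Fin m))
    (S₃ : Finset (Fin m × Fin m × Fin m)) (γ : ℝ) (x : State n) :
    EuclideanSpace ℝ (Idx S₁ S₂ S₃) :=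
  -(γ • matFInv f S₁ S₂ S₃ x x)

/-- The integers `κ_{j₁j₂}` for `(j₁, j₂) ∈ S₂` and `κ_{1ℓ}`, `κ_{2ℓ}` for `ℓ ∈ S₃`. -/
structure Freq (S₂ : Finset (Fin m × Fin m)) (S₃ : Finset (Fin m × Fin m × Fin m)) where
  k : ↥S₂ → ℤ
  k₁ : ↥S₃ → ℤ
  k₂ : ↥S₃ → ℤ

namespace Freq

/-- The four numbers `κ_{1ℓ}`, `κ_{2ℓ}`, `κ_{3ℓ} = κ_{1ℓ} + κ_{2ℓ}`, `κ_{4ℓ} = κ_{2ℓ} - κ_{1ℓ}`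
(numbered from `0` to `3`). -/
def quad (κ : Freq S₂ S₃) (p : ↥S₃ × Fin 4) : ℤ :=
  ![κ.k₁ p.1, κ.k₂ p.1, κ.k₁ p.1 + κ.k₂ p.1, κ.k₂ p.1 - κ.k₁ p.1] p.2

/-- The third-order relation `c` is one of those which hold by the definition of `κ_{3ℓ}` and
`κ_{4ℓ}`: `κ_{1ℓ} + κ_{2ℓ} - κ_{3ℓ} = 0` and `κ_{2ℓ} - κ_{1ℓ} - κ_{4ℓ} = 0`, up to sign. -/
def Imposed (c : ↥S₃ × Fin 4 → ℤ) : Prop :=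
  ∃ l : ↥S₃, ∃ s : ℤ, (s = 1 ∨ s = -1) ∧
    (c = s • (Pi.single (l, 0) 1 + Pi.single (l, 1) 1 - Pi.single (l, 2) 1) ∨
     c = s • (Pi.single (l, 1) 1 - Pi.single (l, 0) 1 - Pi.single (l, 3) 1))

/-- Absence of resonances: all the numbers `κ_{j₁j₂}` (over `S₂`) and `κ_{1ℓ}, …, κ_{4ℓ}`
(over `S₃`) are positive and pairwise distinct, and the only third-order resonances between the
numbers `κ_{sℓ}` are the imposed ones. -/
structure NonResonant (κ : Freq S₂ S₃) : Prop where
  pos_k : ∀ j, 0 < κ.k j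
  pos_quad : ∀ p, 0 < κ.quad p
  distinct : Function.Injective (Sum.elim κ.k κ.quad)
  no_resonance : ∀ c : ↥S₃ × Fin 4 → ℤ, Finset.univ.gcd c = 1 → ∑ p, |c p| = 3 →
    ∑ p, c p * κ.quad p = 0 → Imposed c

end Freq

/-- The real cube root. -/
def cbrt (y : ℝ) : ℝ := Real.sign y * |y| ^ (1 / 3 : ℝ)

/-- The Kronecker delta. -/
def kron (k i : Fin m) : ℝ := if k = i then 1 else 0

/-- `φ^{(k,ε)}_{j₁j₂}(t,x)`, where `κ = κ_{j₁j₂}` and `a = a_{j₁j₂}(x)`. -/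
def phi₂ (κ : ℤ) (ε : ℝ) (j : Fin m × Fin m) (a : ℝ) (k : Fin m) (t : ℝ) : ℝ :=
  2 * √(Real.pi * κ) *
    (kron k j.1 * Real.sign a * Real.cos (2 * Real.pi * κ / ε * t)
      + kron k j.2 * Real.sin (2 * Real.pi * κ / ε * t))

/-- `φ^{(k,ε)}_{ℓ₁ℓ₂ℓ₃}(t)`, where `κ₁ = κ_{1ℓ}`, `κ₂ = κ_{2ℓ}`, so that
`κ_{3ℓ} κ_{4ℓ} = (κ₁ + κ₂) (κ₂ - κ₁)`. -/
def phi₃ (κ₁ κ₂ : ℤ) (ε : ℝ) (l : Fin m × Fin m × Fin m) (k : Fin m) (t : ℝ) : ℝ :=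
  2 * cbrt (2 * Real.pi ^ 2 * (κ₁ + κ₂) * (κ₂ - κ₁)) *
    (kron k l.1 * Real.cos (2 * Real.pi * κ₁ * t / ε)
      + kron k l.2.1 * Real.sin (2 * Real.pi * κ₂ * t / ε)
      + kron k l.2.2 * (Real.cos (2 * Real.pi * κ₁ * t / ε) *
          Real.sin (2 * Real.pi * κ₂ * t / ε)))

/-- The controls `u_k = h^ε_k(t,x)` with gain `γ` and frequencies `κ`. -/
def control (f : Fin m → State n → State n) (κ : Freq S₂ S₃) (S₁ : Finset (Fin m))
    (γ ε : ℝ) (t : ℝ) (x : State n) (k : Fin m) : ℝ :=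
  let a := coeffA f S₁ S₂ S₃ γ x
  (∑ i : ↥S₁, a (.inl i) * kron k i)
    + ε ^ (-(1 / 2) : ℝ) *
      ∑ j : ↥S₂, √|a (.inr (.inl j))| * phi₂ (κ.k j) ε j (a (.inr (.inl j))) k t
    + ε ^ (-(2 / 3) : ℝ) *
      ∑ l : ↥S₃, cbrt (a (.inr (.inr l))) * phi₃ (κ.k₁ l) (κ.k₂ l) ε l k t

/-- `x` is, on the time interval `I` (`I = [0, ∞)` or `I = [0, T)`), a solution in `D` of
`ẋ = g(t,x) + ∑ₖ f_k(x) h_k(t, x(t_j))`, `t ∈ [t_j, t_{j+1})`, `t_j = ε j`, with `x(0) = x⁰`: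
`x` is absolutely continuous on every `[0, b]` with `b ∈ I`, and the equation holds for almost
every `t`. -/
structure IsPiSolutionOn (I : Set ℝ) (D : Set (State n)) (g : ℝ → State n → State n)
    (f : Fin m → State n → State n) (h : ℝ → State n → Fin m → ℝ) (ε : ℝ) (x₀ : State n)
    (x : ℝ → State n) : Prop where
  init : x 0 = x₀
  mem : ∀ t ∈ I, x t ∈ D
  ac : ∀ b ∈ I, AbsolutelyContinuousOnInterval x 0 b
  deriv : ∀ j : ℕ, ∀ᵐ t : ℝ, t ∈ I → t ∈ Ico (ε * j) (ε * (j + 1)) →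
    HasDerivAt x (g t (x t) + ∑ k, h t (x (ε * j)) k • f k (x t)) t

/-- A `π_ε`-solution: defined on the whole of `[0, ∞)`. -/
abbrev IsPiSolution (D : Set (State n)) (g : ℝ → State n → State n)
    (f : Fin m → State n → State n) (h : ℝ → State n → Fin m → ℝ) (ε : ℝ) (x₀ : State n)
    (x : ℝ → State n) : Prop :=
  IsPiSolutionOn (Ici 0) D g f h ε x₀ x

/-- The drift is a Carathéodory function on `[0, ∞) × D`: measurable in `t` and continuous
in `x`. -/
def Caratheodory (D : Set (State n)) (g : ℝ → State n → State n) : Prop :=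
  (∀ x ∈ D, AEStronglyMeasurable (fun t => g t x) (volume.restrict (Ici 0))) ∧
    ∀ t, 0 ≤ t → ContinuousOn (g t) D

/-- Boundedness of the drift: for each compact `K ⊆ D` there are `τ > 0` and `M ≥ 0` such that,
for any `t₀ ≥ 0`, `‖g(t,x)‖ ≤ M` for all `t ∈ [t₀, t₀ + τ]` and `x ∈ K`. -/
def BoundedDrift (D : Set (State n)) (g : ℝ → State n → State n) : Prop :=
  ∀ K ⊆ D, IsCompact K → ∃ τ > 0, ∃ M ≥ 0, ∀ t₀ ≥ 0, ∀ t ∈ Icc t₀ (t₀ + τ), ∀ x ∈ K,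
    ‖g t x‖ ≤ M

end DriftStab

end

open DriftStab

/-! On a sampling interval of length `ε` the coefficients `a` are frozen at the state `ξ` at its
beginning, and a third-order Chen–Fliess expansion (`chenFliess`) expresses the displacement through
iterated integrals of the controls. These are sums of elementary oscillations with a whole number of
periods in time `ε`, so the iterated integrals are computed exactly. Non-resonance leaves, among the
large terms, only those which assemble into the columns of `𝓕`, each with coefficient `ε aᵢ`. As
`𝓕(ξ) a(ξ) = -γ ξ`, the displacement is `-ε γ ξ` plus errors (`period_expansion`).

Errors are counted in powers of `θ = (ε γ α ‖ξ‖)^{1/6}`. Over one interval an oscillation belonging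
to `S₁`, `S₂`, `S₃` has size `θ⁶`, `θ³`, `θ²`, and the wanted terms have order `θ⁶`. Terms of order
4 and 5 would be too large and must vanish identically. Terms of order at least 7 are harmless: `θ⁷
= ε γ α ‖ξ‖ θ`, which is small against `ε γ ‖ξ‖` as `ε → 0`, uniformly in `‖ξ‖ ≤ δ`.

Inside an interval the state may swell to `2 (‖ξ‖ + C θ²)`, an excursion of order `‖ξ‖^{1/3}`. Cubic
smallness of the drift is just what makes its effect linear in `‖ξ‖` again: `(θ²)³ = θ⁶`. Of the two
resulting terms one carries another factor `ε`. The other, of size `δ² ‖ξ‖`, does not become small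
relative to `ε γ ‖ξ‖` with `ε`, and is dominated by a large gain `γ`; the constants of the expansion
do not depend on `γ`, so this choice is not circular. The outcome is a contraction by `1 - ε γ / 2`
per interval (`exists_stepEstimates`). Between sampling times the cube root turns the rate `γ / 2`
into `γ / 6` (`StepEstimates.norm_le_exp`).

Solutions need not be unique. Existence comes from Carathéodory's form of Peano's theorem on each
interval, and a speed bound `V` with `V ε < δ' - δ` keeps a solution starting in the ball of radius
`δ` inside a slightly larger closed ball in `D`. The contraction brings it back into the small ball,
so the pieces can be continued and glued forever. -/

noncomputable section

namespace DriftStab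

/-! ### Absolutely continuous functions and their a.e. derivatives. -/

section AbsolutelyContinuous

variable {E : Type*} [NormedAddCommGroup E]

theorem absCont_of_lipschitzOnWith {f : ℝ → E} {a b : ℝ} {L : NNReal} (hab : a ≤ b)
    (hf : LipschitzOnWith L f (Icc a b)) : AbsolutelyContinuousOnInterval f a b :=
  LipschitzOnWith.absolutelyContinuousOnInterval (by rwa [uIcc_of_le hab])

variable [NormedSpace ℝ E]

theorem lipschitzOnWith_integral {u : ℝ → E} {a b C : ℝ} (hC : 0 ≤ C)
    (hu : IntervalIntegrable u volume a b) (hab : a ≤ b) (hb : ∀ t ∈ Icc a b, ‖u t‖ ≤ C) :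
    LipschitzOnWith C.toNNReal (fun t => ∫ s in a..t, u s) (Icc a b) := by
  refine LipschitzOnWith.of_dist_le_mul fun s hs t ht => ?_
  rw [dist_eq_norm, Real.dist_eq, Real.coe_toNNReal _ hC]
  have h1 : ∀ r ∈ Icc a b, IntervalIntegrable u volume a r := fun r hr =>
    hu.mono_set (by rw [uIcc_of_le hr.1, uIcc_of_le hab]; exact Icc_subset_Icc_right hr.2)
  rw [intervalIntegral.integral_interval_sub_left (h1 s hs) (h1 t ht)]
  refine intervalIntegral.norm_integral_le_of_norm_le_const fun r hr => hb r ?_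
  rcases le_total s t with h | h
  · rw [uIoc_of_ge h] at hr; exact ⟨hs.1.trans hr.1.le, hr.2.trans ht.2⟩
  · rw [uIoc_of_le h] at hr; exact ⟨ht.1.trans hr.1.le, hr.2.trans hs.2⟩

variable [CompleteSpace E]

/-- `f` minus the primitive of `u` is absolutely continuous with derivative zero a.e., hence
constant. -/
theorem integral_eq_sub_of_absCont {f u : ℝ → E} {a b C : ℝ} (hab : a ≤ b) (hC : 0 ≤ C)
    (hf : AbsolutelyContinuousOnInterval f a b) (hu : IntervalIntegrable u volume a b)
    (hb : ∀ t ∈ Icc a b, ‖u t‖ ≤ C) (hd : ∀ᵐ t, t ∈ Icc a b → HasDerivAt f (u t) t) :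
    ∫ t in a..b, u t = f b - f a := by
  have h1 : AbsolutelyContinuousOnInterval (fun t => ∫ s in a..t, u s) a b :=
    absCont_of_lipschitzOnWith hab (lipschitzOnWith_integral hC hu hab hb)
  obtain ⟨c, hc⟩ := (hf.sub h1).const_of_ae_hasDerivAt_zero (by
    filter_upwards [hd, hu.ae_hasDerivAt_integral] with t h2 h3 h4
    have := (h2 (by rwa [uIcc_of_le hab] at h4)).sub (h3 h4 a left_mem_uIcc)
    simpa using this)
  have ha := hc a left_mem_uIcc
  have hb := hc b right_mem_uIcc
  simp only [Pi.sub_apply, intervalIntegral.integral_same, sub_zero] at ha hb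
  rw [ha, ← hb]; abel

variable [SecondCountableTopology E]

/-- The derivative is only asserted to exist with a bound, pointwise a.e.; thus no measurability of
`t ↦ g t (x t)` has to be known. Measurability is supplied by `deriv f`, cut off where it exceeds
`C`. -/
theorem norm_sub_le_of_absCont {f : ℝ → E} {a b C : ℝ} (hab : a ≤ b) (hC : 0 ≤ C)
    (hf : AbsolutelyContinuousOnInterval f a b)
    (hd : ∀ᵐ t, t ∈ Icc a b → ∃ v, HasDerivAt f v t ∧ ‖v‖ ≤ C) : ‖f b - f a‖ ≤ C * (b - a) := by
  borelize E
  let u : ℝ → E := {t | ‖deriv f t‖ ≤ C}.indicator (deriv f)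
  have hum : StronglyMeasurable u := (stronglyMeasurable_deriv f).indicator
    (measurableSet_le (measurable_deriv f).norm measurable_const)
  have hub : ∀ t, ‖u t‖ ≤ C := by
    intro t
    by_cases h : ‖deriv f t‖ ≤ C
    · simp [u, h]
    · simpa [u, h] using hC
  have hui : IntervalIntegrable u volume a b :=
    intervalIntegrable_const.mono_fun (f := fun _ => C) hum.aestronglyMeasurable
      (Filter.Eventually.of_forall fun t => by simpa [abs_of_nonneg hC] using hub t)
  rw [← integral_eq_sub_of_absCont hab hC hf hui (fun t _ => hub t)]
  · refine (intervalIntegral.norm_integral_le_of_norm_le_const (C := C) fun t _ => hub t).trans ?_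
    rw [abs_of_nonneg (sub_nonneg.2 hab)]
  · filter_upwards [hd] with t ht hm
    obtain ⟨v, hv, hvC⟩ := ht hm
    have : u t = v := by
      simp [u, hv.deriv, hvC]
    rwa [this]

theorem lipschitzOnWith_of_absCont {f : ℝ → E} {a b C : ℝ} (hab : a ≤ b) (hC : 0 ≤ C)
    (hf : AbsolutelyContinuousOnInterval f a b)
    (hd : ∀ᵐ t, t ∈ Icc a b → ∃ v, HasDerivAt f v t ∧ ‖v‖ ≤ C) :
    LipschitzOnWith C.toNNReal f (Icc a b) := by
  have key : ∀ s ∈ Icc a b, ∀ t ∈ Icc a b, s ≤ t → ‖f t - f s‖ ≤ C * (t - s) := by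
    intro s hs t ht hst
    refine norm_sub_le_of_absCont hst hC (hf.mono ?_) ?_
    · rw [uIcc_of_le hst, uIcc_of_le hab]; exact Icc_subset_Icc hs.1 ht.2
    · filter_upwards [hd] with r hr hr' using hr ⟨hs.1.trans hr'.1, hr'.2.trans ht.2⟩
  refine LipschitzOnWith.of_dist_le_mul fun s hs t ht => ?_
  rw [dist_eq_norm, Real.dist_eq, Real.coe_toNNReal _ hC]
  rcases le_total s t with h | h
  · rw [norm_sub_rev, abs_sub_comm, abs_of_nonneg (sub_nonneg.2 h)]; exact key s hs t ht h
  · rw [abs_of_nonneg (sub_nonneg.2 h)]; exact key t ht s hs h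

end AbsolutelyContinuous

/-! ### Carathéodory's existence theorem by Euler polygons and compactness. -/

section Peano

open Filter Topology BoundedContinuousFunction

variable {E : Type*} [NormedAddCommGroup E]

/-- The countably many level sets of `k` cover the line, and on each of them the space variable is
constant. This serves for the step functions of the Euler scheme. -/
theorem aestronglyMeasurable_comp_countable {H : ℝ → E → E} {μ : Measure ℝ}
    (hm : ∀ x, AEStronglyMeasurable (fun t => H t x) μ) {k : ℝ → ℕ} (hk : Measurable k)
    (ζ : ℕ → E) : AEStronglyMeasurable (fun s => H s (ζ (k s))) μ := by
  have h : (⋃ i, k ⁻¹' {i}) = univ := by ext; simp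
  rw [← Measure.restrict_univ (μ := μ), ← h]
  refine AEStronglyMeasurable.iUnion fun i => ?_
  refine ((hm (ζ i)).restrict (s := k ⁻¹' {i})).congr ?_
  filter_upwards [ae_restrict_mem (hk (measurableSet_singleton i))] with s hs
  have : k s = i := hs
  rw [this]

variable [NormedSpace ℝ E]

/-- The Euler polygons with step `(b - a) / N` of `z' = H t z`, through their step functions. -/
theorem exists_step_approximation {H : ℝ → E → E} {a b M : ℝ} (hab : a < b) (hM : 0 ≤ M)
    (hm : ∀ x, AEStronglyMeasurable (fun t => H t x) (volume.restrict (Icc a b)))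
    (hb : ∀ t ∈ Icc a b, ∀ x, ‖H t x‖ ≤ M) (z₀ : E) (N : ℕ) (hN : 0 < N) :
    ∃ c : ℝ → E, AEStronglyMeasurable (fun s => H s (c s)) (volume.restrict (Icc a b)) ∧
      ∀ t ∈ Icc a b, ‖(z₀ + ∫ s in a..t, H s (c s)) - c t‖ ≤ M * ((b - a) / N) := by
  set d : ℝ := (b - a) / N with hd
  have hN' : (0 : ℝ) < N := by exact_mod_cast hN
  have hd0 : 0 < d := div_pos (sub_pos.2 hab) hN'
  let ζ : ℕ → E := fun k => k.rec z₀ fun k x => x + ∫ s in (a + k * d)..(a + (k + 1 : ℕ) * d), H s x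
  have hζ : ∀ k, ζ (k + 1) = ζ k + ∫ s in (a + k * d)..(a + (k + 1 : ℕ) * d), H s (ζ k) :=
    fun k => rfl
  let k : ℝ → ℕ := fun s => ⌊(s - a) / d⌋₊
  have hk : Measurable k := Nat.measurable_floor.comp ((measurable_id.sub_const a).div_const d)
  have hcm := aestronglyMeasurable_comp_countable hm hk ζ
  refine ⟨fun s => ζ (k s), hcm, ?_⟩
  have hii : IntervalIntegrable (fun s => H s (ζ (k s))) volume a b := by
    rw [intervalIntegrable_iff_integrableOn_Icc_of_le hab.le]
    refine Integrable.of_bound hcm M ?_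
    filter_upwards [ae_restrict_mem measurableSet_Icc] with s hs using hb s hs _
  have hsub : ∀ s ∈ Icc a b, ∀ t ∈ Icc a b,
      IntervalIntegrable (fun s => H s (ζ (k s))) volume s t := fun s hs t ht =>
    hii.mono_set (by rw [uIcc_of_le hab.le]; exact uIcc_subset_Icc hs ht)
  have hgrid : ∀ i : ℕ, i ≤ N → a + i * d ∈ Icc a b := by
    intro i hi
    have : (i : ℝ) ≤ N := by exact_mod_cast hi
    refine ⟨by nlinarith [(Nat.cast_nonneg i : (0 : ℝ) ≤ i)], ?_⟩
    have : (i : ℝ) * d ≤ N * d := by gcongr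
    have h2 : (N : ℝ) * d = b - a := by rw [hd]; field_simp
    linarith
  have hval : ∀ i : ℕ, i ≤ N → z₀ + ∫ s in a..(a + i * d), H s (ζ (k s)) = ζ i := by
    intro i
    induction i with
    | zero => intro _; simp [ζ]
    | succ i ih =>
      intro hi
      have ha : a ∈ Icc a b := left_mem_Icc.2 hab.le
      rw [← intervalIntegral.integral_add_adjacent_intervals
        (hsub a ha _ (hgrid i (by omega))) (hsub _ (hgrid i (by omega)) _ (hgrid _ hi)),
        ← add_assoc, ih (by omega), hζ]
      congr 1
      refine intervalIntegral.integral_congr_ae ?_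
      -- At the right grid point the floor already equals `i + 1`; this single time is discarded.
      have hne : ∀ᵐ s : ℝ, s ≠ a + (i + 1 : ℕ) * d := by simp [ae_iff, measure_singleton]
      filter_upwards [hne] with s hs hmem
      have hle : a + i * d ≤ a + (i + 1 : ℕ) * d := by push_cast; nlinarith
      rw [uIoc_of_le hle] at hmem
      have : k s = i := by
        have h1 := hmem.1
        have h2 : s < a + (i + 1 : ℕ) * d := lt_of_le_of_ne hmem.2 hs
        refine (Nat.floor_eq_iff ?_).2 ⟨?_, ?_⟩
        · refine div_nonneg ?_ hd0.le
          nlinarith [(Nat.cast_nonneg i : (0 : ℝ) ≤ i)]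
        · rw [le_div_iff₀ hd0]; linarith
        · rw [div_lt_iff₀ hd0]; push_cast at h2; linarith
      rw [this]
  intro t ht
  have hta : 0 ≤ (t - a) / d := div_nonneg (sub_nonneg.2 ht.1) hd0.le
  have h1 : (k t : ℝ) ≤ (t - a) / d := Nat.floor_le hta
  have h2 : (t - a) / d < k t + 1 := Nat.lt_floor_add_one _
  rw [le_div_iff₀ hd0] at h1
  rw [div_lt_iff₀ hd0] at h2
  have hkN : k t ≤ N := by
    have : (t - a) / d ≤ N := by
      rw [div_le_iff₀ hd0, hd]; field_simp; linarith [ht.2]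
    have := (Nat.floor_mono this); rwa [Nat.floor_natCast] at this
  change ‖(z₀ + ∫ s in a..t, H s (ζ (k s))) - ζ (k t)‖ ≤ M * d
  rw [← hval (k t) hkN, add_sub_add_left_eq_sub, intervalIntegral.integral_interval_sub_left
    (hsub a (left_mem_Icc.2 hab.le) t ht) (hsub a (left_mem_Icc.2 hab.le) _ (hgrid _ hkN))]
  refine (intervalIntegral.norm_integral_le_of_norm_le_const (C := M) fun s hs => hb s ?_ _).trans ?_
  · rw [uIoc_of_le (by linarith)] at hs
    exact ⟨(hgrid _ hkN).1.trans hs.1.le, hs.2.trans ht.2⟩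
  · rw [abs_of_nonneg (by linarith)]; gcongr; linarith

/-- Carathéodory's extension of Peano's existence theorem, for a globally bounded field. -/
theorem exists_caratheodory_solution [FiniteDimensional ℝ E] {H : ℝ → E → E} {a b M : ℝ}
    (hab : a < b) (hM : 0 ≤ M)
    (hm : ∀ x, AEStronglyMeasurable (fun t => H t x) (volume.restrict (Icc a b)))
    (hc : ∀ t ∈ Icc a b, Continuous (H t)) (hb : ∀ t ∈ Icc a b, ∀ x, ‖H t x‖ ≤ M) (z₀ : E) :
    ∃ z : ℝ → E, z a = z₀ ∧ LipschitzOnWith M.toNNReal z (Icc a b) ∧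
      ∀ᵐ t, t ∈ Icc a b → HasDerivAt z (H t (z t)) t := by
  have : ProperSpace E := FiniteDimensional.proper ℝ E
  have hbm : ∀ c : ℝ → E, AEStronglyMeasurable (fun s => H s (c s)) (volume.restrict (Icc a b)) →
      IntervalIntegrable (fun s => H s (c s)) volume a b := by
    intro c hcm
    rw [intervalIntegrable_iff_integrableOn_Icc_of_le hab.le]
    refine Integrable.of_bound hcm M ?_
    filter_upwards [ae_restrict_mem measurableSet_Icc] with s hs using hb s hs _
  choose c hcm hcd using fun n : ℕ =>
    exists_step_approximation hab hM hm hb z₀ (n + 1) n.succ_pos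
  -- The polygons are all `M`-Lipschitz with the same initial value, so Arzelà–Ascoli gives a
  -- uniformly convergent subsequence.
  let w : ℕ → ℝ → E := fun n t => z₀ + ∫ s in a..t, H s (c n s)
  have hwL : ∀ n, LipschitzOnWith M.toNNReal (w n) (Icc a b) := fun n => by
    have h := lipschitzOnWith_integral hM (hbm _ (hcm n)) hab.le (fun t ht => hb t ht _)
    refine LipschitzOnWith.of_dist_le_mul fun s hs t ht => ?_
    simpa [w] using h.dist_le_mul s hs t ht
  have hwa : ∀ n, w n a = z₀ := fun n => by simp [w]
  have ha : a ∈ Icc a b := left_mem_Icc.2 hab.le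
  let W : ℕ → (Icc a b →ᵇ E) := fun n =>
    BoundedContinuousFunction.mkOfCompact ⟨(Icc a b).domRestrict (w n),
      continuousOn_iff_continuous_domRestrict.1 (hwL n).continuousOn⟩
  have hWv : ∀ n (t : Icc a b), W n t = w n t := fun n t => rfl
  have hcpt : IsCompact (closure (range W)) := by
    refine BoundedContinuousFunction.arzela_ascoli (Metric.closedBall z₀ (M * (b - a)))
      (isCompact_closedBall _ _) _ ?_ ?_
    · rintro _ t ⟨n, rfl⟩
      rw [hWv, Metric.mem_closedBall, ← hwa n]
      refine ((hwL n).dist_le_mul t t.2 a ha).trans ?_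
      rw [Real.coe_toNNReal _ hM, Real.dist_eq, abs_of_nonneg (sub_nonneg.2 t.2.1)]
      gcongr; exact t.2.2
    · refine Metric.equicontinuous_of_continuity_modulus (fun r => M * r) ?_ _ ?_
      · simpa using (by fun_prop : Continuous fun r : ℝ => M * r).tendsto 0
      · rintro s t ⟨_, n, rfl⟩
        have := (hwL n).dist_le_mul s s.2 t t.2
        rwa [Real.coe_toNNReal _ hM] at this
  obtain ⟨Z, -, φ, hφ, hlim⟩ := hcpt.tendsto_subseq (fun n => subset_closure (mem_range_self n))
  have hpt : ∀ t : Icc a b, Tendsto (fun n => w (φ n) t) atTop (𝓝 (Z t)) := fun t =>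
    ((continuous_eval_const t).tendsto Z).comp hlim
  let ζ : ℝ → E := fun t => Z (projIcc a b hab.le t)
  have hζ : ∀ t ∈ Icc a b, Tendsto (fun n => w (φ n) t) atTop (𝓝 (ζ t)) := fun t ht => by
    have := hpt ⟨t, ht⟩
    simpa [ζ, projIcc_of_mem hab.le ht] using this
  -- The step functions are within `M (b - a) / (n + 1)` of the polygons, so they have the same
  -- limit; dominated convergence then passes to the limit in the integral equation.
  have hcζ : ∀ t ∈ Icc a b, Tendsto (fun n => c (φ n) t) atTop (𝓝 (ζ t)) := fun t ht => by
    have h0 : Tendsto (fun n : ℕ => M * ((b - a) / ((n + 1 : ℕ) : ℝ))) atTop (𝓝 0) := by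
      have := (tendsto_const_div_atTop_nhds_zero_nat (b - a)).comp (tendsto_add_atTop_nat 1)
      simpa using this.const_mul M
    have h1 : Tendsto (fun n => w (φ n) t - c (φ n) t) atTop (𝓝 0) :=
      squeeze_zero_norm (fun n => hcd (φ n) t ht) (h0.comp hφ.tendsto_atTop)
    simpa using (hζ t ht).sub h1
  have hHζ : ∀ t ∈ Icc a b, Tendsto (fun n => H t (c (φ n) t)) atTop (𝓝 (H t (ζ t))) :=
    fun t ht => ((hc t ht).tendsto _).comp (hcζ t ht)
  have hζm : AEStronglyMeasurable (fun s => H s (ζ s)) (volume.restrict (Icc a b)) := by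
    refine aestronglyMeasurable_of_tendsto_ae atTop (fun n => hcm (φ n)) ?_
    filter_upwards [ae_restrict_mem measurableSet_Icc] with t ht using hHζ t ht
  have hint : ∀ t ∈ Icc a b, ζ t = z₀ + ∫ s in a..t, H s (ζ s) := by
    intro t ht
    refine tendsto_nhds_unique (hζ t ht) (tendsto_const_nhds.add ?_)
    have hsub : uIoc a t ⊆ Icc a b := by
      rw [uIoc_of_le ht.1]; exact fun s hs => ⟨hs.1.le, hs.2.trans ht.2⟩
    refine intervalIntegral.tendsto_integral_filter_of_dominated_convergence (fun _ => M)
      (Eventually.of_forall fun n => (hcm (φ n)).mono_set hsub)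
      (Eventually.of_forall fun n => Eventually.of_forall fun s hs => hb s (hsub hs) _)
      intervalIntegrable_const (Eventually.of_forall fun s hs => hHζ s (hsub hs))
  have hL := lipschitzOnWith_integral hM (hbm _ hζm) hab.le (fun t ht => hb t ht _)
  refine ⟨fun t => z₀ + ∫ s in a..t, H s (ζ s), by simp, ?_, ?_⟩
  · refine LipschitzOnWith.of_dist_le_mul fun s hs t ht => ?_
    simpa using hL.dist_le_mul s hs t ht
  · filter_upwards [(hbm _ hζm).ae_hasDerivAt_integral] with t h1 h2
    rw [uIcc_of_le hab.le] at h1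
    have := (h1 h2 a ha).const_add z₀
    rwa [← hint t h2]

end Peano

/-! ### Chen–Fliess expansion of order three with a bounded perturbation. -/

section ChenFliess

variable {E : Type*} [NormedAddCommGroup E] [NormedSpace ℝ E]
  {A : Type*} [Fintype A]

/-- The derivative of `φ` along the vector field `X`. -/
def lieD (X φ : E → E) (x : E) : E := fderiv ℝ φ x (X x)

/-- `y` solves `y' = G(t) + ∑ₚ vₚ(t) Fₚ(y)` on `[a, b]` inside `K`, with `‖G‖ ≤ Γ`. -/
structure IsForcedPath (K : Set E) (F : A → E → E) (v : A → ℝ → ℝ) (Γ a b : ℝ) (y : ℝ → E) :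
    Prop where
  le : a ≤ b
  nonneg : 0 ≤ Γ
  ac : AbsolutelyContinuousOnInterval y a b
  mem : ∀ t ∈ Icc a b, y t ∈ K
  deriv : ∀ᵐ t, t ∈ Icc a b → ∃ G, ‖G‖ ≤ Γ ∧ HasDerivAt y (G + ∑ p, v p t • F p (y t)) t

theorem IsForcedPath.continuousOn {K : Set E} {F : A → E → E} {v : A → ℝ → ℝ} {Γ a b : ℝ}
    {y : ℝ → E} (hy : IsForcedPath K F v Γ a b y) : ContinuousOn y (Icc a b) := by
  have := hy.ac.continuousOn; rwa [uIcc_of_le hy.le] at this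

theorem IsForcedPath.restrict {K : Set E} {F : A → E → E} {v : A → ℝ → ℝ} {Γ a b t : ℝ}
    {y : ℝ → E} (hy : IsForcedPath K F v Γ a b y) (ht : t ∈ Icc a b) :
    IsForcedPath K F v Γ a t y where
  le := ht.1
  nonneg := hy.nonneg
  ac := hy.ac.mono (by
    rw [uIcc_of_le ht.1, uIcc_of_le hy.le]; exact Icc_subset_Icc_right ht.2)
  mem s hs := hy.mem s ⟨hs.1, hs.2.trans ht.2⟩
  deriv := by
    filter_upwards [hy.deriv] with s hs h using hs ⟨h.1, h.2.trans ht.2⟩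

theorem continuousOn_lieD {D : Set E} (hD : IsOpen D) {X φ : E → E} (hX : ContinuousOn X D)
    (hφ : ContDiffOn ℝ 1 φ D) : ContinuousOn (lieD X φ) D :=
  (hφ.continuousOn_fderiv_of_isOpen hD le_rfl).clm_apply hX

theorem contDiffOn_lieD {D : Set E} (hD : IsOpen D) {X φ : E → E} {k l : ℕ∞}
    (hX : ContDiffOn ℝ k X D) (hφ : ContDiffOn ℝ l φ D) (hkl : k + 1 ≤ l) :
    ContDiffOn ℝ k (lieD X φ) D :=
  (hφ.fderiv_of_isOpen hD (by exact_mod_cast hkl)).clm_apply hX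

variable [FiniteDimensional ℝ E]

theorem IsForcedPath.lipschitz {K D : Set E} {F : A → E → E} {v : A → ℝ → ℝ} {Γ a b : ℝ}
    {y : ℝ → E} (hy : IsForcedPath K F v Γ a b y) (hKD : K ⊆ D)
    (hF : ∀ p, ContinuousOn (F p) D) (hv : ∀ p, Continuous (v p)) :
    ∃ L, LipschitzOnWith L y (Icc a b) := by
  have : CompleteSpace E := FiniteDimensional.complete ℝ E
  have hc : ContinuousOn (fun t => ∑ p, v p t • F p (y t)) (Icc a b) :=
    continuousOn_finsetSum _ fun p _ => (hv p).continuousOn.smul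
      ((hF p).comp hy.continuousOn fun t ht => hKD (hy.mem t ht))
  obtain ⟨B, hB⟩ := isCompact_Icc.exists_bound_of_continuousOn hc
  have hB0 : 0 ≤ B := (norm_nonneg _).trans (hB a (left_mem_Icc.2 hy.le))
  refine ⟨_, lipschitzOnWith_of_absCont hy.le (add_nonneg hy.nonneg hB0) hy.ac ?_⟩
  filter_upwards [hy.deriv] with t h ht
  obtain ⟨G, hG, hd⟩ := h ht
  exact ⟨_, hd, (norm_add_le _ _).trans (add_le_add hG (hB t ht))⟩

/-- Chain rule along the path: the driven part gives exactly the Lie derivatives, and the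
perturbation enters only through `Dφ(y) G`, of norm at most `C Γ`. Convexity of `K` makes `φ`
Lipschitz there, whence `φ ∘ y` is absolutely continuous. -/
theorem IsForcedPath.comp_sub_integral {K D : Set E} {F : A → E → E} {v : A → ℝ → ℝ} {Γ a b C : ℝ}
    {y : ℝ → E} (hy : IsForcedPath K F v Γ a b y) (hD : IsOpen D) (hKD : K ⊆ D)
    (hK : Convex ℝ K) (hF : ∀ p, ContinuousOn (F p) D) (hv : ∀ p, Continuous (v p))
    {φ : E → E} (hφ : ContDiffOn ℝ 1 φ D) (hC : ∀ x ∈ K, ‖fderiv ℝ φ x‖ ≤ C) :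
    ‖φ (y b) - φ (y a) - ∫ t in a..b, ∑ q, v q t • lieD (F q) φ (y t)‖ ≤ C * Γ * (b - a) := by
  have : CompleteSpace E := FiniteDimensional.complete ℝ E
  have hC0 : 0 ≤ C := (norm_nonneg _).trans (hC _ (hy.mem a (left_mem_Icc.2 hy.le)))
  obtain ⟨L, hL⟩ := hy.lipschitz hKD hF hv
  have hdiff : ∀ x ∈ K, DifferentiableAt ℝ φ x := fun x hx =>
    (hφ.differentiableOn one_ne_zero).differentiableAt (hD.mem_nhds (hKD hx))
  have hφL : LipschitzOnWith C.toNNReal φ K :=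
    LipschitzOnWith.of_dist_le_mul fun x hx z hz => by
      rw [Real.coe_toNNReal _ hC0, dist_eq_norm, dist_eq_norm]
      exact hK.norm_image_sub_le_of_norm_fderiv_le (fun w hw => hdiff w hw)
        (fun w hw => hC w hw) hz hx
  have hcont : ContinuousOn (fun t => ∑ q, v q t • lieD (F q) φ (y t)) (Icc a b) :=
    continuousOn_finsetSum _ fun q _ => (hv q).continuousOn.smul
      ((continuousOn_lieD hD (hF q) hφ).comp hy.continuousOn fun t ht => hKD (hy.mem t ht))
  have hii : IntervalIntegrable (fun t => ∑ q, v q t • lieD (F q) φ (y t)) volume a b :=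
    ContinuousOn.intervalIntegrable (by rwa [uIcc_of_le hy.le])
  obtain ⟨B, hB⟩ := isCompact_Icc.exists_bound_of_continuousOn hcont
  have hB0 : 0 ≤ B := (norm_nonneg _).trans (hB a (left_mem_Icc.2 hy.le))
  have h1 : AbsolutelyContinuousOnInterval (fun t => φ (y t)) a b :=
    absCont_of_lipschitzOnWith hy.le (hφL.comp hL hy.mem)
  have h2 : AbsolutelyContinuousOnInterval
      (fun t => ∫ s in a..t, ∑ q, v q s • lieD (F q) φ (y s)) a b :=
    absCont_of_lipschitzOnWith hy.le (lipschitzOnWith_integral hB0 hii hy.le hB)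
  have h3 := norm_sub_le_of_absCont hy.le (mul_nonneg hC0 hy.nonneg) (h1.sub h2) (by
    filter_upwards [hy.deriv, hii.ae_hasDerivAt_integral] with t ht1 ht2 ht
    obtain ⟨G, hG, hd⟩ := ht1 ht
    have h4 := ht2 (by rwa [uIcc_of_le hy.le]) a left_mem_uIcc
    have h5 := ((hdiff _ (hy.mem t ht)).hasFDerivAt.comp_hasDerivAt t hd).sub h4
    refine ⟨_, h5, ?_⟩
    have : fderiv ℝ φ (y t) (G + ∑ p, v p t • F p (y t)) -
        ∑ q, v q t • lieD (F q) φ (y t) = fderiv ℝ φ (y t) G := by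
      simp [lieD, map_add, map_sum]
    rw [this]
    refine (ContinuousLinearMap.le_opNorm _ _).trans ?_
    gcongr
    exact hC _ (hy.mem t ht))
  simp only [Pi.sub_apply, intervalIntegral.integral_same, sub_zero] at h3
  refine le_trans (le_of_eq ?_) h3
  congr 1; abel

/-- Replacing the integrands of `∫ ∑ vₚ χₚ` by approximations. -/
theorem norm_sub_integral_le {v : A → ℝ → ℝ} {χ P : A → ℝ → E} {a b U e e' : ℝ} (hab : a ≤ b)
    (hv : ∀ p, Continuous (v p)) (hχ : ∀ p, ContinuousOn (χ p) (Icc a b))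
    (hP : ∀ p, Continuous (P p)) (hU : ∀ p, ∀ t ∈ Icc a b, |v p t| ≤ U)
    (hχP : ∀ p, ∀ t ∈ Icc a b, ‖χ p t - P p t‖ ≤ e') {x x₀ : E}
    (h : ‖x - x₀ - ∫ t in a..b, ∑ p, v p t • χ p t‖ ≤ e) :
    ‖x - x₀ - ∑ p, ∫ t in a..b, v p t • P p t‖ ≤ e + Fintype.card A * (U * (b - a)) * e' := by
  have hi1 : ∀ p, IntervalIntegrable (fun t => v p t • χ p t) volume a b := fun p =>
    ContinuousOn.intervalIntegrable (by
      rw [uIcc_of_le hab]; exact (hv p).continuousOn.smul (hχ p))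
  have hi2 : ∀ p, IntervalIntegrable (fun t => v p t • P p t) volume a b := fun p =>
    ((hv p).smul (hP p)).intervalIntegrable _ _
  rw [intervalIntegral.integral_finsetSum fun p _ => hi1 p] at h
  have h1 : ‖∑ p, ((∫ t in a..b, v p t • χ p t) - ∫ t in a..b, v p t • P p t)‖
      ≤ Fintype.card A * (U * (b - a)) * e' := by
    refine (norm_sum_le _ _).trans ?_
    refine (Finset.sum_le_card_nsmul _ _ (U * (b - a) * e') fun p _ => ?_).trans ?_
    · rw [← intervalIntegral.integral_sub (hi1 p) (hi2 p)]
      refine (intervalIntegral.norm_integral_le_of_norm_le_const (C := U * e')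
        fun t ht => ?_).trans ?_
      · rw [uIoc_of_le hab] at ht
        have ht' : t ∈ Icc a b := ⟨ht.1.le, ht.2⟩
        rw [← smul_sub, norm_smul, Real.norm_eq_abs]
        exact mul_le_mul (hU p t ht') (hχP p t ht') (norm_nonneg _)
          ((abs_nonneg _).trans (hU p t ht'))
      · rw [abs_of_nonneg (sub_nonneg.2 hab)]; exact le_of_eq (by ring)
    · rw [nsmul_eq_mul, Finset.card_univ]; exact le_of_eq (by ring)
  rw [Finset.sum_sub_distrib] at h1
  calc _ = ‖(x - x₀ - ∑ p, ∫ t in a..b, v p t • χ p t) +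
        ((∑ p, ∫ t in a..b, v p t • χ p t) - ∑ p, ∫ t in a..b, v p t • P p t)‖ := by
          congr 1; abel
    _ ≤ _ := (norm_add_le _ _).trans (add_le_add h h1)

/-- The left-hand side is the unrolled recursion `e ↦ c g + N ω e`, applied three times to the
innermost error `c² g + c³ N ω`. Powers of `ω ≤ 1` are dropped except in the genuine fourth-order
term. -/
theorem chenFliess_remainder_le {N ω c g : ℝ} (hN0 : 0 ≤ N) (hω0 : 0 ≤ ω) (hω : ω ≤ 1) (hcc1 : 1 ≤ c)
    (hg : 0 ≤ g) : c * g * (1 + N * ω + (N * ω) ^ 2) + c * c * g * (N * ω) ^ 3 +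
      c ^ 3 * (N ^ 4 * ω ^ 4) ≤ (1 + N) ^ 4 * (4 * c ^ 3) * (g + ω ^ 4) := by
  have hx0 : 0 ≤ N * ω := by positivity
  have hxN : N * ω ≤ N := mul_le_of_le_one_right hN0 hω
  have hB1 : N ≤ (1 + N) ^ 4 := by
    calc N ≤ 1 + N := by linarith
      _ ≤ _ := le_self_pow₀ (by linarith) (by norm_num)
  have hB2 : N ^ 2 ≤ (1 + N) ^ 4 := by
    calc N ^ 2 ≤ (1 + N) ^ 2 := pow_le_pow_left₀ hN0 (by linarith) 2
      _ ≤ _ := pow_le_pow_right₀ (by linarith) (by norm_num)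
  have hB3 : N ^ 3 ≤ (1 + N) ^ 4 := by
    calc N ^ 3 ≤ (1 + N) ^ 3 := pow_le_pow_left₀ hN0 (by linarith) 3
      _ ≤ _ := pow_le_pow_right₀ (by linarith) (by norm_num)
  have hB4 : N ^ 4 ≤ (1 + N) ^ 4 := by exact pow_le_pow_left₀ hN0 (by linarith) 4
  have hB0 : 1 ≤ (1 + N) ^ 4 := one_le_pow₀ (by linarith)
  generalize (1 + N) ^ 4 = B at *
  have hc13 : c ≤ c ^ 3 := le_self_pow₀ hcc1 (by norm_num)
  have hc23 : c * c ≤ c ^ 3 := by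
    calc c * c = c ^ 2 := by ring
      _ ≤ _ := pow_le_pow_right₀ hcc1 (by norm_num)
  have hp2 : (N * ω) ^ 2 ≤ B := (pow_le_pow_left₀ hx0 hxN 2).trans hB2
  have hp3 : (N * ω) ^ 3 ≤ B := (pow_le_pow_left₀ hx0 hxN 3).trans hB3
  have hω4 : 0 ≤ ω ^ 4 := by positivity
  calc c * g * (1 + N * ω + (N * ω) ^ 2) + c * c * g * (N * ω) ^ 3 + c ^ 3 * (N ^ 4 * ω ^ 4)
      ≤ c ^ 3 * g * (B + B + B) + c ^ 3 * g * B + c ^ 3 * (B * ω ^ 4) := by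
        gcongr; exact hxN.trans hB1
    _ ≤ B * (4 * c ^ 3) * (g + ω ^ 4) := by
        have h : 0 ≤ c ^ 3 * (B * ω ^ 4) := by positivity
        linarith

theorem integral_smul_add_sum {u : ℝ → ℝ} {x : E} {W : A → ℝ → E} {a b : ℝ} (hu : Continuous u)
    (hW : ∀ q, Continuous (W q)) : ∫ s in a..b, u s • (x + ∑ q, W q s) =
      (∫ s in a..b, u s) • x + ∑ q, ∫ s in a..b, u s • W q s := by
  simp only [smul_add, Finset.smul_sum]
  rw [intervalIntegral.integral_add, intervalIntegral.integral_finsetSum,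
    intervalIntegral.integral_smul_const]
  · exact fun q _ => (hu.smul (hW q)).intervalIntegrable _ _
  · exact (hu.smul continuous_const).intervalIntegrable _ _
  · exact (continuous_finsetSum _ fun q _ => hu.smul (hW q)).intervalIntegrable _ _

/-- The Chen–Fliess expansion of order three. -/
theorem chenFliess {K D : Set E} {F : A → E → E} (hD : IsOpen D) (hKD : K ⊆ D)
    (hKc : IsCompact K) (hK : Convex ℝ K) (hF : ∀ p, ContDiffOn ℝ 3 (F p) D) :
    ∃ C, 0 ≤ C ∧ ∀ (v : A → ℝ → ℝ) (Γ a b U : ℝ) (y : ℝ → E), IsForcedPath K F v Γ a b y →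
      (∀ p, Continuous (v p)) → (∀ p, ∀ t ∈ Icc a b, |v p t| ≤ U) → 0 ≤ U → U * (b - a) ≤ 1 →
      ‖y b - y a - ∑ p, ((∫ t in a..b, v p t) • F p (y a) +
          ∑ q, ((∫ t in a..b, v p t * ∫ s in a..t, v q s) • lieD (F q) (F p) (y a) +
            ∑ r, (∫ t in a..b, v p t * ∫ s in a..t, v q s * ∫ l in a..s, v r l) •
              lieD (F r) (lieD (F q) (F p)) (y a)))‖
        ≤ C * (Γ * (b - a) + (U * (b - a)) ^ 4) := by
  have hF0 : ∀ p, ContinuousOn (F p) D := fun p => (hF p).continuousOn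
  have hF1 : ∀ p, ContDiffOn ℝ 1 (F p) D := fun p => (hF p).of_le (by norm_num)
  have hF2 : ∀ q p, ContDiffOn ℝ 2 (lieD (F q) (F p)) D := fun q p =>
    contDiffOn_lieD (k := 2) (l := 3) hD ((hF q).of_le (by norm_num)) (hF p) (by norm_num)
  have hF21 : ∀ q p, ContDiffOn ℝ 1 (lieD (F q) (F p)) D := fun q p =>
    (hF2 q p).of_le (by norm_num)
  have hF3 : ∀ r q p, ContDiffOn ℝ 1 (lieD (F r) (lieD (F q) (F p))) D := fun r q p =>
    contDiffOn_lieD (k := 1) (l := 2) hD ((hF r).of_le (by norm_num)) (hF2 q p) (by norm_num)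
  have hbd : ∀ φ : E → E, ContDiffOn ℝ 1 φ D → ∃ C, 0 ≤ C ∧ ∀ x ∈ K, ‖fderiv ℝ φ x‖ ≤ C := by
    intro φ hφ
    obtain ⟨C, hC⟩ := hKc.exists_bound_of_continuousOn
      ((hφ.continuousOn_fderiv_of_isOpen hD le_rfl).mono hKD)
    exact ⟨max C 0, le_max_right _ _, fun x hx => (hC x hx).trans (le_max_left _ _)⟩
  have hbd0 : ∀ φ : E → E, ContinuousOn φ D → ∃ C, 0 ≤ C ∧ ∀ x ∈ K, ‖φ x‖ ≤ C := by
    intro φ hφ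
    obtain ⟨C, hC⟩ := hKc.exists_bound_of_continuousOn (hφ.mono hKD)
    exact ⟨max C 0, le_max_right _ _, fun x hx => (hC x hx).trans (le_max_left _ _)⟩
  choose c0 hc0 hc0' using fun p => hbd0 (F p) (hF0 p)
  choose c1 hc1 hc1' using fun p => hbd (F p) (hF1 p)
  choose c2 hc2 hc2' using fun p q => hbd _ (hF21 q p)
  choose c3 hc3 hc3' using fun p q r => hbd _ (hF3 r q p)
  -- One constant for all fields and derivatives; `1 ≤ c` makes its powers comparable and also
  -- covers the identity map.
  obtain ⟨c, hcc1, hcc0, hcc⟩ : ∃ c : ℝ, 1 ≤ c ∧ (∀ p, c0 p ≤ c) ∧ ∀ p, c1 p ≤ c ∧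
      ∀ q, c2 p q ≤ c ∧ ∀ r, c3 p q r ≤ c := by
    refine ⟨1 + ∑ p, (c0 p + (c1 p + ∑ q, (c2 p q + ∑ r, c3 p q r))), ?_, ?_, ?_⟩
    · have : 0 ≤ ∑ p, (c0 p + (c1 p + ∑ q, (c2 p q + ∑ r, c3 p q r))) :=
        Finset.sum_nonneg fun p _ => add_nonneg (hc0 p) (add_nonneg (hc1 p)
          (Finset.sum_nonneg fun q _ => add_nonneg (hc2 p q)
            (Finset.sum_nonneg fun r _ => hc3 p q r)))
      linarith
    all_goals
      intro p
      have h2 : ∀ q, 0 ≤ c2 p q + ∑ r, c3 p q r := fun q => add_nonneg (hc2 p q)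
            (Finset.sum_nonneg fun r _ => hc3 p q r)
      have hp := Finset.single_le_sum (f := fun p => c0 p + (c1 p + ∑ q, (c2 p q + ∑ r, c3 p q r)))
        (fun p _ => add_nonneg (hc0 p) (add_nonneg (hc1 p)
          (Finset.sum_nonneg fun q _ => add_nonneg (hc2 p q)
            (Finset.sum_nonneg fun r _ => hc3 p q r)))) (Finset.mem_univ p)
      have h20 : 0 ≤ ∑ q, (c2 p q + ∑ r, c3 p q r) := Finset.sum_nonneg fun q _ => h2 q
      have := hc0 p
      have := hc1 p
      try refine ⟨by linarith, fun q => ?_⟩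
      try linarith
    have hq := Finset.single_le_sum (f := fun q => c2 p q + ∑ r, c3 p q r)
      (fun q _ => h2 q) (Finset.mem_univ q)
    have hr0 : 0 ≤ ∑ r, c3 p q r := Finset.sum_nonneg fun r _ => hc3 p q r
    have := hc2 p q
    refine ⟨by linarith, fun r => ?_⟩
    have hr := Finset.single_le_sum (f := fun r => c3 p q r)
      (fun r _ => hc3 p q r) (Finset.mem_univ r)
    linarith
  set N : ℝ := (Fintype.card A : ℝ) with hN
  have hN0 : 0 ≤ N := Nat.cast_nonneg _
  refine ⟨(1 + N) ^ 4 * (4 * c ^ 3), by positivity, ?_⟩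
  intro v Γ a b U y hy hv hU hU0 hω
  have hab := hy.le
  set T := b - a with hT
  have hT0 : 0 ≤ T := sub_nonneg.2 hab
  set ω := U * T with hωd
  have hω0 : 0 ≤ ω := mul_nonneg hU0 hT0
  have hΓ := hy.nonneg
  have hV1 : ∀ p, Continuous fun t => ∫ s in a..t, v p s := fun p =>
    intervalIntegral.continuous_primitive (fun _ _ => (hv p).intervalIntegrable _ _) a
  have hV2 : ∀ q r, Continuous fun t => ∫ s in a..t, v q s * ∫ l in a..s, v r l := fun q r =>
    intervalIntegral.continuous_primitive
      (fun _ _ => ((hv q).mul (hV1 r)).intervalIntegrable _ _) a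
  have hcy : ∀ φ : E → E, ContinuousOn φ D → ContinuousOn (fun t => φ (y t)) (Icc a b) :=
    fun φ hφ => hφ.comp hy.continuousOn fun t ht => hKD (hy.mem t ht)
  have hUt : ∀ t ∈ Icc a b, ∀ p, ∀ s ∈ Icc a t, |v p s| ≤ U := fun t ht p s hs =>
    hU p s ⟨hs.1, hs.2.trans ht.2⟩
  have hsubI : ∀ t ∈ Icc a b, Icc a t ⊆ Icc a b := fun t ht => Icc_subset_Icc_right ht.2
  -- The induction step of the expansion: if the Lie derivatives of `φ` along the path are known up
  -- to `e'`, then `φ` itself is known up to `c Γ T + N ω e'`. Each use gains a factor `ω`. It is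
  -- applied from the innermost Lie derivative outwards.
  have key : ∀ (φ : E → E) (χ P : A → ℝ → E) (e' C : ℝ), ContDiffOn ℝ 1 φ D →
      (∀ x ∈ K, ‖fderiv ℝ φ x‖ ≤ C) → C ≤ c → (∀ p, Continuous (P p)) → 0 ≤ e' →
      (∀ p t, χ p t = lieD (F p) φ (y t)) →
      (∀ p, ∀ t ∈ Icc a b, ‖χ p t - P p t‖ ≤ e') → ∀ t ∈ Icc a b,
      ‖φ (y t) - φ (y a) - ∑ p, ∫ s in a..t, v p s • P p s‖ ≤ c * Γ * T + N * ω * e' := by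
    intro φ χ P e' C hφ hC hCc hP he' hχ hχP t ht
    have h1 := (hy.restrict ht).comp_sub_integral hD hKD hK hF0 hv hφ hC
    have h2 := norm_sub_integral_le (χ := fun p t => lieD (F p) φ (y t)) ht.1 hv
      (fun p => (hcy _ (continuousOn_lieD hD (hF0 p) hφ)).mono (hsubI t ht)) hP (hUt t ht)
      (fun p s hs => by rw [← hχ]; exact hχP p s (hsubI t ht hs)) h1
    refine h2.trans ?_
    have : t - a ≤ T := by rw [hT]; linarith [ht.2]
    have : 0 ≤ t - a := sub_nonneg.2 ht.1
    have : U * (t - a) ≤ ω := by rw [hωd]; gcongr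
    gcongr
  have hy0 : ∀ t ∈ Icc a b, ‖y t - y a‖ ≤ c * (Γ * T + N * ω * c) := by
    intro t ht
    have h := key id (fun p t => F p (y t)) (fun _ _ => 0) c 1 contDiff_id.contDiffOn
      (fun x _ => by rw [fderiv_id]; exact ContinuousLinearMap.norm_id_le) hcc1
      (fun _ => continuous_const) (by linarith)
      (fun p t => by simp [lieD]) (fun p t ht => by
        rw [sub_zero]; exact (hc0' p _ (hy.mem t ht)).trans (hcc0 p)) t ht
    simp only [id, smul_zero, intervalIntegral.integral_zero, Finset.sum_const_zero,
      sub_zero] at h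
    refine h.trans ?_
    have : 0 ≤ N * ω * c := by positivity
    nlinarith
  -- The innermost level is not expanded but frozen at `y a`; one derivative of the third-level
  -- field suffices for this, which is why `C³` is enough.
  have h3 : ∀ p q r, ∀ t ∈ Icc a b, ‖lieD (F r) (lieD (F q) (F p)) (y t) -
      lieD (F r) (lieD (F q) (F p)) (y a)‖ ≤ c * (c * (Γ * T + N * ω * c)) := by
    intro p q r t ht
    refine (hK.norm_image_sub_le_of_norm_fderiv_le (fun w hw => ((hF3 r q p).differentiableOn
      one_ne_zero).differentiableAt (hD.mem_nhds (hKD hw))) (fun w hw =>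
        (hc3' p q r w hw).trans (((hcc p).2 q).2 r)) (hy.mem a (left_mem_Icc.2 hab))
        (hy.mem t ht)).trans ?_
    gcongr
    exact hy0 t ht
  set e3 := c * (c * (Γ * T + N * ω * c)) with he3
  have he30 : 0 ≤ e3 := by positivity
  have h2 : ∀ p q, ∀ t ∈ Icc a b, ‖lieD (F q) (F p) (y t) - (lieD (F q) (F p) (y a) +
      ∑ r, (∫ s in a..t, v r s) • lieD (F r) (lieD (F q) (F p)) (y a))‖
        ≤ c * Γ * T + N * ω * e3 := by
    intro p q t ht
    have h := key (lieD (F q) (F p)) (fun r t => lieD (F r) (lieD (F q) (F p)) (y t))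
      (fun r _ => lieD (F r) (lieD (F q) (F p)) (y a)) e3 _ (hF21 q p) (hc2' p q)
      ((hcc p).2 q).1 (fun _ => continuous_const) he30 (fun _ _ => rfl) (h3 p q) t ht
    simp only [intervalIntegral.integral_smul_const] at h
    rwa [← sub_sub]
  set e2 := c * Γ * T + N * ω * e3 with he2
  have he20 : 0 ≤ e2 := by positivity
  have hsplit : ∀ (u : ℝ → ℝ) (x : E) (w : A → ℝ → ℝ) (d : A → E) (t : ℝ), Continuous u →
      (∀ r, Continuous (w r)) → ∫ s in a..t, u s • (x + ∑ r, w r s • d r) =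
        (∫ s in a..t, u s) • x + ∑ r, (∫ s in a..t, u s * w r s) • d r := by
    intro u x w d t hu hw
    simp only [smul_add, Finset.smul_sum, smul_smul]
    rw [intervalIntegral.integral_add, intervalIntegral.integral_finsetSum]
    · simp only [intervalIntegral.integral_smul_const]
    · exact fun r _ => (((hu.mul (hw r)).smul continuous_const).intervalIntegrable _ _)
    · exact (hu.smul continuous_const).intervalIntegrable _ _
    · exact (continuous_finsetSum _ fun r _ =>
        ((hu.mul (hw r)).smul continuous_const)).intervalIntegrable _ _
  have h1 : ∀ p, ∀ t ∈ Icc a b, ‖F p (y t) - (F p (y a) +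
      ∑ q, ((∫ s in a..t, v q s) • lieD (F q) (F p) (y a) +
      ∑ r, (∫ s in a..t, v q s * ∫ l in a..s, v r l) •
        lieD (F r) (lieD (F q) (F p)) (y a)))‖ ≤ c * Γ * T + N * ω * e2 := by
    intro p t ht
    have h := key (F p) (fun q t => lieD (F q) (F p) (y t))
      (fun q t => lieD (F q) (F p) (y a) +
        ∑ r, (∫ s in a..t, v r s) • lieD (F r) (lieD (F q) (F p)) (y a)) e2 _ (hF1 p) (hc1' p)
      (hcc p).1 (fun q => continuous_const.add (continuous_finsetSum _ fun r _ =>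
        (hV1 r).smul continuous_const)) he20 (fun _ _ => rfl) (h2 p) t ht
    simp only [hsplit _ _ _ _ _ (hv _) hV1] at h
    rwa [← sub_sub]
  set e1 := c * Γ * T + N * ω * e2 with he1
  have he10 : 0 ≤ e1 := by positivity
  have hsplit2 : ∀ (p : A) , ∫ s in a..b, v p s • (F p (y a) +
      ∑ q, ((∫ l in a..s, v q l) • lieD (F q) (F p) (y a) +
      ∑ r, (∫ l in a..s, v q l * ∫ m in a..l, v r m) •
        lieD (F r) (lieD (F q) (F p)) (y a))) = (∫ t in a..b, v p t) • F p (y a) +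
          ∑ q, ((∫ t in a..b, v p t * ∫ s in a..t, v q s) • lieD (F q) (F p) (y a) +
            ∑ r, (∫ t in a..b, v p t * ∫ s in a..t, v q s * ∫ l in a..s, v r l) •
              lieD (F r) (lieD (F q) (F p)) (y a)) := by
    intro p
    have hc' : ∀ q, Continuous fun s => (∫ l in a..s, v q l) • lieD (F q) (F p) (y a) +
      ∑ r, (∫ l in a..s, v q l * ∫ m in a..l, v r m) •
        lieD (F r) (lieD (F q) (F p)) (y a) := fun q =>
      ((hV1 q).smul continuous_const).add (continuous_finsetSum _ fun r _ =>
        (hV2 q r).smul continuous_const)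
    rw [integral_smul_add_sum (hv p) hc']
    congr 1
    refine Finset.sum_congr rfl fun q _ => ?_
    have := hsplit (v p) 0 (fun r s => ∫ l in a..s, v q l * ∫ m in a..l, v r m)
      (fun r => lieD (F r) (lieD (F q) (F p)) (y a)) b (hv p) (hV2 q)
    simp only [zero_add, smul_zero] at this
    rw [← this, ← intervalIntegral.integral_smul_const, ← intervalIntegral.integral_add]
    · simp only [smul_add, smul_smul]
    · exact ((((hv p).mul (hV1 q)).smul continuous_const).intervalIntegrable _ _)
    · exact ((hv p).smul (continuous_finsetSum _ fun r _ =>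
        (hV2 q r).smul continuous_const)).intervalIntegrable _ _
  have h0 := key id (fun p t => F p (y t)) (fun p s => F p (y a) +
      ∑ q, ((∫ l in a..s, v q l) • lieD (F q) (F p) (y a) +
      ∑ r, (∫ l in a..s, v q l * ∫ m in a..l, v r m) •
        lieD (F r) (lieD (F q) (F p)) (y a))) e1 1 contDiff_id.contDiffOn
      (fun x _ => by rw [fderiv_id]; exact ContinuousLinearMap.norm_id_le) hcc1
      (fun p => continuous_const.add (continuous_finsetSum _ fun q _ =>
        ((hV1 q).smul continuous_const).add (continuous_finsetSum _ fun r _ =>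
        (hV2 q r).smul continuous_const))) he10
      (fun p t => by simp [lieD]) h1 b (right_mem_Icc.2 hab)
  simp only [id, hsplit2] at h0
  refine h0.trans ?_
  set g := Γ * T
  have hg : 0 ≤ g := mul_nonneg hΓ hT0
  have e : c * Γ * T + N * ω * e1 = c * g * (1 + N * ω + (N * ω) ^ 2)
      + c * c * g * (N * ω) ^ 3 + c ^ 3 * (N ^ 4 * ω ^ 4) := by
    rw [he1, he2, he3]; simp only [g]; ring
  rw [e]
  exact chenFliess_remainder_le hN0 hω0 hω hcc1 hg

end ChenFliess

/-! ### Exact iterated integrals of oscillations over one period. -/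

section Oscillation

/-- The oscillation with `k` periods in time `ε` and phase `n` quarter turns. -/
def osc (ε : ℝ) (k n : ℤ) (t : ℝ) : ℝ :=
  Real.cos (2 * Real.pi * k / ε * t + n * (Real.pi / 2))

/-- The value of `cos (n π / 2)`. -/
def qcos (n : ℤ) : ℤ := if n % 4 = 0 then 1 else if n % 4 = 2 then -1 else 0

theorem cos_int_mul_pi_div_two (n : ℤ) : Real.cos (n * (Real.pi / 2)) = qcos n := by
  obtain ⟨m, r, hr0, hr4, rfl⟩ : ∃ m r : ℤ, 0 ≤ r ∧ r < 4 ∧ n = r + 4 * m :=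
    ⟨n / 4, n % 4, Int.emod_nonneg _ (by norm_num), Int.emod_lt_of_pos _ (by norm_num),
      (Int.emod_add_mul_ediv n 4).symm⟩
  have h : ((r + 4 * m : ℤ) : ℝ) * (Real.pi / 2) = r * (Real.pi / 2) + m * (2 * Real.pi) := by
    push_cast; ring
  rw [h, Real.cos_add_int_mul_two_pi]
  unfold qcos
  rw [Int.add_mul_emod_self_left]
  interval_cases r
  · simp
  · simp
  · have : ((2 : ℤ) : ℝ) * (Real.pi / 2) = Real.pi := by push_cast; ring
    rw [this]; simp
  · have : ((3 : ℤ) : ℝ) * (Real.pi / 2) = Real.pi / 2 + Real.pi := by push_cast; ring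
    rw [this, Real.cos_add_pi]; simp

@[fun_prop]
theorem continuous_osc (ε : ℝ) (k n : ℤ) : Continuous (osc ε k n) := by
  unfold osc; fun_prop

theorem abs_osc_le (ε : ℝ) (k n : ℤ) (t : ℝ) : |osc ε k n t| ≤ 1 := Real.abs_cos_le_one _

theorem osc_mul_osc (ε : ℝ) (k n l m : ℤ) (t : ℝ) : osc ε k n t * osc ε l m t =
    (osc ε (k + l) (n + m) t + osc ε (k - l) (n - m) t) / 2 := by
  have h1 : 2 * Real.pi * (k + l : ℤ) / ε * t + (n + m : ℤ) * (Real.pi / 2) =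
      (2 * Real.pi * k / ε * t + n * (Real.pi / 2)) +
        (2 * Real.pi * l / ε * t + m * (Real.pi / 2)) := by push_cast; ring
  have h2 : 2 * Real.pi * (k - l : ℤ) / ε * t + (n - m : ℤ) * (Real.pi / 2) =
      (2 * Real.pi * k / ε * t + n * (Real.pi / 2)) -
        (2 * Real.pi * l / ε * t + m * (Real.pi / 2)) := by push_cast; ring
  unfold osc
  rw [h1, h2]
  generalize 2 * Real.pi * k / ε * t + n * (Real.pi / 2) = x
  generalize 2 * Real.pi * l / ε * t + m * (Real.pi / 2) = y
  rw [Real.cos_add, Real.cos_sub]; ring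

theorem hasDerivAt_osc {ε : ℝ} (hε : ε ≠ 0) {k : ℤ} (hk : k ≠ 0) (n : ℤ) (t : ℝ) :
    HasDerivAt (fun t => ε / (2 * Real.pi * k) * osc ε k (n - 1) t) (osc ε k n t) t := by
  have hk' : (k : ℝ) ≠ 0 := by exact_mod_cast hk
  have h1 : HasDerivAt (fun t => 2 * Real.pi * k / ε * t + (n - 1 : ℤ) * (Real.pi / 2))
      (2 * Real.pi * k / ε) t := by
    simpa using ((hasDerivAt_id t).const_mul (2 * Real.pi * k / ε)).add_const
      (((n - 1 : ℤ) : ℝ) * (Real.pi / 2))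
  have h2 := (h1.cos).const_mul (ε / (2 * Real.pi * k))
  have h3 : 2 * Real.pi * k / ε * t + (n - 1 : ℤ) * (Real.pi / 2) =
      (2 * Real.pi * k / ε * t + n * (Real.pi / 2)) - Real.pi / 2 := by push_cast; ring
  refine h2.congr_deriv ?_
  rw [h3, Real.sin_sub_pi_div_two]
  unfold osc
  have := Real.pi_ne_zero
  field_simp

/-- Phases in quarter turns are preserved by products and by antiderivatives (a shift by `-1`), so
all boundary values are integers depending on the phase alone. -/
theorem osc_period {ε : ℝ} (hε : ε ≠ 0) (k n j : ℤ) : osc ε k n (ε * j) = qcos n := by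
  unfold osc
  have : 2 * Real.pi * k / ε * (ε * j) + n * (Real.pi / 2) =
      n * (Real.pi / 2) + (k * j : ℤ) * (2 * Real.pi) := by push_cast; field_simp; ring
  rw [this, Real.cos_add_int_mul_two_pi, cos_int_mul_pi_div_two]

theorem integral_osc_primitive {ε : ℝ} (hε : ε ≠ 0) {k : ℤ} (hk : k ≠ 0) (n : ℤ) (a t : ℝ) :
    ∫ s in a..t, osc ε k n s =
      ε / (2 * Real.pi * k) * osc ε k (n - 1) t - ε / (2 * Real.pi * k) * osc ε k (n - 1) a :=
  intervalIntegral.integral_eq_sub_of_hasDerivAt (fun s _ => hasDerivAt_osc hε hk n s)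
    ((continuous_osc ε k n).intervalIntegrable _ _)

theorem integral_osc {ε : ℝ} (hε : ε ≠ 0) (k n j : ℤ) :
    ∫ s in (ε * j)..(ε * (j + 1)), osc ε k n s = if k = 0 then ε * qcos n else 0 := by
  split_ifs with hk
  · subst hk
    have : ∀ s, osc ε 0 n s = qcos n := fun s => by
      rw [← cos_int_mul_pi_div_two]; simp [osc]
    simp only [this, intervalIntegral.integral_const, smul_eq_mul]
    ring
  · rw [integral_osc_primitive hε hk]
    have h1 := osc_period hε k (n - 1) j
    have h2 := osc_period hε k (n - 1) (j + 1)
    push_cast at h2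
    rw [h1, h2, sub_self]

/-- In the product formula the sum frequency is positive and integrates to zero; only the difference
can contribute. -/
theorem integral_osc_mul {ε : ℝ} (hε : ε ≠ 0) {k l : ℤ} (hk : 0 < k) (hl : 0 < l) (n m j : ℤ) :
    ∫ s in (ε * j)..(ε * (j + 1)), osc ε k n s * osc ε l m s =
      if k = l then ε * qcos (n - m) / 2 else 0 := by
  simp only [osc_mul_osc]
  rw [intervalIntegral.integral_div, intervalIntegral.integral_add
    ((continuous_osc _ _ _).intervalIntegrable _ _)
    ((continuous_osc _ _ _).intervalIntegrable _ _), integral_osc hε, integral_osc hε,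
    if_neg (by omega)]
  by_cases h : k = l
  · simp [h]
  · rw [if_neg (by omega), if_neg h]; simp

theorem integral_osc_mul_mul {ε : ℝ} (hε : ε ≠ 0) {k l i : ℤ} (hk : 0 < k) (hl : 0 < l)
    (hi : 0 < i) (n m o j : ℤ) :
    ∫ s in (ε * j)..(ε * (j + 1)), osc ε k n s * osc ε l m s * osc ε i o s =
      ε / 4 * ((if k + l = i then (qcos (n + m - o) : ℝ) else 0) +
        (if k + i = l then (qcos (n - m + o) : ℝ) else 0) +
        (if k = l + i then (qcos (n - m - o) : ℝ) else 0)) := by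
  have hc := fun k n => (continuous_osc ε k n).intervalIntegrable (μ := volume)
    (ε * j) (ε * (j + 1))
  have h : ∀ s, osc ε k n s * osc ε l m s * osc ε i o s =
      (osc ε (k + l + i) (n + m + o) s + osc ε (k + l - i) (n + m - o) s +
        osc ε (k - l + i) (n - m + o) s + osc ε (k - l - i) (n - m - o) s) / 4 := fun s => by
    rw [osc_mul_osc, div_mul_eq_mul_div, add_mul, osc_mul_osc, osc_mul_osc]; ring
  simp only [h]
  rw [intervalIntegral.integral_div, intervalIntegral.integral_add
    (((hc _ _).add (hc _ _)).add (hc _ _)) (hc _ _), intervalIntegral.integral_add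
    ((hc _ _).add (hc _ _)) (hc _ _), intervalIntegral.integral_add (hc _ _) (hc _ _),
    integral_osc hε, integral_osc hε, integral_osc hε, integral_osc hε, if_neg (by omega)]
  have e1 : k + l - i = 0 ↔ k + l = i := by omega
  have e2 : k - l + i = 0 ↔ k + i = l := by omega
  have e3 : k - l - i = 0 ↔ k = l + i := by omega
  simp only [e1, e2, e3]
  split_ifs <;> ring

/-- The second iterated integral of two oscillations over a period. -/
theorem iterated_integral_osc_two {ε : ℝ} (hε : ε ≠ 0) {k l : ℤ} (hk : 0 < k) (hl : 0 < l)
    (n m j : ℤ) :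
    ∫ t in (ε * j)..(ε * (j + 1)), osc ε k n t * ∫ s in (ε * j)..t, osc ε l m s =
      if k = l then ε ^ 2 * qcos (n - m + 1) / (4 * Real.pi * k) else 0 := by
  simp only [integral_osc_primitive hε hl.ne', mul_sub]
  rw [intervalIntegral.integral_sub (Continuous.intervalIntegrable (by fun_prop) _ _)
    (Continuous.intervalIntegrable (by fun_prop) _ _),
    -- The integration constant of the inner primitive multiplies an integral over full periods and
    -- drops out.
    intervalIntegral.integral_mul_const, integral_osc hε, if_neg hk.ne', zero_mul, sub_zero]
  simp only [mul_left_comm _ (ε / (2 * Real.pi * l))]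
  rw [intervalIntegral.integral_const_mul, integral_osc_mul hε hk hl]
  split_ifs with h
  · subst h
    have : (k : ℝ) ≠ 0 := by exact_mod_cast hk.ne'
    have := Real.pi_ne_zero
    rw [sub_sub_eq_add_sub, show n + 1 - m = n - m + 1 by ring]
    field_simp; norm_num; ring
  · simp

/-- The third iterated integral of three oscillations over a period, when the second one of the
inner two vanishes. -/
theorem iterated_integral_osc_three {ε : ℝ} (hε : ε ≠ 0) {k l i : ℤ} (hk : 0 < k) (hl : 0 < l)
    (hi : 0 < i) (n m o j : ℤ) (hkl : k = l → qcos (n - 1 - m) = 0)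
    (hli : l = i → qcos (m - o + 1) = 0) :
    ∫ t in (ε * j)..(ε * (j + 1)), osc ε k n t * ∫ s in (ε * j)..t, osc ε l m s *
        ∫ r in (ε * j)..s, osc ε i o r =
      -(ε ^ 3 / (16 * Real.pi ^ 2 * k * i)) *
        ((if k + l = i then (qcos (n + m - o) : ℝ) else 0) +
        (if k + i = l then (qcos (n - m + o - 2) : ℝ) else 0) +
        (if k = l + i then (qcos (n - m - o) : ℝ) else 0)) := by
  have hc := fun k n => (continuous_osc ε k n)
  set a := ε * (j : ℝ) with ha
  set b := ε * ((j : ℝ) + 1) with hb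
  let V : ℝ → ℝ := fun t => ε / (2 * Real.pi * k) * osc ε k (n - 1) t
  let w : ℝ → ℝ := fun s => osc ε l m s * ∫ r in a..s, osc ε i o r
  have hw : Continuous w := (hc _ _).mul (intervalIntegral.continuous_primitive
    (fun _ _ => (hc i o).intervalIntegrable _ _) a)
  have hW : ∀ t, HasDerivAt (fun t => ∫ s in a..t, w s) (w t) t := fun t =>
    intervalIntegral.integral_hasDerivAt_right (hw.intervalIntegrable _ _)
      (hw.stronglyMeasurableAtFilter _ _) hw.continuousAt
  have hWb : ∫ s in a..b, w s = 0 := by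
    have := iterated_integral_osc_two hε hl hi m o j
    rw [← ha, ← hb] at this
    change ∫ s in a..b, osc ε l m s * ∫ r in a..s, osc ε i o r = 0
    rw [this]
    split_ifs with h
    · rw [hli h]; simp
    · rfl
  -- Integrating the outer oscillation by parts leaves a single integral of a triple product: the
  -- inner double integral vanishes at both ends, at `b` by `hli`. The constant from the innermost
  -- primitive is removed later by `hkl`.
  have hparts := intervalIntegral.integral_mul_deriv_eq_deriv_mul (a := a) (b := b)
    (fun t _ => hW t) (fun t _ => hasDerivAt_osc hε hk.ne' n t)
    (hw.intervalIntegrable _ _) ((hc k n).intervalIntegrable _ _)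
  rw [hWb, intervalIntegral.integral_same, zero_mul, zero_mul, sub_zero, zero_sub] at hparts
  have h1 : ∫ t in a..b, osc ε k n t * ∫ s in a..t, w s =
      -∫ t in a..b, w t * (ε / (2 * Real.pi * k) * osc ε k (n - 1) t) := by
    rw [← hparts]; congr 1; ext t; ring
  change ∫ t in a..b, osc ε k n t * ∫ s in a..t, w s = _
  rw [h1]
  have h2 : ∀ t, w t * (ε / (2 * Real.pi * k) * osc ε k (n - 1) t) =
      (ε / (2 * Real.pi * k) * (ε / (2 * Real.pi * i))) *
        (osc ε k (n - 1) t * osc ε l m t * osc ε i (o - 1) t) -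
      (ε / (2 * Real.pi * k) * (ε / (2 * Real.pi * i) * osc ε i (o - 1) a)) *
        (osc ε k (n - 1) t * osc ε l m t) := fun t => by
    simp only [w, integral_osc_primitive hε hi.ne']; ring
  simp only [h2]
  rw [intervalIntegral.integral_sub (Continuous.intervalIntegrable (by fun_prop) _ _)
    (Continuous.intervalIntegrable (by fun_prop) _ _),
    intervalIntegral.integral_const_mul, intervalIntegral.integral_const_mul, ha, hb,
    integral_osc_mul_mul hε hk hl hi, integral_osc_mul hε hk hl]
  have h3 : (if k = l then ε * (qcos (n - 1 - m) : ℝ) / 2 else 0) = 0 := by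
    split_ifs with h
    · rw [hkl h]; simp
    · rfl
  rw [h3, mul_zero, sub_zero]
  have e1 : n - 1 + m - (o - 1) = n + m - o := by ring
  have e2 : n - 1 - m + (o - 1) = n - m + o - 2 := by ring
  have e3 : n - 1 - m - (o - 1) = n - m - o := by ring
  rw [e1, e2, e3]
  have : (k : ℝ) ≠ 0 := by exact_mod_cast hk.ne'
  have : (i : ℝ) ≠ 0 := by exact_mod_cast hi.ne'
  have := Real.pi_ne_zero
  field_simp
  norm_num
  ring

end Oscillation

/-! ### Which triples of frequencies can resonate. -/

section Resonance

variable {m : ℕ} {S₂ : Finset (Fin m × Fin m)} {S₃ : Finset (Fin m × Fin m × Fin m)}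

/-- Three members of the same quadruple of frequencies, among them the first two. -/
def IsResonantTriple (i j k : Fin 4) : Prop :=
  i ≠ j ∧ j ≠ k ∧ i ≠ k ∧ (i = 0 ∨ j = 0 ∨ k = 0) ∧ (i = 1 ∨ j = 1 ∨ k = 1)

instance (i j k : Fin 4) : Decidable (IsResonantTriple i j k) := by
  unfold IsResonantTriple; infer_instance

/-- The equation is a relation with coefficients `1, 1, -1`: its absolute values sum to 3 and its
gcd is 1 because of the entry `-1`. It is therefore an imposed one, and those have entries in `{0,
±1}` supported on three slots of a single `ℓ`, always including the slots 0 and 1. -/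
theorem Freq.NonResonant.resonant {κ : Freq S₂ S₃} (hκ : κ.NonResonant) {x y z : ↥S₃ × Fin 4}
    (h : κ.quad x + κ.quad y = κ.quad z) :
    x.1 = z.1 ∧ y.1 = z.1 ∧ IsResonantTriple x.2 y.2 z.2 := by
  classical
  have hx := hκ.pos_quad x
  have hy := hκ.pos_quad y
  have hxz : x ≠ z := by rintro rfl; omega
  have hyz : y ≠ z := by rintro rfl; omega
  let c : ↥S₃ × Fin 4 → ℤ := Pi.single x 1 + Pi.single y 1 - Pi.single z 1
  have hcz : c z = -1 := by simp [c, hxz.symm, hyz.symm]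
  have habs : ∀ p, |c p| = (Pi.single x 1 : ↥S₃ × Fin 4 → ℤ) p + (Pi.single y 1 : _ → ℤ) p +
      (Pi.single z 1 : _ → ℤ) p := by
    intro p
    simp only [c, Pi.sub_apply, Pi.add_apply, Pi.single_apply]
    by_cases h1 : p = z
    · subst h1; simp [hxz.symm, hyz.symm]
    · simp only [h1, if_false]; split_ifs <;> norm_num
  have hsum : ∑ p, |c p| = 3 := by
    simp only [habs, Finset.sum_add_distrib, Finset.sum_pi_single', Finset.mem_univ, if_true]
    norm_num
  have hgcd : Finset.univ.gcd c = 1 := by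
    have h1 : Finset.univ.gcd c ∣ c z := Finset.gcd_dvd (Finset.mem_univ z)
    rw [hcz, Int.dvd_neg] at h1
    rw [← Finset.normalize_gcd]
    exact normalize_eq_one.2 (isUnit_of_dvd_one h1)
  have hrel : ∑ p, c p * κ.quad p = 0 := by
    simp [c, sub_mul, add_mul, Finset.sum_add_distrib, Finset.sum_sub_distrib, Pi.single_apply, h]
  have key : ∃ (l : ↥S₃) (T : Fin 4 → ℤ), (∀ i, |T i| ≤ 1) ∧ (∀ p, c p = if p.1 = l then T p.2 else 0)
      ∧ ∀ i j k, T i ≠ 0 → T j ≠ 0 → T k ≠ 0 → i ≠ j → j ≠ k → i ≠ k → IsResonantTriple i j k := by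
    obtain ⟨l, s, hs, h1 | h1⟩ := hκ.no_resonance c hgcd hsum hrel
    · refine ⟨l, s • ![1, 1, -1, 0], ?_, ?_, ?_⟩
      · rcases hs with rfl | rfl <;> decide
      · rintro ⟨l', i⟩
        rw [h1]
        by_cases hl : l' = l
        · subst hl; fin_cases i <;> simp
        · simp [hl]
      · rcases hs with rfl | rfl <;> decide
    · refine ⟨l, s • ![-1, 1, 0, -1], ?_, ?_, ?_⟩
      · rcases hs with rfl | rfl <;> decide
      · rintro ⟨l', i⟩
        rw [h1]
        by_cases hl : l' = l
        · subst hl; fin_cases i <;> simp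
        · simp [hl]
      · rcases hs with rfl | rfl <;> decide
  obtain ⟨l, T, hT1, hT, hT3⟩ := key
  -- A coincidence would produce a coefficient 2, which no imposed relation has.
  have hxy : x ≠ y := by
    rintro rfl
    have h1 : c x = 2 := by simp [c, hxz]
    rw [hT x] at h1
    split_ifs at h1
    · have := hT1 x.2; rw [h1] at this; norm_num at this
    · norm_num at h1
  have hcx : c x = 1 := by simp [c, hxz, hxy]
  have hcy : c y = 1 := by simp [c, hyz, hxy.symm]
  rw [hT] at hcx hcy hcz
  have h1 : x.1 = l := by by_contra h; rw [if_neg h] at hcx; omega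
  have h2 : y.1 = l := by by_contra h; rw [if_neg h] at hcy; omega
  have h3 : z.1 = l := by by_contra h; rw [if_neg h] at hcz; omega
  rw [if_pos h1] at hcx
  rw [if_pos h2] at hcy
  rw [if_pos h3] at hcz
  refine ⟨h1.trans h3.symm, h2.trans h3.symm, hT3 _ _ _ (by omega) (by omega) (by omega) ?_ ?_ ?_⟩
  · exact fun h => hxy (Prod.ext (h1.trans h2.symm) h)
  · exact fun h => hyz (Prod.ext (h2.trans h3.symm) h)
  · exact fun h => hxz (Prod.ext (h1.trans h3.symm) h)

end Resonance

/-! ### The third-order contribution of one quadruple of frequencies. -/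

section Quadruple

/-- The third iterated integral of three unit oscillations over a period. -/
def tripleCoeff (ε : ℝ) (k l i n m o : ℤ) : ℝ :=
  -(ε ^ 3 / (16 * Real.pi ^ 2 * k * i)) *
    ((if k + l = i then (qcos (n + m - o) : ℝ) else 0) +
      (if k + i = l then (qcos (n - m + o - 2) : ℝ) else 0) +
      (if k = l + i then (qcos (n - m - o) : ℝ) else 0))

theorem tripleCoeff_add {ε : ℝ} {k l i n m o : ℤ} (hl : 0 < l)
    (h : k + l = i) :
    tripleCoeff ε k l i n m o = -(ε ^ 3 / (16 * Real.pi ^ 2 * k * i)) * qcos (n + m - o) := by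
  unfold tripleCoeff
  rw [if_pos h]
  by_cases h1 : k + i = l
  · rw [if_neg (by omega : ¬ k = l + i)]
    -- Both conditions together force `k = 0`; then the prefactor is a division by zero, which is
    -- `0`, and both sides vanish.
    have : k = 0 := by omega
    subst this; simp
  · rw [if_neg h1, if_neg (by omega : ¬ k = l + i)]; simp

theorem tripleCoeff_mid {ε : ℝ} {k l i n m o : ℤ} (hk : 0 < k) (hi : 0 < i) (h : k + i = l) :
    tripleCoeff ε k l i n m o =
      -(ε ^ 3 / (16 * Real.pi ^ 2 * k * i)) * qcos (n - m + o - 2) := by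
  unfold tripleCoeff
  rw [if_pos h, if_neg (by omega), if_neg (by omega)]; simp

theorem tripleCoeff_sub {ε : ℝ} {k l i n m o : ℤ} (hl : 0 < l) (hi : 0 < i) (h : k = l + i) :
    tripleCoeff ε k l i n m o =
      -(ε ^ 3 / (16 * Real.pi ^ 2 * k * i)) * qcos (n - m - o) := by
  unfold tripleCoeff
  rw [if_pos h, if_neg (by omega), if_neg (by omega)]; simp

variable {E : Type*} [AddCommGroup E] [Module ℝ E]

/-- The weights of the four oscillations of a quadruple. -/
def quadWeight : Fin 4 → ℝ := ![1, 1, 1 / 2, 1 / 2]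

/-- The phases of the four oscillations of a quadruple. -/
def quadPhase : Fin 4 → ℤ := ![0, -1, -1, -1]

/-- The vector fields of the four oscillations of a quadruple. -/
def quadSlot : Fin 4 → Fin 3 := ![0, 1, 2, 2]

/-- Of the 64 triples only the 12 orderings of `{0, 1, 2}` and `{0, 1, 3}` are resonant. Slots 2 and
3 drive the same field, so their contributions pair up. With that field in the middle they cancel;
otherwise they combine through `1 / (k₂ - k₁) ∓ 1 / (k₁ + k₂)` into `1 / ((k₁ + k₂) (k₂ - k₁))` with
the signs of an iterated bracket. -/
theorem sum_quadruple (ε : ℝ) {k₁ k₂ : ℤ} (h1 : 0 < k₁) (h2 : k₁ < k₂) (K : Fin 4 → ℤ)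
    (hK : K = ![k₁, k₂, k₁ + k₂, k₂ - k₁])
    (hres : ∀ x y z, K x + K y = K z → IsResonantTriple x y z) (Y : Fin 3 → Fin 3 → Fin 3 → E) :
    ∑ i, ∑ j, ∑ k, (quadWeight i * quadWeight j * quadWeight k *
        tripleCoeff ε (K i) (K j) (K k) (quadPhase i) (quadPhase j) (quadPhase k)) •
          Y (quadSlot i) (quadSlot j) (quadSlot k) =
      (ε ^ 3 / (16 * Real.pi ^ 2 * ((k₁ + k₂ : ℤ) : ℝ) * ((k₂ - k₁ : ℤ) : ℝ))) •
        (Y 2 1 0 + Y 0 1 2 - Y 2 0 1 - Y 1 0 2) := by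
  have hzero : ∀ i j k, ¬ IsResonantTriple i j k → tripleCoeff ε (K i) (K j) (K k)
      (quadPhase i) (quadPhase j) (quadPhase k) = 0 := by
    intro i j k h
    unfold tripleCoeff
    rw [if_neg fun hh => h (hres _ _ _ hh), if_neg fun hh => h ?_, if_neg fun hh => h ?_]
    · simp
    · have := hres _ _ _ hh.symm; revert this; clear hh h; revert i j k; decide
    · have := hres _ _ _ hh; revert this; clear hh h; revert i j k; decide
  have p1 : (0 : ℤ) < k₂ := by omega
  have p3 : (0 : ℤ) < k₁ + k₂ := by omega
  have p4 : (0 : ℤ) < k₂ - k₁ := by omega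
  have K0 : K 0 = k₁ := by rw [hK]; rfl
  have K1 : K 1 = k₂ := by rw [hK]; rfl
  have K2 : K 2 = k₁ + k₂ := by rw [hK]; rfl
  have K3 : K 3 = k₂ - k₁ := by rw [hK]; rfl
  have q0 : quadPhase 0 = 0 := rfl
  have q1 : quadPhase 1 = -1 := rfl
  have q2 : quadPhase 2 = -1 := rfl
  have q3 : quadPhase 3 = -1 := rfl
  have w0 : quadWeight 0 = 1 := rfl
  have w1 : quadWeight 1 = 1 := rfl
  have w2 : quadWeight 2 = 1 / 2 := rfl
  have w3 : quadWeight 3 = 1 / 2 := rfl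
  have s0 : quadSlot 0 = 0 := rfl
  have s1 : quadSlot 1 = 1 := rfl
  have s2 : quadSlot 2 = 2 := rfl
  have s3 : quadSlot 3 = 2 := rfl
  simp (decide := true) only [Fin.sum_univ_four, hzero, mul_zero, zero_smul, add_zero, zero_add]
  simp only [K0, K1, K2, K3, q0, q1, q2, q3, w0, w1, w2, w3, s0, s1, s2, s3]
  rw [tripleCoeff_add (k := k₁) (l := k₂) (i := k₁ + k₂) p1 rfl,
    tripleCoeff_mid (k := k₁) (l := k₂) (i := k₂ - k₁) h1 p4 (by ring),
    tripleCoeff_mid (k := k₁) (l := k₁ + k₂) (i := k₂) h1 p1 (by ring),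
    tripleCoeff_add (k := k₁) (l := k₂ - k₁) (i := k₂) p4 (by ring),
    tripleCoeff_add (k := k₂) (l := k₁) (i := k₁ + k₂) h1 (by ring),
    tripleCoeff_sub (k := k₂) (l := k₁) (i := k₂ - k₁) h1 p4 (by ring),
    tripleCoeff_mid (k := k₂) (l := k₁ + k₂) (i := k₁) p1 h1 (by ring),
    tripleCoeff_sub (k := k₂) (l := k₂ - k₁) (i := k₁) p4 h1 (by ring),
    tripleCoeff_sub (k := k₁ + k₂) (l := k₁) (i := k₂) h1 p1 (by ring),
    tripleCoeff_sub (k := k₁ + k₂) (l := k₂) (i := k₁) p1 h1 (by ring),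
    tripleCoeff_add (k := k₂ - k₁) (l := k₁) (i := k₂) h1 (by ring),
    tripleCoeff_mid (k := k₂ - k₁) (l := k₂) (i := k₁) p4 h1 (by ring)]
  have z1 : (k₁ : ℝ) ≠ 0 := by exact_mod_cast h1.ne'
  have z2 : (k₂ : ℝ) ≠ 0 := by exact_mod_cast p1.ne'
  have z3 : ((k₁ + k₂ : ℤ) : ℝ) ≠ 0 := by exact_mod_cast p3.ne'
  have z4 : ((k₂ - k₁ : ℤ) : ℝ) ≠ 0 := by exact_mod_cast p4.ne'
  have e2 : (k₂ : ℝ) = (((k₁ + k₂ : ℤ) : ℝ) + ((k₂ - k₁ : ℤ) : ℝ)) / 2 := by push_cast; ring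
  have e1 : (k₁ : ℝ) = (((k₁ + k₂ : ℤ) : ℝ) - ((k₂ - k₁ : ℤ) : ℝ)) / 2 := by push_cast; ring
  generalize ((k₁ + k₂ : ℤ) : ℝ) = r at *
  generalize ((k₂ - k₁ : ℤ) : ℝ) = s at *
  simp only [show qcos (0 + -1 - -1) = 1 from rfl, show qcos (0 - -1 + -1 - 2) = -1 from rfl,
    show qcos (-1 + 0 - -1) = 1 from rfl, show qcos (-1 - 0 - -1) = 1 from rfl,
    show qcos (-1 - -1 + 0 - 2) = -1 from rfl, show qcos (-1 - -1 - 0) = 1 from rfl,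
    Int.cast_one, Int.cast_neg]
  rw [e1] at z1 ⊢
  rw [e2] at z2 ⊢
  have z1' : r - s ≠ 0 := fun h => z1 (by rw [h]; simp)
  have z2' : r + s ≠ 0 := fun h => z2 (by rw [h]; simp)
  have hpi := Real.pi_ne_zero
  match_scalars <;> field_simp <;> ring

end Quadruple

/-! ### Lie brackets in terms of Lie derivatives. -/

section Brackets

variable {E : Type*} [NormedAddCommGroup E] [NormedSpace ℝ E]

theorem lieBracket_eq_lieD (V W : E → E) (x : E) :
    VectorField.lieBracket ℝ V W x = lieD V W x - lieD W V x := rfl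

/-- By symmetry of second derivatives, differentiation of `Z` along `[V, W]` is the commutator of
the differentiations along `V` and `W`; the other half of the outer bracket is plain linearity. -/
theorem lieBracket_lieBracket_eq_lieD {D : Set E} (hD : IsOpen D) {V W Z : E → E}
    (hV : ContDiffOn ℝ 3 V D) (hW : ContDiffOn ℝ 3 W D) (hZ : ContDiffOn ℝ 3 Z D) {x : E}
    (hx : x ∈ D) :
    VectorField.lieBracket ℝ (VectorField.lieBracket ℝ V W) Z x =
      lieD V (lieD W Z) x + lieD Z (lieD W V) x - lieD W (lieD V Z) x - lieD Z (lieD V W) x := by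
  have hd : ∀ {X φ : E → E}, ContDiffOn ℝ 3 X D → ContDiffOn ℝ 3 φ D →
      DifferentiableAt ℝ (lieD X φ) x := fun hX hφ =>
    ((contDiffOn_lieD (k := 1) (l := 3) hD (hX.of_le (by norm_num)) hφ
      (by norm_num)).differentiableOn one_ne_zero).differentiableAt (hD.mem_nhds hx)
  have hat : ∀ {X : E → E}, ContDiffOn ℝ 3 X D → ContDiffAt ℝ 3 X x := fun hX =>
    hX.contDiffAt (hD.mem_nhds hx)
  have h1 := VectorField.fderiv_apply_lieBracket (n := 3) (hat hZ)
    (by simp; norm_num) ((hat hW).differentiableAt (by norm_num))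
    ((hat hV).differentiableAt (by norm_num))
  have h2 : fderiv ℝ (VectorField.lieBracket ℝ V W) x = fderiv ℝ (lieD V W) x -
      fderiv ℝ (lieD W V) x := by
    have : VectorField.lieBracket ℝ V W = lieD V W - lieD W V := rfl
    rw [this, fderiv_sub (hd hV hW) (hd hW hV)]
  have e1 : lieD (VectorField.lieBracket ℝ V W) Z x = lieD V (lieD W Z) x - lieD W (lieD V Z) x :=
    h1
  have e2 : lieD Z (VectorField.lieBracket ℝ V W) x = lieD Z (lieD V W) x - lieD Z (lieD W V) x := by
    unfold lieD at *; rw [h2]; rfl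
  rw [lieBracket_eq_lieD, e1, e2]
  abel

end Brackets

/-! ### The real cube root. -/

section Roots

theorem cbrt_pow_three (y : ℝ) : cbrt y ^ 3 = y := by
  unfold cbrt
  rw [mul_pow, ← Real.rpow_natCast (|y| ^ (1 / 3 : ℝ)), ← Real.rpow_mul (abs_nonneg y)]
  norm_num
  rcases lt_trichotomy y 0 with h | h | h
  · rw [Real.sign_of_neg h, abs_of_neg h]; ring
  · simp [h]
  · rw [Real.sign_of_pos h, abs_of_pos h]; ring

end Roots

/-! ### Decomposition of the controls into elementary oscillations and their sizes. -/

section Atoms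

variable {m : ℕ} {S₁ : Finset (Fin m)} {S₂ : Finset (Fin m × Fin m)}
  {S₃ : Finset (Fin m × Fin m × Fin m)}

/-- The elementary oscillations of which the controls are made up. -/
abbrev Atom (S₁ : Finset (Fin m)) (S₂ : Finset (Fin m × Fin m))
    (S₃ : Finset (Fin m × Fin m × Fin m)) := ↥S₁ ⊕ (↥S₂ × Fin 2) ⊕ (↥S₃ × Fin 4)

/-- The vector field which an elementary oscillation drives. -/
def atomField : Atom S₁ S₂ S₃ → Fin m
  | .inl i => i
  | .inr (.inl p) => ![p.1.1.1, p.1.1.2] p.2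
  | .inr (.inr p) => ![p.1.1.1, p.1.1.2.1, p.1.1.2.2] (quadSlot p.2)

/-- The frequency of an elementary oscillation. -/
def atomFreq (κ : Freq S₂ S₃) : Atom S₁ S₂ S₃ → ℤ
  | .inl _ => 0
  | .inr (.inl p) => κ.k p.1
  | .inr (.inr p) => κ.quad p

/-- The phase of an elementary oscillation, in quarter turns. -/
def atomPhase : Atom S₁ S₂ S₃ → ℤ
  | .inl _ => 0
  | .inr (.inl p) => ![0, -1] p.2
  | .inr (.inr p) => quadPhase p.2

/-- The amplitude common to the four oscillations of a quadruple. -/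
def quadAmp (κ : Freq S₂ S₃) (ε : ℝ) (a : EuclideanSpace ℝ (Idx S₁ S₂ S₃)) (l : ↥S₃) : ℝ :=
  ε ^ (-(2 / 3) : ℝ) * (cbrt (a (.inr (.inr l))) *
    (2 * cbrt (2 * Real.pi ^ 2 * (κ.k₁ l + κ.k₂ l) * (κ.k₂ l - κ.k₁ l))))

/-- The amplitude of an elementary oscillation. -/
def atomAmp (κ : Freq S₂ S₃) (ε : ℝ) (a : EuclideanSpace ℝ (Idx S₁ S₂ S₃)) : Atom S₁ S₂ S₃ → ℝ
  | .inl i => a (.inl i)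
  | .inr (.inl p) => ε ^ (-(1 / 2) : ℝ) * (√|a (.inr (.inl p.1))| *
      (2 * √(Real.pi * κ.k p.1))) * ![Real.sign (a (.inr (.inl p.1))), 1] p.2
  | .inr (.inr p) => quadAmp κ ε a p.1 * quadWeight p.2

/-- The elementary oscillation `p`. -/
def atomControl (κ : Freq S₂ S₃) (ε : ℝ) (a : EuclideanSpace ℝ (Idx S₁ S₂ S₃))
    (p : Atom S₁ S₂ S₃) (t : ℝ) : ℝ :=
  atomAmp κ ε a p * osc ε (atomFreq κ p) (atomPhase p) t

/-- Phase `-1` turns a cosine into a sine. The product `cos · sin` in the third-order control is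
half the sum of the sines with frequencies `κ₁ + κ₂` and `κ₂ - κ₁`; hence four oscillations for each
`ℓ`, the last two with weight `1 / 2`. -/
theorem control_eq_sum {n : ℕ} (f : Fin m → State n → State n) (κ : Freq S₂ S₃) (γ ε t : ℝ)
    (x : State n) (k : Fin m) : control f κ S₁ γ ε t x k =
      ∑ p, atomControl κ ε (coeffA f S₁ S₂ S₃ γ x) p t * kron k (atomField p) := by
  generalize ha : coeffA f S₁ S₂ S₃ γ x = a
  simp only [control, ha]
  have ht : ∀ y : ℝ, Real.cos (y + -(Real.pi / 2)) = Real.sin y := fun y => by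
    rw [← sub_eq_add_neg, Real.cos_sub_pi_div_two]
  rw [Fintype.sum_sum_type, Fintype.sum_sum_type, Fintype.sum_prod_type, Fintype.sum_prod_type,
    Finset.mul_sum, Finset.mul_sum, add_assoc]
  congr 1
  · refine Finset.sum_congr rfl fun i _ => ?_
    simp [atomControl, atomAmp, atomFreq, atomPhase, atomField, osc]
  congr 1
  · refine Finset.sum_congr rfl fun j _ => ?_
    simp only [Fin.sum_univ_two, atomControl, atomAmp, atomFreq, atomPhase, atomField, osc, phi₂]
    simp [ht]
    ring
  · refine Finset.sum_congr rfl fun l _ => ?_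
    simp only [Fin.sum_univ_four, atomControl, atomAmp, atomFreq, atomPhase, atomField, osc, phi₃,
      Freq.quad, quadAmp, quadPhase, quadWeight, quadSlot]
    have h1 : ∀ i : ℤ, 2 * Real.pi * (i : ℝ) / ε * t = 2 * Real.pi * i * t / ε := fun i => by ring
    have h3 : 2 * Real.pi * ((κ.k₁ l : ℝ) + κ.k₂ l) / ε * t =
      2 * Real.pi * κ.k₁ l * t / ε + 2 * Real.pi * κ.k₂ l * t / ε := by ring
    have h4 : 2 * Real.pi * ((κ.k₂ l : ℝ) - κ.k₁ l) / ε * t =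
      2 * Real.pi * κ.k₂ l * t / ε - 2 * Real.pi * κ.k₁ l * t / ε := by ring
    simp [ht, h3, h4, h1, Real.sin_add, Real.sin_sub]
    ring

theorem sum_control_smul {n : ℕ} (f : Fin m → State n → State n) (κ : Freq S₂ S₃) (γ ε t : ℝ)
    (x y : State n) : ∑ k, control f κ S₁ γ ε t x k • f k y =
      ∑ p, atomControl κ ε (coeffA f S₁ S₂ S₃ γ x) p t • f (atomField p) y := by
  simp only [control_eq_sum, Finset.sum_smul]
  rw [Finset.sum_comm]
  refine Finset.sum_congr rfl fun p _ => ?_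
  simp [kron, ite_smul]

theorem continuous_atomControl (κ : Freq S₂ S₃) (ε : ℝ) (a : EuclideanSpace ℝ (Idx S₁ S₂ S₃))
    (p : Atom S₁ S₂ S₃) : Continuous (atomControl κ ε a p) :=
  continuous_const.mul (continuous_osc _ _ _)

theorem abs_atomControl_le (κ : Freq S₂ S₃) (ε : ℝ) (a : EuclideanSpace ℝ (Idx S₁ S₂ S₃))
    (p : Atom S₁ S₂ S₃) (t : ℝ) : |atomControl κ ε a p t| ≤ |atomAmp κ ε a p| := by
  rw [atomControl, abs_mul]
  exact mul_le_of_le_one_right (abs_nonneg _) (abs_osc_le _ _ _ _)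

/-- The order of an elementary oscillation with respect to the sixth root of `ε ‖a‖`. -/
def atomOrder : Atom S₁ S₂ S₃ → ℕ
  | .inl _ => 6
  | .inr (.inl _) => 3
  | .inr (.inr _) => 2

/-- The powers of `ε` are such that `ε · ε^{-1/2} √|a| = (ε |a|)^{1/2}` and `ε · ε^{-2/3} |a|^{1/3}
= (ε |a|)^{1/3}`. Measuring in a sixth root `θ` makes all orders integers. -/
theorem exists_atomAmp_bound (κ : Freq S₂ S₃) : ∃ W : ℝ, 1 ≤ W ∧
    ∀ (ε θ : ℝ) (a : EuclideanSpace ℝ (Idx S₁ S₂ S₃)), 0 < ε → 0 ≤ θ →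
      (∀ i, ε * |a i| ≤ θ ^ 6) → ∀ p, ε * |atomAmp κ ε a p| ≤ W * θ ^ atomOrder p := by
  have h2 : ∀ j, 0 ≤ 2 * √(Real.pi * κ.k j) := fun j => by positivity
  have h3 : ∀ l, 0 ≤ 2 * |cbrt (2 * Real.pi ^ 2 * (κ.k₁ l + κ.k₂ l) * (κ.k₂ l - κ.k₁ l))| :=
    fun l => by positivity
  have h20 := Finset.sum_nonneg fun j (_ : j ∈ Finset.univ) => h2 j
  have h30 := Finset.sum_nonneg fun j (_ : j ∈ Finset.univ) => h3 j
  refine ⟨1 + ∑ j, 2 * √(Real.pi * κ.k j) +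
    ∑ l, 2 * |cbrt (2 * Real.pi ^ 2 * (κ.k₁ l + κ.k₂ l) * (κ.k₂ l - κ.k₁ l))|, by linarith, ?_⟩
  intro ε θ a hε hθ ha p
  rcases p with i | ⟨j, s⟩ | ⟨l, s⟩
  · calc ε * |a (.inl i)| ≤ 1 * θ ^ 6 := by rw [one_mul]; exact ha _
      _ ≤ _ := by simp only [atomOrder]; gcongr; linarith
  · have hs : |(![Real.sign (a (.inr (.inl j))), 1] : Fin 2 → ℝ) s| ≤ 1 := by
      fin_cases s
      · rcases Real.sign_apply_eq (a (.inr (.inl j))) with h | h | h <;> simp [h]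
      · simp
    have hr : ε * (ε ^ (-(1 / 2) : ℝ) * √|a (.inr (.inl j))|) ≤ θ ^ 3 := by
      have e1 : ε * ε ^ (-(1 / 2) : ℝ) = √ε := by
        rw [Real.sqrt_eq_rpow]
        nth_rewrite 1 [← Real.rpow_one ε]
        rw [← Real.rpow_add hε]; norm_num
      rw [← mul_assoc, e1, ← Real.sqrt_mul hε.le]
      refine Real.sqrt_le_iff.2 ⟨by positivity, ?_⟩
      rw [← pow_mul]; exact ha _
    have hj := Finset.single_le_sum (fun j _ => h2 j) (Finset.mem_univ j)
    have e : |atomAmp κ ε a (.inr (.inl (j, s)))| = ε ^ (-(1 / 2) : ℝ) *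
        (√|a (.inr (.inl j))| * (2 * √(Real.pi * κ.k j))) *
          |(![Real.sign (a (.inr (.inl j))), 1] : Fin 2 → ℝ) s| := by
      simp only [atomAmp]
      rw [abs_mul, abs_of_nonneg]
      exact mul_nonneg (Real.rpow_nonneg hε.le _) (mul_nonneg (Real.sqrt_nonneg _) (h2 j))
    rw [e]
    calc _ = (ε * (ε ^ (-(1 / 2) : ℝ) * √|a (.inr (.inl j))|)) * (2 * √(Real.pi * κ.k j)) *
          |(![Real.sign (a (.inr (.inl j))), 1] : Fin 2 → ℝ) s| := by ring
      _ ≤ θ ^ 3 * (1 + ∑ j, 2 * √(Real.pi * κ.k j) + ∑ l, 2 * |cbrt (2 * Real.pi ^ 2 *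
          (κ.k₁ l + κ.k₂ l) * (κ.k₂ l - κ.k₁ l))|) * 1 := by
        gcongr
        linarith
      _ = _ := by simp only [atomOrder]; ring
  · have hw : |quadWeight s| ≤ 1 := by fin_cases s <;> norm_num [quadWeight]
    have hr : ε * (ε ^ (-(2 / 3) : ℝ) * |cbrt (a (.inr (.inr l)))|) ≤ θ ^ 2 := by
      have e1 : (ε * ε ^ (-(2 / 3) : ℝ)) ^ 3 = ε := by
        nth_rewrite 1 [← Real.rpow_one ε]
        rw [← Real.rpow_add hε, ← Real.rpow_natCast, ← Real.rpow_mul hε.le]; norm_num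
      rw [← mul_assoc]
      refine le_of_pow_le_pow_left₀ (n := 3) (by norm_num) (by positivity) ?_
      rw [mul_pow, e1, ← abs_pow, cbrt_pow_three, ← pow_mul]; exact ha _
    have hl := Finset.single_le_sum (fun l _ => h3 l) (Finset.mem_univ l)
    have e : |atomAmp κ ε a (.inr (.inr (l, s)))| = ε ^ (-(2 / 3) : ℝ) * (|cbrt (a (.inr (.inr l)))| *
        (2 * |cbrt (2 * Real.pi ^ 2 * (κ.k₁ l + κ.k₂ l) * (κ.k₂ l - κ.k₁ l))|)) *
          |quadWeight s| := by
      simp only [atomAmp, quadAmp]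
      rw [abs_mul, abs_mul, abs_mul, abs_mul, abs_of_nonneg (Real.rpow_nonneg hε.le _), abs_two]
    rw [e]
    calc _ = (ε * (ε ^ (-(2 / 3) : ℝ) * |cbrt (a (.inr (.inr l)))|)) *
          (2 * |cbrt (2 * Real.pi ^ 2 * (κ.k₁ l + κ.k₂ l) * (κ.k₂ l - κ.k₁ l))|) *
          |quadWeight s| := by ring
      _ ≤ θ ^ 2 * (1 + ∑ j, 2 * √(Real.pi * κ.k j) + ∑ l, 2 * |cbrt (2 * Real.pi ^ 2 *
          (κ.k₁ l + κ.k₂ l) * (κ.k₂ l - κ.k₁ l))|) * 1 := by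
        gcongr
        linarith
      _ = _ := by simp only [atomOrder]; ring

end Atoms

/-! ### Principal parts and remainders of the iterated integrals. -/

section PeriodExpansion

theorem abs_integral_mul_le {v w : ℝ → ℝ} {a b P Q t : ℝ} (ht : t ∈ Icc a b)
    (hv : ∀ s, |v s| ≤ P) (hw : ∀ s ∈ Icc a b, |w s| ≤ Q) :
    |∫ s in a..t, v s * w s| ≤ (b - a) * P * Q := by
  have hP : 0 ≤ P := (abs_nonneg _).trans (hv a)
  have hQ : 0 ≤ Q := (abs_nonneg _).trans (hw t ht)
  refine (intervalIntegral.norm_integral_le_of_norm_le_const (f := fun s => v s * w s)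
    (C := P * Q) fun s hs => ?_).trans ?_
  · rw [uIoc_of_le ht.1] at hs
    rw [Real.norm_eq_abs, abs_mul]
    exact mul_le_mul (hv s) (hw s ⟨hs.1.le, hs.2.trans ht.2⟩) (abs_nonneg _) hP
  · rw [abs_of_nonneg (sub_nonneg.2 ht.1), mul_assoc (b - a), mul_comm (P * Q)]
    gcongr; exact ht.2

theorem norm_sum_smul_sub_le {ι E : Type*} [Fintype ι] [NormedAddCommGroup E] [NormedSpace ℝ E]
    {S M : ι → ℝ} {X : ι → E} {e B : ℝ} (hS : ∀ i, |S i - M i| ≤ e) (hX : ∀ i, ‖X i‖ ≤ B) :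
    ‖∑ i, S i • X i - ∑ i, M i • X i‖ ≤ Fintype.card ι * (e * B) := by
  rw [← Finset.sum_sub_distrib]
  refine (norm_sum_le _ _).trans ((Finset.sum_le_card_nsmul _ _ (e * B) fun i _ => ?_).trans ?_)
  · rw [← sub_smul, norm_smul, Real.norm_eq_abs]
    exact mul_le_mul (hS i) (hX i) (norm_nonneg _) ((abs_nonneg _).trans (hS i))
  · rw [nsmul_eq_mul, Finset.card_univ]

variable {m : ℕ} {S₁ : Finset (Fin m)} {S₂ : Finset (Fin m × Fin m)}
  {S₃ : Finset (Fin m × Fin m × Fin m)}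

/-- The first iterated integrals of the elementary oscillations. -/
def iter₁ (κ : Freq S₂ S₃) (ε : ℝ) (a : EuclideanSpace ℝ (Idx S₁ S₂ S₃)) (j : ℤ)
    (p : Atom S₁ S₂ S₃) : ℝ :=
  ∫ t in (ε * j)..(ε * (j + 1)), atomControl κ ε a p t

/-- The second iterated integrals of the elementary oscillations. -/
def iter₂ (κ : Freq S₂ S₃) (ε : ℝ) (a : EuclideanSpace ℝ (Idx S₁ S₂ S₃)) (j : ℤ)
    (p q : Atom S₁ S₂ S₃) : ℝ :=
  ∫ t in (ε * j)..(ε * (j + 1)), atomControl κ ε a p t * ∫ s in (ε * j)..t, atomControl κ ε a q s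

/-- The third iterated integrals of the elementary oscillations. -/
def iter₃ (κ : Freq S₂ S₃) (ε : ℝ) (a : EuclideanSpace ℝ (Idx S₁ S₂ S₃)) (j : ℤ)
    (p q r : Atom S₁ S₂ S₃) : ℝ :=
  ∫ t in (ε * j)..(ε * (j + 1)), atomControl κ ε a p t *
    ∫ s in (ε * j)..t, atomControl κ ε a q s * ∫ l in (ε * j)..s, atomControl κ ε a r l

/-- The principal part of the second iterated integrals. -/
def iterMain₂ (κ : Freq S₂ S₃) (ε : ℝ) (a : EuclideanSpace ℝ (Idx S₁ S₂ S₃)) (j : ℤ) :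
    Atom S₁ S₂ S₃ → Atom S₁ S₂ S₃ → ℝ
  | .inr (.inl p), .inr (.inl q) => iter₂ κ ε a j (.inr (.inl p)) (.inr (.inl q))
  | _, _ => 0

/-- The principal part of the third iterated integrals. -/
def iterMain₃ (κ : Freq S₂ S₃) (ε : ℝ) (a : EuclideanSpace ℝ (Idx S₁ S₂ S₃)) (j : ℤ) :
    Atom S₁ S₂ S₃ → Atom S₁ S₂ S₃ → Atom S₁ S₂ S₃ → ℝ
  | .inr (.inr p), .inr (.inr q), .inr (.inr r) =>
    iter₃ κ ε a j (.inr (.inr p)) (.inr (.inr q)) (.inr (.inr r))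
  | _, _, _ => 0

variable {κ : Freq S₂ S₃} {ε : ℝ} {a : EuclideanSpace ℝ (Idx S₁ S₂ S₃)} {j : ℤ}

theorem atomFreq_pos (hκ : κ.NonResonant) (p : (↥S₂ × Fin 2) ⊕ (↥S₃ × Fin 4)) :
    0 < atomFreq (S₁ := S₁) κ (.inr p) := by
  rcases p with p | p
  · exact hκ.pos_k p.1
  · exact hκ.pos_quad p

theorem iter₁_inl (hε : ε ≠ 0) (i : ↥S₁) : iter₁ κ ε a j (.inl i) = ε * a (.inl i) := by
  simp only [iter₁, atomControl, intervalIntegral.integral_const_mul, integral_osc hε]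
  simp [atomAmp, atomFreq, atomPhase, qcos, mul_comm]

theorem iter₁_inr (hκ : κ.NonResonant) (hε : ε ≠ 0) (p : (↥S₂ × Fin 2) ⊕ (↥S₃ × Fin 4)) :
    iter₁ κ ε a j (.inr p) = 0 := by
  simp only [iter₁, atomControl, intervalIntegral.integral_const_mul, integral_osc hε]
  rw [if_neg (atomFreq_pos hκ p).ne', mul_zero]

theorem iter₂_inr (hκ : κ.NonResonant) (hε : ε ≠ 0) (p q : (↥S₂ × Fin 2) ⊕ (↥S₃ × Fin 4)) :
    iter₂ κ ε a j (.inr p) (.inr q) = atomAmp κ ε a (.inr p) * atomAmp κ ε a (.inr q) *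
      if atomFreq (S₁ := S₁) κ (.inr p) = atomFreq (S₁ := S₁) κ (.inr q) then
        ε ^ 2 * qcos (atomPhase (.inr p : Atom S₁ S₂ S₃) - atomPhase (.inr q : Atom S₁ S₂ S₃) + 1) /
          (4 * Real.pi * atomFreq (S₁ := S₁) κ (.inr p)) else 0 := by
  rw [← iterated_integral_osc_two hε (atomFreq_pos hκ p) (atomFreq_pos hκ q) _ _ j]
  simp only [iter₂, atomControl, intervalIntegral.integral_const_mul]
  rw [← intervalIntegral.integral_const_mul]
  refine intervalIntegral.integral_congr (E := ℝ) fun t _ => ?_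
  ring

theorem quad_injective (hκ : κ.NonResonant) : Function.Injective κ.quad :=
  hκ.distinct.comp Sum.inr_injective

/-- The two diagonal conditions of the triple integral hold because equal frequencies here mean the
same oscillation, hence equal phases, and `cos (±π / 2) = 0`. -/
theorem iter₃_inr (hκ : κ.NonResonant) (hε : ε ≠ 0) (p q r : ↥S₃ × Fin 4) :
    iter₃ κ ε a j (.inr (.inr p)) (.inr (.inr q)) (.inr (.inr r)) =
      (quadAmp κ ε a p.1 * quadWeight p.2) * (quadAmp κ ε a q.1 * quadWeight q.2) *
        (quadAmp κ ε a r.1 * quadWeight r.2) * tripleCoeff ε (κ.quad p) (κ.quad q) (κ.quad r)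
        (quadPhase p.2) (quadPhase q.2) (quadPhase r.2) := by
  rw [tripleCoeff, ← iterated_integral_osc_three hε (hκ.pos_quad p) (hκ.pos_quad q)
    (hκ.pos_quad r) _ _ _ j (fun h => ?_) (fun h => ?_)]
  · simp only [iter₃, atomControl, intervalIntegral.integral_const_mul, atomAmp, atomFreq,
      atomPhase]
    rw [← intervalIntegral.integral_const_mul]
    refine intervalIntegral.integral_congr (E := ℝ) fun t _ => ?_
    have : ∀ s, quadAmp κ ε a q.1 * quadWeight q.2 * osc ε (κ.quad q) (quadPhase q.2) s *
        (quadAmp κ ε a r.1 * quadWeight r.2 *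
          ∫ l in (ε * j)..s, osc ε (κ.quad r) (quadPhase r.2) l) =
        (quadAmp κ ε a q.1 * quadWeight q.2 * (quadAmp κ ε a r.1 * quadWeight r.2)) *
        (osc ε (κ.quad q) (quadPhase q.2) s *
          ∫ l in (ε * j)..s, osc ε (κ.quad r) (quadPhase r.2) l) := fun s => by ring
    simp only [this, intervalIntegral.integral_const_mul]
    ring
  · rw [quad_injective hκ h]; ring_nf; rfl
  · rw [quad_injective hκ h]; ring_nf; rfl

/-- Pairs involving `S₃` have order 4 or 5, too large for the remainder, so exact vanishing is
needed. Different oscillations have different frequencies here, and an oscillation paired with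
itself is a quarter turn away from its primitive. -/
theorem iter₂_sub_main_eq_zero (hκ : κ.NonResonant) (hε : ε ≠ 0)
    (p q : (↥S₂ × Fin 2) ⊕ (↥S₃ × Fin 4)) :
    iter₂ κ ε a j (.inr p) (.inr q) - iterMain₂ κ ε a j (.inr p) (.inr q) = 0 := by
  rcases p with p | p <;> rcases q with q | q
  · simp [iterMain₂]
  · rw [iter₂_inr hκ hε, if_neg]
    · simp [iterMain₂]
    · intro h; have := hκ.distinct (a₁ := .inl p.1) (a₂ := .inr q) h; simp at this
  · rw [iter₂_inr hκ hε, if_neg]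
    · simp [iterMain₂]
    · intro h; have := hκ.distinct (a₁ := .inr p) (a₂ := .inl q.1) h; simp at this
  · rw [iter₂_inr hκ hε]
    split_ifs with h
    · have h' : p = q := quad_injective hκ h
      subst h'
      simp [iterMain₂]
      simp [qcos]
    · simp [iterMain₂]

theorem abs_iter_le {W θ Q t : ℝ} {w : ℝ → ℝ}
    (hA : ∀ p, ε * |atomAmp κ ε a p| ≤ W * θ ^ atomOrder p) (p : Atom S₁ S₂ S₃)
    (ht : t ∈ Icc (ε * j) (ε * (j + 1))) (hw : ∀ s ∈ Icc (ε * j) (ε * (j + 1)), |w s| ≤ Q) :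
    |∫ s in (ε * j)..t, atomControl κ ε a p s * w s| ≤ W * θ ^ atomOrder p * Q := by
  refine (abs_integral_mul_le ht (fun s => abs_atomControl_le κ ε a p s) hw).trans ?_
  have hQ : 0 ≤ Q := (abs_nonneg _).trans (hw t ht)
  rw [show ε * ((j : ℝ) + 1) - ε * j = ε by ring]
  exact mul_le_mul_of_nonneg_right (hA p) hQ

theorem abs_iter₁_le {W θ t : ℝ}
    (hA : ∀ p, ε * |atomAmp κ ε a p| ≤ W * θ ^ atomOrder p) (p : Atom S₁ S₂ S₃)
    (ht : t ∈ Icc (ε * j) (ε * (j + 1))) :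
    |∫ s in (ε * j)..t, atomControl κ ε a p s| ≤ W * θ ^ atomOrder p := by
  simpa using abs_iter_le (w := fun _ => 1) (Q := 1) hA p ht (fun _ _ => by simp)

theorem pow_mul_pow_le_of_order {W θ : ℝ} (hW : 1 ≤ W) (hθ : 0 ≤ θ) (hθ1 : θ ≤ 1) {k l : ℕ} (hk : k ≤ 3)
    (hl : 7 ≤ l) : W ^ k * θ ^ l ≤ W ^ 3 * θ ^ 7 :=
  mul_le_mul (pow_le_pow_right₀ hW hk) (pow_le_pow_of_le_one hθ hθ1 hl) (by positivity)
    (by positivity)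

/-- A pair containing an `S₁` term has order at least `6 + 2`; all other pairs are treated exactly.
-/
theorem abs_iter₂_sub_main_le (hκ : κ.NonResonant) {W θ : ℝ} (hW : 1 ≤ W) (hε : 0 < ε)
    (hθ : 0 ≤ θ) (hθ1 : θ ≤ 1) (hA : ∀ p, ε * |atomAmp κ ε a p| ≤ W * θ ^ atomOrder p)
    (p q : Atom S₁ S₂ S₃) :
    |iter₂ κ ε a j p q - iterMain₂ κ ε a j p q| ≤ W ^ 3 * θ ^ 7 := by
  have hb : ε * (j + 1) ∈ Icc (ε * j) (ε * (j + 1)) := right_mem_Icc.2 (by nlinarith)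
  have h0 : 0 ≤ W ^ 3 * θ ^ 7 := by positivity
  have h : |iter₂ κ ε a j p q| ≤ W ^ 2 * θ ^ (atomOrder p + atomOrder q) :=
    (abs_iter_le hA p hb fun s hs => abs_iter₁_le hA q hs).trans
      (le_of_eq (by rw [pow_add]; ring))
  rcases p with p | p
  · have : iterMain₂ κ ε a j (.inl p) q = 0 := rfl
    rw [this, sub_zero]
    refine h.trans (pow_mul_pow_le_of_order hW hθ hθ1 (by norm_num) ?_)
    rcases q with q | q | q <;> simp [atomOrder]
  · rcases q with q | q
    · have : iterMain₂ κ ε a j (.inr p) (.inl q) = 0 := by rcases p with p | p <;> rfl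
      rw [this, sub_zero]
      refine h.trans (pow_mul_pow_le_of_order hW hθ hθ1 (by norm_num) ?_)
      rcases p with p | p <;> simp [atomOrder]
    · rw [iter₂_sub_main_eq_zero hκ hε.ne', abs_zero]; exact h0

/-- A triple not entirely from `S₃` has order at least `3 + 2 + 2 = 7`. -/
theorem abs_iter₃_sub_main_le {W θ : ℝ} (hW : 1 ≤ W) (hε : 0 < ε)
    (hθ : 0 ≤ θ) (hθ1 : θ ≤ 1) (hA : ∀ p, ε * |atomAmp κ ε a p| ≤ W * θ ^ atomOrder p)
    (p q r : Atom S₁ S₂ S₃) :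
    |iter₃ κ ε a j p q r - iterMain₃ κ ε a j p q r| ≤ W ^ 3 * θ ^ 7 := by
  have hb : ε * (j + 1) ∈ Icc (ε * j) (ε * (j + 1)) := right_mem_Icc.2 (by nlinarith)
  have h : |iter₃ κ ε a j p q r| ≤ W ^ 3 * θ ^ (atomOrder p + (atomOrder q + atomOrder r)) :=
    (abs_iter_le hA p hb fun s hs => abs_iter_le hA q hs fun l hl =>
      abs_iter₁_le hA r hl).trans (le_of_eq (by rw [pow_add, pow_add]; ring))
  have h' : 7 ≤ atomOrder p + (atomOrder q + atomOrder r) → iterMain₃ κ ε a j p q r = 0 →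
      |iter₃ κ ε a j p q r - iterMain₃ κ ε a j p q r| ≤ W ^ 3 * θ ^ 7 := fun h7 h0 => by
    rw [h0, sub_zero]; exact h.trans (pow_mul_pow_le_of_order hW hθ hθ1 le_rfl h7)
  rcases p with p | p | p <;> rcases q with q | q | q <;> rcases r with r | r | r <;>
    first
    | exact h' (by simp [atomOrder]) rfl
    | (rw [iterMain₃, sub_self, abs_zero]; positivity)

/-- The principal part of the second-order terms. -/
theorem sum_iterMain₂ {n : ℕ} (f : Fin m → State n → State n) (hκ : κ.NonResonant) (hε : 0 < ε)
    (x : State n) :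
    ∑ p, ∑ q, iterMain₂ κ ε a j p q • lieD (f (atomField q)) (f (atomField p)) x =
      ε • ∑ i : ↥S₂, a (.inr (.inl i)) • column f (.inr (.inl i) : Idx S₁ S₂ S₃) x := by
  simp only [Fintype.sum_sum_type, iterMain₂, zero_smul, Finset.sum_const_zero, zero_add, add_zero]
  simp only [Fintype.sum_prod_type, Finset.smul_sum]
  refine Finset.sum_congr rfl fun i _ => ?_
  have hsame : ∀ s : Fin 2, ∑ i', ∑ s', iter₂ κ ε a j (.inr (.inl (i, s))) (.inr (.inl (i', s'))) •
      lieD (f (atomField (.inr (.inl (i', s')) : Atom S₁ S₂ S₃)))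
        (f (atomField (.inr (.inl (i, s)) : Atom S₁ S₂ S₃))) x =
      ∑ s', iter₂ κ ε a j (.inr (.inl (i, s))) (.inr (.inl (i, s'))) •
      lieD (f (atomField (.inr (.inl (i, s')) : Atom S₁ S₂ S₃)))
        (f (atomField (.inr (.inl (i, s)) : Atom S₁ S₂ S₃))) x := fun s => by
    refine Fintype.sum_eq_single i fun i' hi' => Finset.sum_eq_zero fun s' _ => ?_
    rw [iter₂_inr hκ hε.ne', if_neg, mul_zero, zero_smul]
    intro h
    have := hκ.distinct (a₁ := .inl i) (a₂ := .inl i') h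
    simp only [Sum.inl.injEq] at this
    exact hi' this.symm
  simp only [hsame]
  have hk : (0 : ℝ) < κ.k i := by exact_mod_cast hκ.pos_k i
  -- Only the cosine carries the sign, so the product of the two amplitudes restores the signed
  -- coefficient.
  have hsq : √|a (.inr (.inl i))| * √|a (.inr (.inl i))| * Real.sign (a (.inr (.inl i))) =
      a (.inr (.inl i)) := by
    rw [Real.mul_self_sqrt (abs_nonneg _)]
    rcases lt_trichotomy (a (.inr (.inl i))) 0 with h | h | h
    · rw [Real.sign_of_neg h, abs_of_neg h]; ring
    · simp [h]
    · rw [Real.sign_of_pos h, abs_of_pos h]; ring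
  have hsk : √(Real.pi * κ.k i) * √(Real.pi * κ.k i) = Real.pi * κ.k i :=
    Real.mul_self_sqrt (by positivity)
  have he : ε ^ (-(1 / 2) : ℝ) * ε ^ (-(1 / 2) : ℝ) * ε ^ 2 = ε := by
    rw [← Real.rpow_add hε, ← Real.rpow_natCast, ← Real.rpow_add hε]; norm_num
  have hcoef : (ε ^ (-(1 / 2) : ℝ) * (√|a (.inr (.inl i))| * (2 * √(Real.pi * κ.k i)))) *
      (ε ^ (-(1 / 2) : ℝ) * (√|a (.inr (.inl i))| * (2 * √(Real.pi * κ.k i)))) *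
      Real.sign (a (.inr (.inl i))) * (ε ^ 2 / (4 * Real.pi * κ.k i)) = ε * a (.inr (.inl i)) := by
    have hpi := Real.pi_pos
    calc _ = (ε ^ (-(1 / 2) : ℝ) * ε ^ (-(1 / 2) : ℝ) * ε ^ 2) *
          (√|a (.inr (.inl i))| * √|a (.inr (.inl i))| * Real.sign (a (.inr (.inl i)))) *
          (4 * (√(Real.pi * κ.k i) * √(Real.pi * κ.k i)) / (4 * Real.pi * κ.k i)) := by ring
      _ = _ := by rw [he, hsq, hsk]; field_simp
  -- The diagonal integrals vanish and the two mixed ones are opposite: this antisymmetry turns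
  -- second-order Lie derivatives into a bracket.
  have q1 : qcos (0 - 0 + 1) = 0 := rfl
  have q2 : qcos (0 - -1 + 1) = -1 := rfl
  have q3 : qcos (-1 - 0 + 1) = 1 := rfl
  have q4 : qcos (-1 - -1 + 1) = 0 := rfl
  simp only [Fin.sum_univ_two, iter₂_inr hκ hε.ne', atomFreq, atomPhase, atomField, atomAmp, if_true,
    Matrix.cons_val_zero, Matrix.cons_val_one, q1, q2, q3, q4, column, lieBracket_eq_lieD]
  rw [smul_smul, ← hcoef]
  push_cast
  match_scalars <;> ring

/-- The principal part of the third-order terms. -/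
theorem sum_iterMain₃ {n : ℕ} {D : Set (State n)} (hD : IsOpen D) {f : Fin m → State n → State n}
    (hf : ∀ i, ContDiffOn ℝ 3 (f i) D) (hκ : κ.NonResonant) (hε : 0 < ε) {x : State n}
    (hx : x ∈ D) :
    ∑ p, ∑ q, ∑ r, iterMain₃ κ ε a j p q r •
        lieD (f (atomField r)) (lieD (f (atomField q)) (f (atomField p))) x =
      ε • ∑ i : ↥S₃, a (.inr (.inr i)) • column f (.inr (.inr i) : Idx S₁ S₂ S₃) x := by
  simp only [Fintype.sum_sum_type, iterMain₃, zero_smul, Finset.sum_const_zero, zero_add]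
  simp only [Fintype.sum_prod_type, Finset.smul_sum]
  refine Finset.sum_congr rfl fun l _ => ?_
  have hres := fun x y z h => hκ.resonant (x := x) (y := y) (z := z) h
  -- Triples mixing different `ℓ` never resonate, so each `ℓ` contributes separately.
  have hzero : ∀ p q r : ↥S₃ × Fin 4, ¬ (q.1 = p.1 ∧ r.1 = p.1) →
      iter₃ κ ε a j (.inr (.inr p)) (.inr (.inr q)) (.inr (.inr r)) = 0 := by
    intro p q r h
    rw [iter₃_inr hκ hε.ne', tripleCoeff, if_neg, if_neg, if_neg]
    · simp
    · intro hh; obtain ⟨h1, h2, -⟩ := hres _ _ _ hh.symm; exact h ⟨h1, h2⟩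
    · intro hh; obtain ⟨h1, h2, -⟩ := hres _ _ _ hh; exact h ⟨h1.symm, h2.trans h1.symm⟩
    · intro hh; obtain ⟨h1, h2, -⟩ := hres _ _ _ hh; exact h ⟨h2.trans h1.symm, h1.symm⟩
  let Y : Fin 3 → Fin 3 → Fin 3 → State n := fun u v w =>
    lieD (f ((![l.1.1, l.1.2.1, l.1.2.2] : Fin 3 → Fin m) w))
      (lieD (f ((![l.1.1, l.1.2.1, l.1.2.2] : Fin 3 → Fin m) v))
        (f ((![l.1.1, l.1.2.1, l.1.2.2] : Fin 3 → Fin m) u))) x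
  have hsame : ∀ s : Fin 4, ∑ l', ∑ s', ∑ l'', ∑ s'',
      iter₃ κ ε a j (.inr (.inr (l, s))) (.inr (.inr (l', s'))) (.inr (.inr (l'', s''))) •
      lieD (f (atomField (.inr (.inr (l'', s'')) : Atom S₁ S₂ S₃)))
        (lieD (f (atomField (.inr (.inr (l', s')) : Atom S₁ S₂ S₃)))
          (f (atomField (.inr (.inr (l, s)) : Atom S₁ S₂ S₃)))) x =
      ∑ s', ∑ s'', (quadAmp κ ε a l ^ 3) • (quadWeight s * quadWeight s' * quadWeight s'' *
        tripleCoeff ε (κ.quad (l, s)) (κ.quad (l, s')) (κ.quad (l, s''))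
          (quadPhase s) (quadPhase s') (quadPhase s'')) •
          Y (quadSlot s) (quadSlot s') (quadSlot s'') := fun s => by
    rw [Fintype.sum_eq_single l]
    · refine Finset.sum_congr rfl fun s' _ => ?_
      rw [Fintype.sum_eq_single l]
      · refine Finset.sum_congr rfl fun s'' _ => ?_
        rw [iter₃_inr hκ hε.ne', smul_smul]
        congr 1
        ring
      · intro l'' hl''
        refine Finset.sum_eq_zero fun s'' _ => ?_
        rw [hzero _ _ _ fun h => hl'' h.2, zero_smul]
    · intro l' hl'
      refine Finset.sum_eq_zero fun s' _ => Finset.sum_eq_zero fun l'' _ =>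
        Finset.sum_eq_zero fun s'' _ => ?_
      rw [hzero _ _ _ fun h => hl' h.1, zero_smul]
  simp only [hsame, ← Finset.smul_sum]
  have p1 : 0 < κ.k₁ l := hκ.pos_quad (l, 0)
  have p3 : 0 < κ.k₁ l + κ.k₂ l := hκ.pos_quad (l, 2)
  have p4 : 0 < κ.k₂ l - κ.k₁ l := hκ.pos_quad (l, 3)
  rw [sum_quadruple ε (k₂ := κ.k₂ l) p1 (by omega) (fun s => κ.quad (l, s)) (by ext s; fin_cases s <;> rfl)
    (fun u v w h => (hres _ _ _ h).2.2) Y]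
  have hY : Y 2 1 0 + Y 0 1 2 - Y 2 0 1 - Y 1 0 2 =
      column f (.inr (.inr l) : Idx S₁ S₂ S₃) x :=
    (lieBracket_lieBracket_eq_lieD hD (hf _) (hf _) (hf _) hx).symm
  rw [hY, smul_smul, smul_smul]
  congr 1
  have he : (ε ^ (-(2 / 3) : ℝ)) ^ 3 * ε ^ 3 = ε := by
    rw [← Real.rpow_natCast, ← Real.rpow_mul hε.le, ← Real.rpow_natCast, ← Real.rpow_add hε]
    norm_num
  have h3 : ((κ.k₁ l + κ.k₂ l : ℤ) : ℝ) ≠ 0 := by exact_mod_cast p3.ne'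
  have h4 : ((κ.k₂ l - κ.k₁ l : ℤ) : ℝ) ≠ 0 := by exact_mod_cast p4.ne'
  have hpi := Real.pi_ne_zero
  -- The cube of the amplitude, `2³ · 2 π² κ₃ κ₄ · a`, exactly cancels the denominator `16 π² κ₃ κ₄`
  -- of the quadruple sum.
  rw [quadAmp, mul_pow, mul_pow, mul_pow, cbrt_pow_three, cbrt_pow_three]
  push_cast at h3 h4 ⊢
  calc _ = ((ε ^ (-(2 / 3) : ℝ)) ^ 3 * ε ^ 3) * a (.inr (.inr l)) *
        (2 ^ 3 * (2 * Real.pi ^ 2 * (κ.k₁ l + κ.k₂ l) * (κ.k₂ l - κ.k₁ l)) /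
          (16 * Real.pi ^ 2 * (κ.k₁ l + κ.k₂ l) * (κ.k₂ l - κ.k₁ l))) := by ring
    _ = _ := by rw [he]; field_simp; ring

end PeriodExpansion

/-! ### Displacement over one sampling interval. -/

section Period

variable {n m : ℕ} {S₁ : Finset (Fin m)} {S₂ : Finset (Fin m × Fin m)}
  {S₃ : Finset (Fin m × Fin m × Fin m)}

theorem exists_norm_bound {ι E : Type*} [Finite ι] [NormedAddCommGroup E] {K D : Set E}
    (hK : IsCompact K) (hKD : K ⊆ D) {X : ι → E → E} (hX : ∀ i, ContinuousOn (X i) D) :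
    ∃ B, 0 ≤ B ∧ ∀ i, ∀ x ∈ K, ‖X i x‖ ≤ B := by
  choose b hb using fun i => hK.exists_bound_of_continuousOn ((hX i).mono hKD)
  obtain ⟨M, hM⟩ := Finite.exists_le b
  exact ⟨max M 0, le_max_right _ _, fun i x hx => (hb i x hx).trans ((hM i).trans (le_max_left _ _))⟩

/-- The displacement over a period is `ε ∑ aᵢ columnᵢ`, up to the drift and to terms of order
`(ε ‖a‖)^{7/6}`. -/
theorem period_expansion {D K : Set (State n)} (hD : IsOpen D) (hKD : K ⊆ D)
    (hKc : IsCompact K) (hK : Convex ℝ K) {f : Fin m → State n → State n}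
    (hf : ∀ i, ContDiffOn ℝ 3 (f i) D) {κ : Freq S₂ S₃} (hκ : κ.NonResonant) :
    ∃ C, 0 ≤ C ∧ ∃ c₀, 0 < c₀ ∧ ∀ (ε θ Γ : ℝ) (a : EuclideanSpace ℝ (Idx S₁ S₂ S₃)) (j : ℤ)
      (y : ℝ → State n), 0 < ε → 0 ≤ θ → θ ≤ c₀ → (∀ i, ε * |a i| ≤ θ ^ 6) →
      IsForcedPath K (fun p => f (atomField p)) (atomControl κ ε a) Γ (ε * j) (ε * (j + 1)) y →
      ‖y (ε * (j + 1)) - y (ε * j) - ε • ∑ i, a i • column f i (y (ε * j))‖ ≤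
        C * (Γ * ε + θ ^ 7) := by
  obtain ⟨C₀, hC₀, hCF⟩ := chenFliess (A := Atom S₁ S₂ S₃) (F := fun p => f (atomField p)) hD hKD hKc
    hK (fun p => hf _)
  obtain ⟨W, hW, hA⟩ := exists_atomAmp_bound (S₁ := S₁) κ
  have hX2 : ∀ q p, ContDiffOn ℝ 2 (lieD (f q) (f p)) D := fun q p =>
    contDiffOn_lieD (k := 2) (l := 3) hD ((hf q).of_le (by norm_num)) (hf p) (by norm_num)
  obtain ⟨B₂, hB₂, hB₂'⟩ := exists_norm_bound (ι := Atom S₁ S₂ S₃ × Atom S₁ S₂ S₃) hKc hKD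
    (X := fun p => lieD (f (atomField p.2)) (f (atomField p.1))) fun p => (hX2 _ _).continuousOn
  obtain ⟨B₃, hB₃, hB₃'⟩ := exists_norm_bound
    (ι := Atom S₁ S₂ S₃ × Atom S₁ S₂ S₃ × Atom S₁ S₂ S₃) hKc hKD
    (X := fun p => lieD (f (atomField p.2.2)) (lieD (f (atomField p.2.1)) (f (atomField p.1))))
    fun p => continuousOn_lieD hD (hf _).continuousOn ((hX2 _ _).of_le (by norm_num))
  have hW0 : 0 < W := by linarith
  refine ⟨C₀ * (1 + W ^ 4) + Fintype.card (Atom S₁ S₂ S₃ × Atom S₁ S₂ S₃) * (W ^ 3 * B₂) +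
    Fintype.card (Atom S₁ S₂ S₃ × Atom S₁ S₂ S₃ × Atom S₁ S₂ S₃) * (W ^ 3 * B₃), by positivity,
    -- This threshold gives `W θ ≤ 1`, hence `θ ≤ 1` and total control size `W θ² ≤ 1`, as the
    -- Chen–Fliess bound requires.
    W⁻¹, by positivity, ?_⟩
  intro ε θ Γ a j y hε hθ hθc ha hy
  have hθW : W * θ ≤ 1 := by
    calc W * θ ≤ W * W⁻¹ := by gcongr
      _ = 1 := mul_inv_cancel₀ hW0.ne'
  have hθ1 : θ ≤ 1 := le_trans (by nlinarith) hθW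
  have hA' := hA ε θ a hε hθ ha
  have hlen : ε * ((j : ℝ) + 1) - ε * j = ε := by ring
  have hmem : y (ε * j) ∈ K := hy.mem _ (left_mem_Icc.2 hy.le)
  have hUω : W * θ ^ 2 / ε * (ε * ((j : ℝ) + 1) - ε * j) = W * θ ^ 2 := by
    rw [hlen]; field_simp
  -- The lowest order, 2, bounds every oscillation uniformly; the fourth-order remainder is then of
  -- order `θ⁸`.
  have h1 := hCF (atomControl κ ε a) Γ _ _ (W * θ ^ 2 / ε) y hy
    (continuous_atomControl κ ε a) (fun p t _ => by
      refine (abs_atomControl_le κ ε a p t).trans ?_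
      rw [le_div_iff₀ hε, mul_comm]
      refine (hA' p).trans ?_
      gcongr W * ?_
      refine pow_le_pow_of_le_one hθ hθ1 ?_
      rcases p with p | p | p <;> simp [atomOrder]) (by positivity)
    (by rw [hUω]; nlinarith)
  rw [hUω, hlen] at h1
  set x := y (ε * j)
  change ‖y (ε * (j + 1)) - x - ∑ p, (iter₁ κ ε a j p • f (atomField p) x +
    ∑ q, (iter₂ κ ε a j p q • lieD (f (atomField q)) (f (atomField p)) x +
      ∑ r, iter₃ κ ε a j p q r • lieD (f (atomField r)) (lieD (f (atomField q))
        (f (atomField p))) x))‖ ≤ _ at h1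
  simp only [Finset.sum_add_distrib] at h1
  have hlev1 : ∑ p, iter₁ κ ε a j p • f (atomField p) x =
      ε • ∑ i : ↥S₁, a (.inl i) • column f (.inl i : Idx S₁ S₂ S₃) x := by
    simp only [Fintype.sum_sum_type (α₁ := ↥S₁), iter₁_inl hε.ne', iter₁_inr hκ hε.ne', zero_smul,
      Finset.sum_const_zero, add_zero, mul_smul, Finset.smul_sum]
    rfl
  have h2 := norm_sum_smul_sub_le (ι := Atom S₁ S₂ S₃ × Atom S₁ S₂ S₃)
    (S := fun p => iter₂ κ ε a j p.1 p.2) (M := fun p => iterMain₂ κ ε a j p.1 p.2)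
    (X := fun p => lieD (f (atomField p.2)) (f (atomField p.1)) x)
    (fun p => abs_iter₂_sub_main_le hκ hW hε hθ hθ1 hA' p.1 p.2) (fun p => hB₂' p x hmem)
  have h3 := norm_sum_smul_sub_le (ι := Atom S₁ S₂ S₃ × Atom S₁ S₂ S₃ × Atom S₁ S₂ S₃)
    (S := fun p => iter₃ κ ε a j p.1 p.2.1 p.2.2) (M := fun p => iterMain₃ κ ε a j p.1 p.2.1 p.2.2)
    (X := fun p => lieD (f (atomField p.2.2)) (lieD (f (atomField p.2.1)) (f (atomField p.1))) x)
    (fun p => abs_iter₃_sub_main_le hW hε hθ hθ1 hA' p.1 p.2.1 p.2.2) (fun p => hB₃' p x hmem)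
  simp only [Fintype.sum_prod_type (α₁ := Atom S₁ S₂ S₃)] at h2 h3
  rw [sum_iterMain₂ f hκ hε] at h2
  rw [sum_iterMain₃ hD hf hκ hε (hKD hmem)] at h3
  rw [hlev1] at h1
  have hcol : ε • ∑ i, a i • column f i x =
      ε • ∑ i : ↥S₁, a (.inl i) • column f (.inl i : Idx S₁ S₂ S₃) x +
      (ε • ∑ i : ↥S₂, a (.inr (.inl i)) • column f (.inr (.inl i) : Idx S₁ S₂ S₃) x +
      ε • ∑ i : ↥S₃, a (.inr (.inr i)) • column f (.inr (.inr i) : Idx S₁ S₂ S₃) x) := by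
    rw [Fintype.sum_sum_type, Fintype.sum_sum_type, smul_add, smul_add]
  rw [hcol]
  set T₁ := ε • ∑ i : ↥S₁, a (.inl i) • column f (.inl i : Idx S₁ S₂ S₃) x
  set T₂ := ε • ∑ i : ↥S₂, a (.inr (.inl i)) • column f (.inr (.inl i) : Idx S₁ S₂ S₃) x
  set T₃ := ε • ∑ i : ↥S₃, a (.inr (.inr i)) • column f (.inr (.inr i) : Idx S₁ S₂ S₃) x
  generalize ∑ p, ∑ q, iter₂ κ ε a j p q • lieD (f (atomField q)) (f (atomField p)) x = Z₂ at h1 h2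
  generalize ∑ p, ∑ q, ∑ r, iter₃ κ ε a j p q r • lieD (f (atomField r)) (lieD (f (atomField q))
        (f (atomField p))) x = Z₃ at h1 h3
  have hsplit : y (ε * (j + 1)) - x - (T₁ + (T₂ + T₃)) =
      (y (ε * (j + 1)) - x - (T₁ + (Z₂ + Z₃))) + (Z₂ - T₂) + (Z₃ - T₃) := by abel
  rw [hsplit]
  have hΓε : 0 ≤ Γ * ε := mul_nonneg hy.nonneg hε.le
  have h87 : (W * θ ^ 2) ^ 4 ≤ W ^ 4 * θ ^ 7 := by
    rw [mul_pow, ← pow_mul]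
    gcongr W ^ 4 * ?_
    exact pow_le_pow_of_le_one hθ hθ1 (by norm_num)
  set N₂ : ℝ := (Fintype.card (Atom S₁ S₂ S₃ × Atom S₁ S₂ S₃) : ℝ)
  set N₃ : ℝ := (Fintype.card (Atom S₁ S₂ S₃ × Atom S₁ S₂ S₃ × Atom S₁ S₂ S₃) : ℝ)
  have hN₂ : 0 ≤ N₂ := Nat.cast_nonneg _
  have hN₃ : 0 ≤ N₃ := Nat.cast_nonneg _
  have hθ7 : 0 ≤ θ ^ 7 := by positivity
  calc _ ≤ C₀ * (Γ * ε + (W * θ ^ 2) ^ 4) + N₂ * (W ^ 3 * θ ^ 7 * B₂) + N₃ * (W ^ 3 * θ ^ 7 * B₃) :=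
        (norm_add_le _ _).trans (add_le_add ((norm_add_le _ _).trans (add_le_add h1 h2)) h3)
    _ ≤ C₀ * ((1 + W ^ 4) * (Γ * ε + θ ^ 7)) + N₂ * (W ^ 3 * B₂) * (Γ * ε + θ ^ 7) +
        N₃ * (W ^ 3 * B₃) * (Γ * ε + θ ^ 7) := by
        have hW4 : 0 ≤ W ^ 4 := by positivity
        have e2 : N₂ * (W ^ 3 * θ ^ 7 * B₂) ≤ N₂ * (W ^ 3 * B₂) * (Γ * ε + θ ^ 7) := by
          have : 0 ≤ N₂ * (W ^ 3 * B₂) * (Γ * ε) := by positivity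
          linarith
        have e3 : N₃ * (W ^ 3 * θ ^ 7 * B₃) ≤ N₃ * (W ^ 3 * B₃) * (Γ * ε + θ ^ 7) := by
          have : 0 ≤ N₃ * (W ^ 3 * B₃) * (Γ * ε) := by positivity
          linarith
        gcongr
        nlinarith [mul_nonneg hW4 hΓε]
    _ = _ := by ring

end Period

/-! ### Lipschitz functions on adjacent intervals. -/

section Gluing

variable {E : Type*} [NormedAddCommGroup E]

theorem lipschitzOnWith_Icc_union {z : ℝ → E} {a b c : ℝ} {L : NNReal}
    (h1 : LipschitzOnWith L z (Icc a b)) (h2 : LipschitzOnWith L z (Icc b c)) :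
    LipschitzOnWith L z (Icc a c) := by
  have key : ∀ s ∈ Icc a c, ∀ t ∈ Icc a c, s ≤ t → dist (z s) (z t) ≤ L * (t - s) := by
    intro s hs t ht hst
    have hd : ∀ {u v : ℝ}, u ≤ v → dist u v = v - u := fun h => by
      rw [Real.dist_eq, abs_sub_comm, abs_of_nonneg (sub_nonneg.2 h)]
    rcases le_total t b with htb | htb
    · rw [← hd hst]; exact h1.dist_le_mul s ⟨hs.1, hst.trans htb⟩ t ⟨ht.1, htb⟩
    rcases le_total b s with hbs | hbs
    · rw [← hd hst]; exact h2.dist_le_mul s ⟨hbs, hs.2⟩ t ⟨htb, ht.2⟩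
    have e1 := h1.dist_le_mul s ⟨hs.1, hbs⟩ b ⟨hs.1.trans hbs, le_rfl⟩
    have e2 := h2.dist_le_mul b ⟨le_rfl, htb.trans ht.2⟩ t ⟨htb, ht.2⟩
    rw [hd hbs] at e1
    rw [hd htb] at e2
    calc _ ≤ _ := dist_triangle _ (z b) _
      _ ≤ _ := add_le_add e1 e2
      _ = _ := by ring
  refine LipschitzOnWith.of_dist_le_mul fun s hs t ht => ?_
  rcases le_total s t with h | h
  · rw [Real.dist_eq, abs_sub_comm, abs_of_nonneg (sub_nonneg.2 h)]; exact key s hs t ht h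
  · rw [dist_comm, Real.dist_eq, abs_of_nonneg (sub_nonneg.2 h)]; exact key t ht s hs h

theorem lipschitzOnWith_congr {z w : ℝ → E} {s : Set ℝ} {L : NNReal} (h : LipschitzOnWith L w s)
    (hzw : EqOn z w s) : LipschitzOnWith L z s := fun x hx y hy => by
  rw [hzw hx, hzw hy]; exact h hx hy

end Gluing

/-! ### Radial retraction onto a ball. -/

section Retraction

variable {E : Type*} [NormedAddCommGroup E] [NormedSpace ℝ E]

/-- The radial retraction onto the closed ball of radius `r`. -/
def ballRetract (r : ℝ) (x : E) : E := (r / max r ‖x‖) • x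

theorem continuous_ballRetract {r : ℝ} (hr : 0 < r) : Continuous (ballRetract r : E → E) := by
  unfold ballRetract
  exact (continuous_const.div (continuous_const.max continuous_norm)
    fun x => (lt_max_of_lt_left hr).ne').smul continuous_id

theorem ballRetract_mem {r : ℝ} (hr : 0 < r) (x : E) :
    ballRetract r x ∈ Metric.closedBall (0 : E) r := by
  have hm : 0 < max r ‖x‖ := lt_max_of_lt_left hr
  rw [mem_closedBall_zero_iff, ballRetract, norm_smul, Real.norm_eq_abs,
    abs_of_nonneg (by positivity), div_mul_eq_mul_div, div_le_iff₀ hm]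
  gcongr; exact le_max_right _ _

theorem ballRetract_of_mem {r : ℝ} (hr : 0 < r) {x : E} (hx : x ∈ Metric.closedBall (0 : E) r) :
    ballRetract r x = x := by
  rw [mem_closedBall_zero_iff] at hx
  rw [ballRetract, max_eq_left hx, div_self hr.ne', one_smul]

end Retraction

/-! ### Solutions on a single sampling interval: confinement and extension. -/

section Pieces

variable {n m : ℕ}

/-- The right-hand side of the equation, with the argument of the feedback frozen at `ξ`. -/
def rhs (g : ℝ → State n → State n) (f : Fin m → State n → State n)
    (h : ℝ → State n → Fin m → ℝ) (t : ℝ) (ξ x : State n) : State n :=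
  g t x + ∑ k, h t ξ k • f k x

/-- `y` is a solution on the part `[ε j, b]` of the sampling interval `[ε j, ε (j + 1)]`. -/
structure IsPiece (D : Set (State n)) (g : ℝ → State n → State n)
    (f : Fin m → State n → State n) (h : ℝ → State n → Fin m → ℝ) (ε : ℝ) (j : ℕ) (b : ℝ)
    (y : ℝ → State n) : Prop where
  le : ε * j ≤ b
  le_next : b ≤ ε * (j + 1)
  ac : AbsolutelyContinuousOnInterval y (ε * j) b
  mem : ∀ t ∈ Icc (ε * j) b, y t ∈ D
  deriv : ∀ᵐ t, t ∈ Icc (ε * j) b → HasDerivAt y (rhs g f h t (y (ε * j)) (y t)) t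

/-- What the construction of solutions on `[0, ∞)` and their decay use about one sampling
interval. -/
structure StepEstimates (D : Set (State n)) (g : ℝ → State n → State n)
    (f : Fin m → State n → State n) (h : ℝ → State n → Fin m → ℝ) (ε δ δ' V q : ℝ)
    (Ψ : ℝ → ℝ) : Prop where
  eps_pos : 0 < ε
  delta_pos : 0 < δ
  subset : Metric.closedBall (0 : State n) δ' ⊆ D
  speed_nonneg : 0 ≤ V
  speed_small : V * ε < δ' - δ
  q_nonneg : 0 ≤ q
  q_le_one : q ≤ 1
  caratheodory : Caratheodory D g
  field_continuous : ∀ k, ContinuousOn (f k) D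
  control_continuous : ∀ ξ k, Continuous fun t => h t ξ k
  speed : ∀ t, 0 ≤ t → ∀ ξ : State n, ‖ξ‖ ≤ δ → ∀ x ∈ Metric.closedBall (0 : State n) δ',
    ‖rhs g f h t ξ x‖ ≤ V
  step : ∀ j y, IsPiece D g f h ε j (ε * (j + 1)) y → ‖y (ε * j)‖ ≤ δ →
    (∀ t ∈ Icc (ε * j) (ε * (j + 1)), y t ∈ Metric.closedBall (0 : State n) δ') →
      ‖y (ε * (j + 1))‖ ≤ q * ‖y (ε * j)‖
  bound : ∀ j b y, IsPiece D g f h ε j b y → ‖y (ε * j)‖ ≤ δ →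
    (∀ t ∈ Icc (ε * j) b, y t ∈ Metric.closedBall (0 : State n) δ') →
      ∀ t ∈ Icc (ε * j) b, ‖y t‖ ≤ Ψ ‖y (ε * j)‖

variable {D : Set (State n)} {g : ℝ → State n → State n} {f : Fin m → State n → State n}
  {h : ℝ → State n → Fin m → ℝ} {ε δ δ' V q : ℝ} {Ψ : ℝ → ℝ} {j : ℕ} {b : ℝ} {y : ℝ → State n}

theorem IsPiece.mono (hy : IsPiece D g f h ε j b y) {c : ℝ} (hc : c ∈ Icc (ε * j) b) :
    IsPiece D g f h ε j c y where
  le := hc.1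
  le_next := hc.2.trans hy.le_next
  ac := hy.ac.mono (by
    rw [uIcc_of_le hc.1, uIcc_of_le hy.le]; exact Icc_subset_Icc_right hc.2)
  mem t ht := hy.mem t ⟨ht.1, ht.2.trans hc.2⟩
  deriv := by
    filter_upwards [hy.deriv] with t h1 h2 using h1 ⟨h2.1, h2.2.trans hc.2⟩

/-- Agreement on the closed interval yields equal germs only in its interior; the endpoints form a
null set. -/
theorem IsPiece.congr (hy : IsPiece D g f h ε j b y) {z : ℝ → State n}
    (hz : EqOn z y (Icc (ε * j) b)) : IsPiece D g f h ε j b z where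
  le := hy.le
  le_next := hy.le_next
  ac := by
    have := hy.ac
    rw [absolutelyContinuousOnInterval_iff] at this ⊢
    intro η hη
    obtain ⟨d, hd, hd'⟩ := this η hη
    refine ⟨d, hd, fun E hE hE' => ?_⟩
    have h1 := hd' E hE hE'
    rw [← uIcc_of_le hy.le] at hz
    refine lt_of_eq_of_lt (Finset.sum_congr rfl fun i hi => ?_) h1
    have h2 := hE.1 i hi
    rw [hz h2.1, hz h2.2]
  mem t ht := by rw [hz ht]; exact hy.mem t ht
  deriv := by
    have h1 : ∀ᵐ t : ℝ, t ≠ ε * j := by simp [ae_iff, measure_singleton]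
    have h2 : ∀ᵐ t : ℝ, t ≠ b := by simp [ae_iff, measure_singleton]
    filter_upwards [hy.deriv, h1, h2] with t h3 h4 h5 h6
    have h7 := h3 h6
    rw [← hz h6, ← hz (left_mem_Icc.2 hy.le)] at h7
    refine h7.congr_of_eventuallyEq ?_
    filter_upwards [Ioo_mem_nhds (lt_of_le_of_ne h6.1 h4.symm) (lt_of_le_of_ne h6.2 h5)] with s hs
      using hz ⟨hs.1.le, hs.2.le⟩

theorem IsPiece.continuousOn (hy : IsPiece D g f h ε j b y) : ContinuousOn y (Icc (ε * j) b) := by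
  have := hy.ac.continuousOn; rwa [uIcc_of_le hy.le] at this

theorem StepEstimates.mul_nonneg (S : StepEstimates D g f h ε δ δ' V q Ψ) (j : ℕ) : 0 ≤ ε * j :=
  _root_.mul_nonneg S.eps_pos.le (Nat.cast_nonneg _)

theorem StepEstimates.delta'_pos (S : StepEstimates D g f h ε δ δ' V q Ψ) : 0 < δ' := by
  have := S.speed_small; have := S.delta_pos
  have := _root_.mul_nonneg S.speed_nonneg S.eps_pos.le
  linarith

/-- A piece which starts in the small ball stays in the large one. -/
theorem StepEstimates.confined (S : StepEstimates D g f h ε δ δ' V q Ψ)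
    (hy : IsPiece D g f h ε j b y) (h0 : ‖y (ε * j)‖ ≤ δ) :
    ∀ t ∈ Icc (ε * j) b, y t ∈ Metric.closedBall (0 : State n) δ' := by
  by_contra hcon
  push Not at hcon
  obtain ⟨t₁, ht₁, hn⟩ := hcon
  rw [mem_closedBall_zero_iff, not_le] at hn
  have hcont : ContinuousOn (fun t => ‖y t‖) (Icc (ε * j) b) := hy.continuousOn.norm
  have hclosed : IsClosed (Icc (ε * j) b ∩ (fun t => ‖y t‖) ⁻¹' Ici δ') :=
    hcont.preimage_isClosed_of_isClosed isClosed_Icc isClosed_Ici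
  have hcpt : IsCompact (Icc (ε * j) b ∩ (fun t => ‖y t‖) ⁻¹' Ici δ') :=
    isCompact_Icc.of_isClosed_subset hclosed inter_subset_left
  -- At the first time `t` with norm at least `δ'`, the speed bound has been valid on all of `[ε j,
  -- t)`, so the distance travelled is at most `V ε < δ' - δ`: a contradiction.
  obtain ⟨t, ⟨ht, ht'⟩, hmin⟩ := hcpt.exists_isLeast ⟨t₁, ht₁, hn.le⟩
  have hb := norm_sub_le_of_absCont (C := V) ht.1 S.speed_nonneg (hy.mono ht).ac (by
    have hne : ∀ᵐ s : ℝ, s ≠ t := by simp [ae_iff, measure_singleton]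
    filter_upwards [hy.deriv, hne] with s hs hst hsm
    have hsm' : s ∈ Icc (ε * j) b := ⟨hsm.1, hsm.2.trans ht.2⟩
    refine ⟨_, hs hsm', S.speed s ((S.mul_nonneg j).trans hsm.1) _ h0 _ ?_⟩
    rw [mem_closedBall_zero_iff]
    by_contra hlt
    exact absurd (hmin ⟨hsm', (not_le.1 hlt).le⟩) (not_le.2 (lt_of_le_of_ne hsm.2 hst)))
  have h1 : V * (t - ε * j) ≤ V * ε := by
    refine mul_le_mul_of_nonneg_left ?_ S.speed_nonneg
    have := ht.2.trans hy.le_next; linarith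
  have h2 : ‖y t‖ ≤ ‖y t - y (ε * j)‖ + ‖y (ε * j)‖ := by
    simpa using norm_add_le (y t - y (ε * j)) (y (ε * j))
  have h3 : δ' ≤ ‖y t‖ := ht'
  have := S.speed_small
  linarith

theorem StepEstimates.lipschitz (S : StepEstimates D g f h ε δ δ' V q Ψ)
    (hy : IsPiece D g f h ε j b y) (h0 : ‖y (ε * j)‖ ≤ δ) :
    LipschitzOnWith V.toNNReal y (Icc (ε * j) b) := by
  refine lipschitzOnWith_of_absCont hy.le S.speed_nonneg hy.ac ?_
  filter_upwards [hy.deriv] with s hs hsm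
  exact ⟨_, hs hsm, S.speed s ((S.mul_nonneg j).trans hsm.1) _ h0 _ (S.confined hy h0 s hsm)⟩

/-- A piece extends to the whole sampling interval. -/
theorem StepEstimates.extend (S : StepEstimates D g f h ε δ δ' V q Ψ)
    (hy : IsPiece D g f h ε j b y) (h0 : ‖y (ε * j)‖ ≤ δ) :
    ∃ z, IsPiece D g f h ε j (ε * (j + 1)) z ∧ EqOn z y (Iic b) := by
  rcases hy.le_next.eq_or_lt with rfl | hlt
  · exact ⟨y, hy, fun _ _ => rfl⟩
  have hb0 : 0 ≤ b := (S.mul_nonneg j).trans hy.le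
  have hδ' := S.delta'_pos
  set ξ := y (ε * j) with hξ
  have hP : ∀ x : State n, ballRetract δ' x ∈ D := fun x => S.subset (ballRetract_mem hδ' x)
  -- Composition with the retraction makes the field globally defined and bounded by `V`. The glued
  -- curve stays in the ball by the same speed argument, so the retraction acts as the identity
  -- along it.
  obtain ⟨w, hwb, hwL, hw⟩ := exists_caratheodory_solution
    (H := fun t x => rhs g f h t ξ (ballRetract δ' x)) hlt S.speed_nonneg
    (fun x => by
      refine AEStronglyMeasurable.add ?_ ?_
      · exact (S.caratheodory.1 _ (hP x)).mono_set fun t ht => hb0.trans ht.1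
      · exact (continuous_finsetSum _ fun k _ =>
          (S.control_continuous ξ k).smul continuous_const).aestronglyMeasurable)
    (fun t ht => by
      have h1 : Continuous fun x => g t (ballRetract δ' x) :=
        (S.caratheodory.2 t (hb0.trans ht.1)).comp_continuous (continuous_ballRetract hδ') hP
      have h2 : ∀ k, Continuous fun x => f k (ballRetract δ' x) := fun k =>
        (S.field_continuous k).comp_continuous (continuous_ballRetract hδ') hP
      have h3 : ∀ k, Continuous fun x => h t ξ k • f k (ballRetract δ' x) := fun k =>
        (continuous_const_smul (h t ξ k)).comp (h2 k)
      exact h1.add (continuous_finsetSum _ fun k _ => h3 k))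
    (fun t ht x => S.speed t (hb0.trans ht.1) ξ h0 _ (ballRetract_mem hδ' x)) (y b)
  let z : ℝ → State n := fun t => if t ≤ b then y t else w t
  have hzy : EqOn z y (Iic b) := fun t ht => if_pos ht
  have hzw : EqOn z w (Ici b) := fun t ht => by
    rcases (show b ≤ t from ht).eq_or_lt with rfl | h1
    · simp [z, hwb]
    · exact if_neg (not_le.2 h1)
  have hzL : LipschitzOnWith V.toNNReal z (Icc (ε * j) (ε * (j + 1))) :=
    lipschitzOnWith_Icc_union
      (lipschitzOnWith_congr (S.lipschitz hy h0) (hzy.mono fun t ht => ht.2))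
      (lipschitzOnWith_congr hwL (hzw.mono fun t ht => ht.1))
  have hle : ε * j ≤ ε * (j + 1) := hy.le.trans hlt.le
  have hz0 : z (ε * j) = ξ := hzy hy.le
  have hzK : ∀ t ∈ Icc (ε * j) (ε * (j + 1)), z t ∈ Metric.closedBall (0 : State n) δ' := by
    intro t ht
    have h1 := hzL.dist_le_mul t ht (ε * j) (left_mem_Icc.2 hle)
    rw [Real.coe_toNNReal _ S.speed_nonneg, dist_eq_norm, Real.dist_eq,
      abs_of_nonneg (sub_nonneg.2 ht.1), hz0] at h1
    have h2 : V * (t - ε * j) ≤ V * ε := by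
      refine mul_le_mul_of_nonneg_left ?_ S.speed_nonneg
      linarith [ht.2]
    have h3 : ‖z t‖ ≤ ‖z t - ξ‖ + ‖ξ‖ := by simpa using norm_add_le (z t - ξ) ξ
    have := S.speed_small
    rw [mem_closedBall_zero_iff]
    linarith
  refine ⟨z, ⟨hle, le_rfl, absCont_of_lipschitzOnWith hle hzL, fun t ht => S.subset (hzK t ht), ?_⟩,
    hzy⟩
  have hne : ∀ᵐ s : ℝ, s ≠ b := by simp [ae_iff, measure_singleton]
  filter_upwards [hy.deriv, hw, hne] with t h1 h2 h3 ht
  rw [hz0]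
  rcases lt_or_gt_of_ne h3 with h4 | h4
  · rw [hzy h4.le]
    refine (h1 ⟨ht.1, h4.le⟩).congr_of_eventuallyEq ?_
    filter_upwards [Iio_mem_nhds h4] with s hs using hzy (le_of_lt (mem_Iio.1 hs))
  · have h5 := h2 ⟨h4.le, ht.2⟩
    have h6 : z t = w t := hzw h4.le
    rw [← h6, ballRetract_of_mem hδ' (hzK t ht)] at h5
    refine h5.congr_of_eventuallyEq ?_
    filter_upwards [Ioi_mem_nhds h4] with s hs using hzw (le_of_lt (mem_Ioi.1 hs))

/-- The constant curve is a piece on the one-point interval `[ε j, ε j]`, where the equation is an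
a.e. void condition; this piece is then extended. -/
theorem StepEstimates.exists_piece (S : StepEstimates D g f h ε δ δ' V q Ψ) (j : ℕ) {ξ : State n}
    (hξ : ‖ξ‖ ≤ δ) : ∃ z, z (ε * j) = ξ ∧ IsPiece D g f h ε j (ε * (j + 1)) z := by
  have h1 : IsPiece D g f h ε j (ε * j) fun _ => ξ := by
    refine ⟨le_rfl, by linarith [S.eps_pos], ?_, fun t _ => S.subset ?_, ?_⟩
    · exact absCont_of_lipschitzOnWith (L := 0) le_rfl
        (LipschitzOnWith.of_dist_le_mul fun _ _ _ _ => by simp)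
    · rw [mem_closedBall_zero_iff]
      have := S.speed_small
      have := _root_.mul_nonneg S.speed_nonneg S.eps_pos.le
      linarith
    · have hne : ∀ᵐ s : ℝ, s ≠ ε * j := by simp [ae_iff, measure_singleton]
      filter_upwards [hne] with s hs hsm
      exact absurd (le_antisymm hsm.2 hsm.1) hs
  obtain ⟨z, hz, hzy⟩ := S.extend h1 hξ
  exact ⟨z, hzy (mem_Iic.2 le_rfl), hz⟩

end Pieces

/-! ### Global solutions from pieces, extension and norm bounds. -/

section Assembly

variable {n m : ℕ} {D : Set (State n)} {g : ℝ → State n → State n} {f : Fin m → State n → State n}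
  {h : ℝ → State n → Fin m → ℝ} {ε δ δ' V q : ℝ} {Ψ : ℝ → ℝ} {x y : ℝ → State n} {x₀ : State n}

theorem IsPiSolutionOn.isPiece {I : Set ℝ} (hx : IsPiSolutionOn I D g f h ε x₀ x) (hε : 0 < ε)
    {j : ℕ} {b : ℝ} (hb : b ∈ Icc (ε * j) (ε * (j + 1))) (hI : Icc 0 b ⊆ I) :
    IsPiece D g f h ε j b x := by
  have h0 : 0 ≤ ε * j := mul_nonneg hε.le (Nat.cast_nonneg _)
  have hb0 : 0 ≤ b := h0.trans hb.1
  have hsub : Icc (ε * j) b ⊆ I := (Icc_subset_Icc_left h0).trans hI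
  refine ⟨hb.1, hb.2, (hx.ac b (hI (right_mem_Icc.2 hb0))).mono ?_, fun t ht => hx.mem t (hsub ht), ?_⟩
  · rw [uIcc_of_le hb.1, uIcc_of_le hb0]; exact Icc_subset_Icc_left h0
  · have hne : ∀ᵐ s : ℝ, s ≠ ε * (j + 1) := by simp [ae_iff, measure_singleton]
    filter_upwards [hx.deriv j, hne] with t h1 h2 ht
    exact h1 (hsub ht) ⟨ht.1, lt_of_le_of_ne (ht.2.trans hb.2) h2⟩

/-- Both conclusions are carried through the induction together: `q ≤ 1` keeps the sampled state in
the small ball, where the next step estimate applies. -/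
theorem StepEstimates.norm_grid_le (S : StepEstimates D g f h ε δ δ' V q Ψ) {J : ℕ}
    (hp : ∀ j < J, IsPiece D g f h ε j (ε * (j + 1)) x) (h0 : ‖x 0‖ ≤ δ) :
    ∀ j ≤ J, ‖x (ε * j)‖ ≤ q ^ j * ‖x 0‖ ∧ ‖x (ε * j)‖ ≤ δ := by
  intro j
  induction j with
  | zero => intro _; simpa using h0
  | succ j ih =>
    intro hj
    obtain ⟨h1, h2⟩ := ih (by omega)
    have hpj := hp j (by omega)
    have h3 := S.step j x hpj h2 (S.confined hpj h2)
    push_cast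
    refine ⟨h3.trans ?_, h3.trans ?_⟩
    · rw [pow_succ', mul_assoc]; exact mul_le_mul_of_nonneg_left h1 S.q_nonneg
    · exact (mul_le_of_le_one_left (norm_nonneg _) S.q_le_one).trans h2

theorem mem_Icc_floor (hε : 0 < ε) {t : ℝ} (ht : 0 ≤ t) :
    t ∈ Icc (ε * ⌊t / ε⌋₊) (ε * (⌊t / ε⌋₊ + 1)) := by
  constructor
  · have := Nat.floor_le (div_nonneg ht hε.le)
    rwa [le_div_iff₀ hε, mul_comm] at this
  · have := Nat.lt_floor_add_one (t / ε)
    rw [div_lt_iff₀ hε, mul_comm] at this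
    exact this.le

/-- A function which solves every sampling interval is a solution. -/
theorem StepEstimates.isPiSolution (S : StepEstimates D g f h ε δ δ' V q Ψ)
    (hp : ∀ j : ℕ, IsPiece D g f h ε j (ε * (j + 1)) x) (h0 : ‖x 0‖ ≤ δ) :
    IsPiSolution D g f h ε (x 0) x := by
  have hδ : ∀ j : ℕ, ‖x (ε * j)‖ ≤ δ := fun j =>
    (S.norm_grid_le (J := j) (fun i _ => hp i) h0 j le_rfl).2
  have hL : ∀ N : ℕ, LipschitzOnWith V.toNNReal x (Icc 0 (ε * N)) := by
    intro N
    induction N with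
    | zero =>
      refine LipschitzOnWith.of_dist_le_mul fun s hs t ht => ?_
      simp only [Nat.cast_zero, mul_zero, Icc_self, mem_singleton_iff] at hs ht
      rw [hs, ht]; simp
    | succ N ih =>
      refine lipschitzOnWith_Icc_union ih ?_
      push_cast
      exact S.lipschitz (hp N) (hδ N)
  refine ⟨rfl, fun t ht => (hp _).mem t (mem_Icc_floor S.eps_pos ht), fun b hb => ?_, fun j => ?_⟩
  · refine absCont_of_lipschitzOnWith hb ((hL (⌊b / ε⌋₊ + 1)).mono (Icc_subset_Icc_right ?_))
    push_cast
    exact (mem_Icc_floor S.eps_pos hb).2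
  · filter_upwards [(hp j).deriv] with t h1 _ h2
    exact h1 ⟨h2.1, h2.2.le⟩

/-- A function which solves the first sampling intervals continues to a solution. -/
theorem StepEstimates.exists_solution (S : StepEstimates D g f h ε δ δ' V q Ψ) {J : ℕ}
    (hy : ∀ j ≤ J, IsPiece D g f h ε j (ε * (j + 1)) y) (h0 : ‖y 0‖ ≤ δ) :
    ∃ x, IsPiSolution D g f h ε (y 0) x ∧ EqOn x y (Icc 0 (ε * (J + 1))) := by
  have hyδ := S.norm_grid_le (J := J + 1) (fun j hj => hy j (by omega)) h0
  -- The pieces up to `J` are prescribed to be `y`, later ones are chosen freely subject to matching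
  -- values at the sampling times.
  let Q : ℕ → (ℝ → State n) → Prop := fun j z =>
    IsPiece D g f h ε j (ε * (j + 1)) z ∧ ‖z (ε * j)‖ ≤ δ ∧ (j ≤ J → z = y)
  have hstep : ∀ j z, Q j z → ∃ z', Q (j + 1) z' ∧ z' (ε * (j + 1)) = z (ε * (j + 1)) := by
    rintro j z ⟨h1, h2, h3⟩
    by_cases hj : j + 1 ≤ J
    · refine ⟨y, ⟨hy _ hj, (hyδ (j + 1) (by omega)).2, fun _ => rfl⟩, ?_⟩
      rw [h3 (by omega)]
    · have h4 := S.step j z h1 h2 (S.confined h1 h2)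
      have h5 : ‖z (ε * (j + 1))‖ ≤ δ :=
        h4.trans ((mul_le_of_le_one_left (norm_nonneg _) S.q_le_one).trans h2)
      obtain ⟨z', hz', hp⟩ := S.exists_piece (j + 1) h5
      refine ⟨z', ⟨hp, by rw [hz']; exact h5, fun h => absurd h hj⟩, ?_⟩
      rw [← hz']; push_cast; rfl
  choose! nxt hnxt using hstep
  let p : ℕ → ℝ → State n := fun j => j.rec y fun j z => nxt j z
  have hp : ∀ j, Q j (p j) := by
    intro j
    induction j with
    | zero => exact ⟨hy 0 (Nat.zero_le _), by simpa [p] using h0, fun _ => rfl⟩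
    | succ j ih => exact (hnxt j (p j) ih).1
  have hmatch : ∀ j : ℕ, p (j + 1) (ε * (j + 1)) = p j (ε * (j + 1)) := fun j =>
    (hnxt j (p j) (hp j)).2
  let x : ℝ → State n := fun t => p ⌊t / ε⌋₊ t
  have hxp : ∀ j : ℕ, EqOn x (p j) (Icc (ε * j) (ε * (j + 1))) := by
    intro j t ht
    rcases ht.2.eq_or_lt with rfl | hlt
    · have : ⌊ε * ((j : ℝ) + 1) / ε⌋₊ = j + 1 := by
        rw [mul_div_cancel_left₀ _ S.eps_pos.ne']
        exact_mod_cast Nat.floor_natCast (R := ℝ) (j + 1)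
      simp only [x, this, hmatch]
    · have : ⌊t / ε⌋₊ = j := by
        refine (Nat.floor_eq_iff (div_nonneg ((S.mul_nonneg j).trans ht.1) S.eps_pos.le)).2 ⟨?_, ?_⟩
        · rw [le_div_iff₀ S.eps_pos, mul_comm]; exact ht.1
        · rw [div_lt_iff₀ S.eps_pos, mul_comm]; exact hlt
      simp only [x, this]
  have hx0 : x 0 = y 0 := by simp [x, p]
  have hsol := S.isPiSolution (x := x) (fun j => (hp j).1.congr (hxp j)) (by rw [hx0]; exact h0)
  rw [hx0] at hsol
  refine ⟨x, hsol, fun t ht => ?_⟩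
  have hfl := mem_Icc_floor S.eps_pos ht.1
  rcases le_or_gt ⌊t / ε⌋₊ J with hJ | hJ
  · rw [hxp _ hfl, (hp _).2.2 hJ]
  · have h1 : ε * ((J : ℝ) + 1) ≤ ε * ⌊t / ε⌋₊ := by
      have : (J : ℝ) + 1 ≤ ⌊t / ε⌋₊ := by exact_mod_cast hJ
      exact mul_le_mul_of_nonneg_left this S.eps_pos.le
    have h2 : t = ε * (J + 1) := le_antisymm ht.2 (h1.trans hfl.1)
    rw [hxp J ⟨by rw [h2]; nlinarith [S.eps_pos], ht.2⟩, (hp _).2.2 le_rfl]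

theorem StepEstimates.exists_solution_of_init (S : StepEstimates D g f h ε δ δ' V q Ψ)
    (h0 : ‖x₀‖ ≤ δ) : ∃ x, IsPiSolution D g f h ε x₀ x := by
  obtain ⟨z, hz, hp⟩ := S.exists_piece 0 h0
  have hz0 : z 0 = x₀ := by simpa using hz
  obtain ⟨x, hx, -⟩ := S.exists_solution (J := 0) (y := z) (fun j hj => by
    obtain rfl : j = 0 := by omega
    exact hp) (by rw [hz0]; exact h0)
  exact ⟨x, by rwa [hz0] at hx⟩

/-- Solutions on bounded intervals extend. -/
theorem StepEstimates.exists_extension (S : StepEstimates D g f h ε δ δ' V q Ψ) {T : ℝ}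
    (hT : 0 < T) (hy : IsPiSolutionOn (Ico 0 T) D g f h ε x₀ y) (h0 : ‖x₀‖ ≤ δ) :
    ∃ x, IsPiSolution D g f h ε x₀ x ∧ EqOn x y (Ico 0 T) := by
  have hε := S.eps_pos
  have hδ' := S.delta'_pos
  have hc : 0 < ⌈T / ε⌉₊ := Nat.ceil_pos.2 (div_pos hT hε)
  -- The ceiling minus one, not the floor: then `ε J < T ≤ ε (J + 1)`, so the last interval is
  -- nondegenerate even when `T` is itself a sampling time.
  obtain ⟨J, hJ⟩ : ∃ J, ⌈T / ε⌉₊ = J + 1 := ⟨⌈T / ε⌉₊ - 1, by omega⟩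
  have hJT : ε * J < T := by
    have : J < ⌈T / ε⌉₊ := by omega
    rwa [Nat.lt_ceil, lt_div_iff₀ hε, mul_comm] at this
  have hTJ : T ≤ ε * (J + 1) := by
    have := Nat.le_ceil (T / ε)
    rw [hJ, div_le_iff₀ hε, mul_comm] at this
    exact_mod_cast this
  have hpj : ∀ j < J, IsPiece D g f h ε j (ε * (j + 1)) y := by
    intro j hj
    have h1 : ε * ((j : ℝ) + 1) ≤ ε * J := by
      have : (j : ℝ) + 1 ≤ J := by exact_mod_cast hj
      exact mul_le_mul_of_nonneg_left this hε.le
    exact hy.isPiece hε ⟨by nlinarith, le_rfl⟩ fun t ht => ⟨ht.1, by linarith [ht.2]⟩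
  have h00 : ‖y 0‖ ≤ δ := by rw [hy.init]; exact h0
  have hyJ := (S.norm_grid_le hpj h00 J le_rfl).2
  have hpb : ∀ b ∈ Ico (ε * J) T, IsPiece D g f h ε J b y := fun b hb =>
    hy.isPiece hε ⟨hb.1, hb.2.le.trans hTJ⟩ fun t ht => ⟨ht.1, ht.2.trans_lt hb.2⟩
  have hL : LipschitzOnWith V.toNNReal y (Ico (ε * J) T) := by
    intro s hs t ht
    have hmax : max s t ∈ Ico (ε * J) T := ⟨hs.1.trans (le_max_left _ _), max_lt hs.2 ht.2⟩
    exact S.lipschitz (hpb _ hmax) hyJ ⟨hs.1, le_max_left _ _⟩ ⟨ht.1, le_max_right _ _⟩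
  -- The solution is `V`-Lipschitz up to `T`; a Lipschitz extension supplies its limit at `T`, which
  -- lies in the closed ball and hence in `D`.
  obtain ⟨w, hwL, hwy⟩ := hL.extend_finite_dimension
  let z : ℝ → State n := fun t => if t < T then y t else w t
  have hzy : EqOn z y (Iio T) := fun t ht => if_pos ht
  have hzw : EqOn z w (Icc (ε * J) T) := fun t ht => by
    rcases ht.2.lt_or_eq with h1 | h1
    · rw [hzy h1]; exact hwy ⟨ht.1, h1⟩
    · exact if_neg (not_lt.2 h1.ge)
  have hzp : IsPiece D g f h ε J T z := by
    refine ⟨hJT.le, hTJ, absCont_of_lipschitzOnWith hJT.le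
      (lipschitzOnWith_congr hwL.lipschitzOnWith hzw), fun t ht => S.subset ?_, ?_⟩
    · rw [hzw ht]
      have hcl : closure (Ico (ε * J) T) = Icc (ε * J) T := closure_Ico hJT.ne
      rw [← hcl] at ht
      have hB := (Metric.isClosed_closedBall (x := (0 : State n)) (ε := δ')).closure_eq
      rw [← hB]
      refine map_mem_closure hwL.continuous ht fun s hs => ?_
      rw [← hwy hs]
      exact S.confined (hpb s hs) hyJ s ⟨hs.1, le_rfl⟩
    · have hne : ∀ᵐ s : ℝ, s ≠ T := by simp [ae_iff, measure_singleton]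
      have hne' : ∀ᵐ s : ℝ, s ≠ ε * (J + 1) := by simp [ae_iff, measure_singleton]
      filter_upwards [hy.deriv J, hne, hne'] with t h1 h2 h3 ht
      have h4 : t < T := lt_of_le_of_ne ht.2 h2
      rw [hzy h4, hzy hJT]
      refine (h1 ⟨(S.mul_nonneg J).trans ht.1, h4⟩
        ⟨ht.1, lt_of_le_of_ne (ht.2.trans hTJ) h3⟩).congr_of_eventuallyEq ?_
      filter_upwards [Iio_mem_nhds h4] with s hs using hzy hs
  obtain ⟨u, hu, huz⟩ := S.extend hzp (by rw [hzy hJT]; exact hyJ)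
  have huy : EqOn u y (Iio T) := fun t ht => (huz (mem_Iic.2 (le_of_lt ht))).trans (hzy ht)
  have hu0 : u 0 = x₀ := by rw [huy hT, hy.init]
  obtain ⟨x, hx, hxu⟩ := S.exists_solution (J := J) (y := u) (fun j hj => by
    rcases hj.lt_or_eq with hj | rfl
    · refine (hpj j hj).congr (huy.mono fun t ht => ?_)
      have h1 : ε * ((j : ℝ) + 1) ≤ ε * J := by
        have : (j : ℝ) + 1 ≤ J := by exact_mod_cast hj
        exact mul_le_mul_of_nonneg_left this hε.le
      exact lt_of_le_of_lt (ht.2.trans h1) hJT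
    · exact hu) (by rw [hu0]; exact h0)
  rw [hu0] at hx
  exact ⟨x, hx, fun t ht => (hxu ⟨ht.1, ht.2.le.trans hTJ⟩).trans (huy ht.2)⟩

/-- `ξ` is the state at the last sampling time before `t`. -/
theorem StepEstimates.norm_solution_le (S : StepEstimates D g f h ε δ δ' V q Ψ)
    (hx : IsPiSolution D g f h ε x₀ x) (h0 : ‖x₀‖ ≤ δ) {t : ℝ} (ht : 0 ≤ t) :
    ∃ ξ : State n, ‖ξ‖ ≤ q ^ ⌊t / ε⌋₊ * ‖x₀‖ ∧ ‖x t‖ ≤ Ψ ‖ξ‖ := by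
  have hp : ∀ j : ℕ, IsPiece D g f h ε j (ε * (j + 1)) x := fun j =>
    IsPiSolutionOn.isPiece hx S.eps_pos ⟨by nlinarith [S.eps_pos], le_rfl⟩ fun t ht => ht.1
  have h1 := S.norm_grid_le (J := ⌊t / ε⌋₊) (fun j _ => hp j) (by rw [hx.init]; exact h0) _ le_rfl
  rw [hx.init] at h1
  exact ⟨_, h1.1, S.bound _ _ x (hp _) h1.2 (S.confined (hp _) h1.2) t
    (mem_Icc_floor S.eps_pos ht)⟩

end Assembly

/-! ### Bounds for coefficients, controls and drift. -/

section Estimates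

variable {n m : ℕ} {S₁ : Finset (Fin m)} {S₂ : Finset (Fin m × Fin m)}
  {S₃ : Finset (Fin m × Fin m × Fin m)} {D : Set (State n)} {f : Fin m → State n → State n}

theorem matF_apply (x : State n) (v : EuclideanSpace ℝ (Idx S₁ S₂ S₃)) :
    matF f S₁ S₂ S₃ x v = ∑ i, v i • column f i x := by
  simp [matF]

/-- Spanning gives surjectivity, and the count of columns gives equal dimensions, hence bijectivity.
This is needed because `inverse` has a default value on non-invertible maps. -/
theorem RankCondition.matF_matFInv (hr : RankCondition D f S₁ S₂ S₃) {x : State n} (hx : x ∈ D)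
    (v : State n) : matF f S₁ S₂ S₃ x (matFInv f S₁ S₂ S₃ x v) = v := by
  have hsurj : Function.Surjective (matF f S₁ S₂ S₃ x) := by
    intro w
    have hw : w ∈ Submodule.span ℝ (range fun i : Idx S₁ S₂ S₃ => column f i x) := by
      rw [hr.2 x hx]; trivial
    obtain ⟨c, hc⟩ := (Submodule.mem_span_range_iff_exists_fun ℝ).1 hw
    exact ⟨WithLp.toLp 2 c, by rw [matF_apply]; exact hc⟩
  have hcard : Module.finrank ℝ (EuclideanSpace ℝ (Idx S₁ S₂ S₃)) =
      Module.finrank ℝ (State n) := by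
    simp only [finrank_euclideanSpace, Fintype.card_sum, Fintype.card_coe, Fintype.card_fin]
    rw [← hr.1]; ring
  have hinj : Function.Injective (matF f S₁ S₂ S₃ x) :=
    (LinearMap.injective_iff_surjective_of_finrank_eq_finrank
      (f := (matF f S₁ S₂ S₃ x).toLinearMap) hcard).2 hsurj
  let e := (LinearEquiv.ofBijective (matF f S₁ S₂ S₃ x).toLinearMap
    ⟨hinj, hsurj⟩).toContinuousLinearEquiv
  have he : matF f S₁ S₂ S₃ x = (e : EuclideanSpace ℝ (Idx S₁ S₂ S₃) →L[ℝ] State n) := by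
    ext1 v; rfl
  rw [matFInv, he, ContinuousLinearMap.inverse_equiv]
  simp

theorem RankCondition.sum_coeffA_smul (hr : RankCondition D f S₁ S₂ S₃) {x : State n}
    (hx : x ∈ D) (γ : ℝ) :
    ∑ i, coeffA f S₁ S₂ S₃ γ x i • column f i x = -(γ • x) := by
  rw [← matF_apply, coeffA, map_neg, map_smul, hr.matF_matFInv hx]

theorem abs_coeffA_le {α γ : ℝ} (hγ : 0 ≤ γ) {x : State n} (hF : ‖matFInv f S₁ S₂ S₃ x‖ ≤ α)
    (i : Idx S₁ S₂ S₃) : |coeffA f S₁ S₂ S₃ γ x i| ≤ γ * α * ‖x‖ := by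
  calc |coeffA f S₁ S₂ S₃ γ x i| ≤ ‖coeffA f S₁ S₂ S₃ γ x‖ :=
      (Real.norm_eq_abs _).symm.trans_le (PiLp.norm_apply_le _ i)
    _ = γ * ‖matFInv f S₁ S₂ S₃ x x‖ := by
      rw [coeffA, norm_neg, norm_smul, Real.norm_eq_abs, abs_of_nonneg hγ]
    _ ≤ γ * (α * ‖x‖) := by
      gcongr; exact ContinuousLinearMap.le_of_opNorm_le _ hF x
    _ = _ := by ring

/-- On a compact set the oscillating part of the velocity is of the order of the cube root of
`ε ‖a‖`, divided by `ε`. -/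
theorem exists_control_bound (hf : ∀ k, ContinuousOn (f k) D) {K : Set (State n)}
    (hK : IsCompact K) (hKD : K ⊆ D) (κ : Freq S₂ S₃) :
    ∃ C, 0 ≤ C ∧ ∀ (γ ε θ t : ℝ) (ξ x : State n), 0 < ε → 0 ≤ θ → θ ≤ 1 →
      (∀ i, ε * |coeffA f S₁ S₂ S₃ γ ξ i| ≤ θ ^ 6) → x ∈ K →
        ε * ‖∑ k, control f κ S₁ γ ε t ξ k • f k x‖ ≤ C * θ ^ 2 := by
  obtain ⟨B, hB, hfB⟩ := exists_norm_bound hK hKD hf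
  obtain ⟨W, hW, hA⟩ := exists_atomAmp_bound (S₁ := S₁) κ
  refine ⟨Fintype.card (Atom S₁ S₂ S₃) * (W * B), by positivity, ?_⟩
  intro γ ε θ t ξ x hε hθ hθ1 ha hx
  rw [sum_control_smul]
  set a := coeffA f S₁ S₂ S₃ γ ξ
  have hp : ∀ p : Atom S₁ S₂ S₃,
      ε * ‖atomControl κ ε a p t • f (atomField p) x‖ ≤ W * B * θ ^ 2 := by
    intro p
    have h1 : θ ^ atomOrder p ≤ θ ^ 2 :=
      pow_le_pow_of_le_one hθ hθ1 (by rcases p with i | i | i <;> simp [atomOrder])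
    calc ε * ‖atomControl κ ε a p t • f (atomField p) x‖
        = ε * |atomControl κ ε a p t| * ‖f (atomField p) x‖ := by
          rw [norm_smul, Real.norm_eq_abs, mul_assoc]
      _ ≤ ε * |atomAmp κ ε a p| * B := by
          refine mul_le_mul ?_ (hfB _ _ hx) (norm_nonneg _) (by positivity)
          exact mul_le_mul_of_nonneg_left (abs_atomControl_le _ _ _ _ _) hε.le
      _ ≤ W * θ ^ 2 * B := by
          refine mul_le_mul_of_nonneg_right ((hA ε θ a hε hθ ha p).trans ?_) hB
          exact mul_le_mul_of_nonneg_left h1 (by linarith)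
      _ = _ := by ring
  calc _ ≤ ε * ∑ p, ‖atomControl κ ε a p t • f (atomField p) x‖ := by
        gcongr; exact norm_sum_le _ _
    _ ≤ ∑ _p : Atom S₁ S₂ S₃, W * B * θ ^ 2 := by
        rw [Finset.mul_sum]; exact Finset.sum_le_sum fun p _ => hp p
    _ = _ := by simp; ring

/-- A bounded drift which is cubically small at the origin has a cubic bound on every compact
set. -/
theorem BoundedDrift.exists_cubic_bound {g : ℝ → State n → State n} (hg : BoundedDrift D g)
    {M δ₀ : ℝ} (hM : 0 ≤ M) (hδ₀ : 0 < δ₀)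
    (h3 : ∀ t, 0 ≤ t → ∀ x ∈ Metric.ball (0 : State n) δ₀ ∩ D, ‖g t x‖ ≤ M * ‖x‖ ^ 3)
    {K : Set (State n)} (hK : IsCompact K) (hKD : K ⊆ D) :
    ∃ M', 0 ≤ M' ∧ ∀ t, 0 ≤ t → ∀ x ∈ K, ‖g t x‖ ≤ M' * ‖x‖ ^ 3 := by
  obtain ⟨τ, hτ, N, hN, hb⟩ := hg K hKD hK
  refine ⟨M + N / δ₀ ^ 3, by positivity, fun t ht x hx => ?_⟩
  rw [add_mul]
  rcases lt_or_ge ‖x‖ δ₀ with h | h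
  · have := h3 t ht x ⟨by simpa using h, hKD hx⟩
    have : 0 ≤ N / δ₀ ^ 3 * ‖x‖ ^ 3 := by positivity
    linarith
  · have h1 := hb t ht t ⟨le_rfl, by linarith⟩ x hx
    have h2 : N ≤ N / δ₀ ^ 3 * ‖x‖ ^ 3 := by
      rw [div_mul_eq_mul_div, le_div_iff₀ (by positivity)]; gcongr
    have : 0 ≤ M * ‖x‖ ^ 3 := by positivity
    linarith

theorem exists_closedBall_subset {r : ℝ} (hr : 0 < r) (hD : IsOpen D)
    (h : Metric.closedBall (0 : State n) r ⊆ D) :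
    ∃ R, r < R ∧ Metric.closedBall (0 : State n) R ⊆ D := by
  obtain ⟨d, hd, hsub⟩ :=
    (isCompact_closedBall (0 : State n) r).exists_cthickening_subset_open hD h
  rw [cthickening_closedBall hd.le hr.le] at hsub
  exact ⟨r + d, by linarith, by rwa [add_comm]⟩

end Estimates

/-! ### Choice of gain and period, contraction, decay and stability. -/

section Stabilization

variable {n m : ℕ} {S₁ : Finset (Fin m)} {S₂ : Finset (Fin m × Fin m)}
  {S₃ : Finset (Fin m × Fin m × Fin m)} {D : Set (State n)} {f : Fin m → State n → State n}

/-- The bound for a solution on a sampling interval in terms of the norm `s` of its value at the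
beginning. -/
def overshoot (C β s : ℝ) : ℝ := 2 * (s + C * ((β * s) ^ (1 / 6 : ℝ)) ^ 2)

theorem rpow_sixth_pow_six {u : ℝ} (hu : 0 ≤ u) : (u ^ (1 / 6 : ℝ)) ^ 6 = u := by
  rw [← Real.rpow_natCast, ← Real.rpow_mul hu]; norm_num

theorem continuous_overshoot (C β : ℝ) : Continuous (overshoot C β) := by
  have : Continuous fun s : ℝ => (β * s) ^ (1 / 6 : ℝ) :=
    (Real.continuous_rpow_const (by norm_num)).comp (continuous_const.mul continuous_id)
  unfold overshoot
  fun_prop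

/-- The bound behaves like `s + s^{1/3}`; writing the decay of `s` as `e⁶` turns the cube root into
`e²`. -/
theorem overshoot_le_of_le {C β s δ e : ℝ} (hC : 0 ≤ C) (hβ : 0 ≤ β) (hs : 0 ≤ s) (hδ : 0 ≤ δ)
    (he : 0 ≤ e) (h : s ≤ δ * e ^ 6) :
    overshoot C β s ≤ 2 * (δ * e ^ 6 + C * ((β * δ) ^ (1 / 6 : ℝ)) ^ 2 * e ^ 2) := by
  have h1 : (β * s) ^ (1 / 6 : ℝ) ≤ (β * δ) ^ (1 / 6 : ℝ) * e := by
    refine le_of_pow_le_pow_left₀ (n := 6) (by norm_num) (by positivity) ?_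
    rw [mul_pow, rpow_sixth_pow_six (by positivity), rpow_sixth_pow_six (by positivity), mul_assoc]
    gcongr
  unfold overshoot
  rw [mul_assoc C, ← mul_pow]
  gcongr

/-- For small `ε` the controls satisfy the step estimates. -/
theorem exists_stepEstimates (hD : IsOpen D) (hf : ∀ i, ContDiffOn ℝ 3 (f i) D)
    (hrank : RankCondition D f S₁ S₂ S₃) {α : ℝ} (hα : 0 < α)
    (hF : ∀ x ∈ D, ‖matFInv f S₁ S₂ S₃ x‖ ≤ α) {g : ℝ → State n → State n}
    (hg : Caratheodory D g) {δ δ' M : ℝ} (hδ : 0 < δ) (hδ' : δ < δ')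
    (hδD : Metric.closedBall (0 : State n) δ' ⊆ D) (hM : 0 ≤ M)
    (hgM : ∀ t, 0 ≤ t → ∀ x ∈ Metric.closedBall (0 : State n) δ', ‖g t x‖ ≤ M * ‖x‖ ^ 3)
    {κ : Freq S₂ S₃} (hκ : κ.NonResonant) :
    ∃ γ > 0, ∃ C, 0 ≤ C ∧ ∃ ε₁ > 0, ∀ ε, 0 < ε → ε ≤ ε₁ → ∃ V,
      StepEstimates D g f (control f κ S₁ γ ε) ε δ δ' V (1 - ε * γ / 2)
        (overshoot C (ε * γ * α)) := by
  have hKc : IsCompact (Metric.closedBall (0 : State n) δ') := isCompact_closedBall _ _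
  have hfc : ∀ k, ContinuousOn (f k) D := fun k => (hf k).continuousOn
  obtain ⟨C, hC, hCb⟩ := exists_control_bound (S₁ := S₁) hfc hKc hδD κ
  obtain ⟨P, hP, c₀, hc₀, hPE⟩ := period_expansion (S₁ := S₁) hD hδD hKc (convex_closedBall _ _) hf hκ
  have hδ'0 : 0 < δ' := hδ.trans hδ'
  have hgap : 0 < (δ' - δ) / 3 := by linarith
  -- This gives `32 P M δ² ≤ γ / 4`, where `32 P M δ²` is the part of the drift error which does not
  -- shrink with `ε`. The constants `P`, `M` and `C` are fixed before `γ`.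
  set γ : ℝ := 1 + 128 * P * M * δ ^ 2 with hγdef
  have hγ1 : 0 ≤ 128 * P * M * δ ^ 2 := by positivity
  have hγ : 0 < γ := by linarith
  let Θ : ℝ → ℝ := fun ε => (ε * γ * α * δ) ^ (1 / 6 : ℝ)
  have hΘ : Continuous Θ := (Real.continuous_rpow_const (by norm_num)).comp (by fun_prop)
  have hΘ0 : Θ 0 = 0 := by simp [Θ]
  have hev : ∀ (F : ℝ → ℝ) (c : ℝ), Continuous F → F 0 = 0 → 0 < c → ∀ᶠ ε in nhds 0, F ε < c :=
    fun F c hF h0 hc => (hF.tendsto' 0 0 h0).eventually_lt_const hc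
  -- Every left-hand side is continuous and vanishes at `ε = 0`. In turn: nonnegativity of `1 - ε
  -- γ`, two smallness conditions on `θ`, the oscillating part of the displacement, the `θ⁷` error,
  -- the drift part of the displacement, absorption of the drift in the overshoot, and the drift
  -- error caused by the excursion.
  have hsmall : ∀ᶠ ε in nhds (0 : ℝ), ε * γ < 1 ∧ Θ ε < 1 ∧ Θ ε < c₀ ∧
      C * Θ ε ^ 2 < (δ' - δ) / 3 ∧ P * γ * α * Θ ε < γ / 8 ∧ ε * (M * δ' ^ 3) < (δ' - δ) / 3 ∧
      ε * (M * δ' ^ 2) < 1 / 2 ∧ ε * (32 * P * M * C ^ 3 * γ * α) < γ / 8 := by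
    refine (hev _ _ ?_ ?_ ?_).and <| (hev _ _ ?_ ?_ ?_).and <| (hev _ _ ?_ ?_ ?_).and <|
      (hev _ _ ?_ ?_ ?_).and <| (hev _ _ ?_ ?_ ?_).and <| (hev _ _ ?_ ?_ ?_).and <|
      (hev _ _ ?_ ?_ ?_).and <| hev _ _ ?_ ?_ ?_
    all_goals first | fun_prop | positivity | simp [hΘ0]
  obtain ⟨r, hr, hr'⟩ := Metric.eventually_nhds_iff.1 hsmall
  refine ⟨γ, hγ, C, hC, r / 2, by positivity, fun ε hε hεr => ?_⟩
  obtain ⟨s1, s2, s3, s4, s5, s6, s7, s8⟩ := hr' (y := ε) (by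
    rw [dist_zero_right, Real.norm_eq_abs, abs_of_pos hε]; linarith)
  set β : ℝ := ε * γ * α with hβdef
  have hβ : 0 < β := by positivity
  have hθ0 : ∀ s : ℝ, 0 ≤ s → 0 ≤ (β * s) ^ (1 / 6 : ℝ) := fun s hs => by positivity
  have hθΘ : ∀ s : ℝ, 0 ≤ s → s ≤ δ → (β * s) ^ (1 / 6 : ℝ) ≤ Θ ε := fun s hs hsδ =>
    Real.rpow_le_rpow (by positivity) (by gcongr) (by norm_num)
  have ha : ∀ ξ : State n, ξ ∈ D → ∀ i,
      ε * |coeffA f S₁ S₂ S₃ γ ξ i| ≤ ((β * ‖ξ‖) ^ (1 / 6 : ℝ)) ^ 6 := by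
    intro ξ hξ i
    rw [rpow_sixth_pow_six (by positivity)]
    calc _ ≤ ε * (γ * α * ‖ξ‖) := by
          gcongr; exact abs_coeffA_le hγ.le (hF ξ hξ) i
      _ = _ := by rw [hβdef]; ring
  have hin : ∀ ξ : State n, ‖ξ‖ ≤ δ → ξ ∈ D := fun ξ hξ =>
    hδD (by rw [mem_closedBall_zero_iff]; linarith)
  have hctl : ∀ (t : ℝ) (ξ x : State n), ‖ξ‖ ≤ δ → x ∈ Metric.closedBall (0 : State n) δ' →
      ‖∑ k, control f κ S₁ γ ε t ξ k • f k x‖ ≤ C * ((β * ‖ξ‖) ^ (1 / 6 : ℝ)) ^ 2 / ε := by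
    intro t ξ x hξ hx
    rw [le_div_iff₀ hε, mul_comm]
    exact hCb γ ε _ t ξ x hε (hθ0 _ (norm_nonneg _))
      ((hθΘ _ (norm_nonneg _) hξ).trans s2.le) (ha ξ (hin ξ hξ)) hx
  have hbound : ∀ j b y, IsPiece D g f (control f κ S₁ γ ε) ε j b y → ‖y (ε * j)‖ ≤ δ →
      (∀ t ∈ Icc (ε * j) b, y t ∈ Metric.closedBall (0 : State n) δ') →
        ∀ t ∈ Icc (ε * j) b, ‖y t‖ ≤ overshoot C β ‖y (ε * j)‖ := by
    intro j b y hy hyδ hyK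
    have hj0 : 0 ≤ ε * j := by positivity
    -- At the time of maximal norm the drift contributes at most half of that maximum and is
    -- absorbed on the left; this is the factor 2 in `overshoot`, and it replaces Gronwall's
    -- inequality.
    obtain ⟨tm, htm, hmax⟩ := isCompact_Icc.exists_isMaxOn (nonempty_Icc.2 hy.le)
      hy.continuousOn.norm
    have hmax' : ∀ t ∈ Icc (ε * j) b, ‖y t‖ ≤ ‖y tm‖ := fun t ht => hmax ht
    set θ := (β * ‖y (ε * j)‖) ^ (1 / 6 : ℝ) with hθ
    have h1 := norm_sub_le_of_absCont (C := M * (δ' ^ 2 * ‖y tm‖) + C * θ ^ 2 / ε) htm.1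
      (by positivity) (hy.mono htm).ac (by
        filter_upwards [hy.deriv] with s hs hsm
        have hsm' : s ∈ Icc (ε * j) b := ⟨hsm.1, hsm.2.trans htm.2⟩
        refine ⟨_, hs hsm', (norm_add_le _ _).trans (add_le_add ?_ (hctl s _ _ hyδ (hyK s hsm')))⟩
        refine (hgM s (hj0.trans hsm.1) _ (hyK s hsm')).trans ?_
        have h2 := mem_closedBall_zero_iff.1 (hyK s hsm')
        have h3 := hmax' s hsm'
        rw [pow_succ]
        gcongr)
    have h2 : (M * (δ' ^ 2 * ‖y tm‖) + C * θ ^ 2 / ε) * (tm - ε * j) ≤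
        ε * (M * δ' ^ 2) * ‖y tm‖ + C * θ ^ 2 := by
      calc _ ≤ (M * (δ' ^ 2 * ‖y tm‖) + C * θ ^ 2 / ε) * ε := by
            gcongr
            have := htm.2.trans hy.le_next
            linarith
        _ = _ := by field_simp
    have h3 : ‖y tm‖ ≤ ‖y tm - y (ε * j)‖ + ‖y (ε * j)‖ := by
      simpa using norm_add_le (y tm - y (ε * j)) (y (ε * j))
    have h4 : ε * (M * δ' ^ 2) * ‖y tm‖ ≤ 1 / 2 * ‖y tm‖ := by gcongr
    intro t ht
    refine (hmax' t ht).trans ?_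
    rw [overshoot, ← hθ]
    linarith
  refine ⟨M * δ' ^ 3 + C * Θ ε ^ 2 / ε, hε, hδ, hδD, by positivity, ?_, by linarith, by
    have : 0 ≤ ε * γ := by positivity
    linarith, hg, hfc, ?_, ?_, ?_, hbound⟩
  · have : (M * δ' ^ 3 + C * Θ ε ^ 2 / ε) * ε = ε * (M * δ' ^ 3) + C * Θ ε ^ 2 := by field_simp
    rw [this]; linarith
  · intro ξ k
    simp only [control_eq_sum]
    exact continuous_finsetSum _ fun p _ => (continuous_atomControl _ _ _ _).mul continuous_const
  · intro t ht ξ hξ x hx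
    refine (norm_add_le _ _).trans (add_le_add ?_ ?_)
    · refine (hgM t ht x hx).trans ?_
      have := mem_closedBall_zero_iff.1 hx
      gcongr
    · refine (hctl t ξ x hξ hx).trans ?_
      have h1 := hθΘ _ (norm_nonneg ξ) hξ
      have h2 := hθ0 _ (norm_nonneg ξ)
      gcongr
  · intro j y hy hyδ hyK
    have hb := hbound j _ y hy hyδ hyK
    set ξ := y (ε * j) with hξ
    set θ := (β * ‖ξ‖) ^ (1 / 6 : ℝ) with hθ
    have hθn : 0 ≤ θ := hθ0 _ (norm_nonneg _)
    have hθ6 : θ ^ 6 = β * ‖ξ‖ := rpow_sixth_pow_six (by positivity)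
    have hθle : θ ≤ Θ ε := hθΘ _ (norm_nonneg _) hyδ
    have hov : overshoot C β ‖ξ‖ = 2 * (‖ξ‖ + C * θ ^ 2) := rfl
    have hj0 : 0 ≤ ε * j := by positivity
    have hfp : IsForcedPath (Metric.closedBall (0 : State n) δ') (fun p => f (atomField p))
        (atomControl κ ε (coeffA f S₁ S₂ S₃ γ ξ)) (M * overshoot C β ‖ξ‖ ^ 3)
        (ε * (j : ℤ)) (ε * ((j : ℤ) + 1)) y := by
      push_cast
      refine ⟨hy.le, ?_, hy.ac, hyK, ?_⟩
      · rw [hov]; positivity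
      · filter_upwards [hy.deriv] with t h1 h2
        refine ⟨g t (y t), (hgM t (hj0.trans h2.1) _ (hyK t h2)).trans ?_, ?_⟩
        · have := hb t h2
          gcongr
        · rw [← sum_control_smul]; exact h1 h2
    have h1 := hPE ε θ _ (coeffA f S₁ S₂ S₃ γ ξ) j y hε hθn (hθle.trans s3.le)
      (ha ξ (hin ξ hyδ)) hfp
    push_cast at h1
    rw [← hξ, hrank.sum_coeffA_smul (hin ξ hyδ)] at h1
    have h2 : y (ε * (j + 1)) = (y (ε * (j + 1)) - ξ - ε • -(γ • ξ)) + (1 - ε * γ) • ξ := by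
      module
    have h3 : ‖y (ε * (j + 1))‖ ≤
        P * (M * overshoot C β ‖ξ‖ ^ 3 * ε + θ ^ 7) + (1 - ε * γ) * ‖ξ‖ := by
      conv_lhs => rw [h2]
      refine (norm_add_le _ _).trans (add_le_add h1 ?_)
      rw [norm_smul, Real.norm_eq_abs, abs_of_nonneg (by linarith)]
    set s := ‖ξ‖ with hs
    have hs0 : 0 ≤ s := norm_nonneg _
    -- Convexity of the cube gives `2³ · 4 = 32`; `θ⁶ = β s` makes the cubed excursion linear in
    -- `s`.
    have h4 : overshoot C β s ^ 3 ≤ 32 * (δ ^ 2 * s) + 32 * (C ^ 3 * (β * s)) := by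
      have e1 : (s + C * θ ^ 2) ^ 3 ≤ 4 * (s ^ 3 + (C * θ ^ 2) ^ 3) := by
        have := add_pow_le hs0 (show 0 ≤ C * θ ^ 2 by positivity) 3
        norm_num at this; linarith
      have e2 : s ^ 3 ≤ δ ^ 2 * s := by rw [pow_succ]; gcongr
      have e3 : (C * θ ^ 2) ^ 3 = C ^ 3 * (β * s) := by rw [← hθ6]; ring
      rw [hov, mul_pow]
      linarith
    have h5 : θ ^ 7 ≤ β * s * Θ ε := by
      rw [pow_succ, hθ6]; gcongr
    have h6 : P * (M * overshoot C β s ^ 3 * ε + θ ^ 7) ≤ ε * γ / 2 * s := by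
      calc _ ≤ P * (M * (32 * (δ ^ 2 * s) + 32 * (C ^ 3 * (β * s))) * ε + β * s * Θ ε) := by
            gcongr
        _ = ε * s * (32 * P * M * δ ^ 2 + ε * (32 * P * M * C ^ 3 * γ * α) +
            P * γ * α * Θ ε) := by rw [hβdef]; ring
        -- The errors use up half of the nominal contraction `ε γ`.
        _ ≤ ε * s * (γ / 4 + γ / 8 + γ / 8) := by
            gcongr
            linarith
        _ = _ := by ring
    linarith

/-- The step estimates yield exponential decay. -/
theorem StepEstimates.norm_le_exp {g : ℝ → State n → State n} {h : ℝ → State n → Fin m → ℝ}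
    {ε δ δ' V γ C β : ℝ}
    (S : StepEstimates D g f h ε δ δ' V (1 - ε * γ / 2) (overshoot C β)) (hγ : 0 < γ)
    (hC : 0 ≤ C) (hβ : 0 ≤ β) {x₀ : State n} (h0 : ‖x₀‖ ≤ δ) {x : ℝ → State n}
    (hx : IsPiSolution D g f h ε x₀ x) {t : ℝ} (ht : 0 ≤ t) :
    ‖x t‖ ≤ 2 * (δ + C * ((β * δ) ^ (1 / 6 : ℝ)) ^ 2) * Real.exp (γ * ε / 2) *
      Real.exp (-(γ / 6) * t) := by
  have hε := S.eps_pos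
  have hδ := S.delta_pos
  obtain ⟨ξ, hξ, hxt⟩ := S.norm_solution_le hx h0 ht
  set N := ⌊t / ε⌋₊
  have hN : t - ε ≤ ε * N := by
    have := (mem_Icc_floor hε ht).2
    linarith
  -- With `e = exp (-(γ / 12) (t - ε))`, the sampled state decays like `e⁶`, at rate `γ / 2`, and
  -- the excursion like `e²`, at rate `γ / 6`; the shift by `ε` pays for the time since the last
  -- sampling.
  have hq : (1 - ε * γ / 2) ^ N ≤ Real.exp (-(γ / 12) * (t - ε)) ^ 6 := by
    calc (1 - ε * γ / 2) ^ N ≤ Real.exp (-(ε * γ / 2)) ^ N :=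
          pow_le_pow_left₀ S.q_nonneg (Real.one_sub_le_exp_neg _) N
      _ = Real.exp (-(γ / 2) * (ε * N)) := by rw [← Real.exp_nat_mul]; congr 1; ring
      _ ≤ Real.exp (-(γ / 2) * (t - ε)) := by
          apply Real.exp_le_exp.2
          have := mul_le_mul_of_nonneg_left hN (half_pos hγ).le
          linarith
      _ = _ := by rw [← Real.exp_nat_mul]; congr 1; push_cast; ring
  have h1 : ‖ξ‖ ≤ δ * Real.exp (-(γ / 12) * (t - ε)) ^ 6 := by
    calc ‖ξ‖ ≤ (1 - ε * γ / 2) ^ N * ‖x₀‖ := hξ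
      _ ≤ Real.exp (-(γ / 12) * (t - ε)) ^ 6 * δ := by gcongr
      _ = _ := mul_comm _ _
  have h2 := overshoot_le_of_le hC hβ (norm_nonneg ξ) hδ.le (Real.exp_nonneg _) h1
  have hγt : 0 ≤ γ * t := by positivity
  have hγε : 0 ≤ γ * ε := by positivity
  have h6 : Real.exp (-(γ / 12) * (t - ε)) ^ 6 ≤
      Real.exp (γ * ε / 2) * Real.exp (-(γ / 6) * t) := by
    rw [← Real.exp_nat_mul, ← Real.exp_add]
    apply Real.exp_le_exp.2; push_cast; linarith
  have h3 : Real.exp (-(γ / 12) * (t - ε)) ^ 2 ≤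
      Real.exp (γ * ε / 2) * Real.exp (-(γ / 6) * t) := by
    rw [← Real.exp_nat_mul, ← Real.exp_add]
    apply Real.exp_le_exp.2; push_cast; linarith
  calc ‖x t‖ ≤ 2 * (δ * Real.exp (-(γ / 12) * (t - ε)) ^ 6 + C * ((β * δ) ^ (1 / 6 : ℝ)) ^ 2 *
        Real.exp (-(γ / 12) * (t - ε)) ^ 2) := hxt.trans h2
    _ ≤ 2 * (δ * (Real.exp (γ * ε / 2) * Real.exp (-(γ / 6) * t)) +
        C * ((β * δ) ^ (1 / 6 : ℝ)) ^ 2 * (Real.exp (γ * ε / 2) * Real.exp (-(γ / 6) * t))) := by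
        gcongr
    _ = _ := by ring

/-- The step estimates yield stability. -/
theorem StepEstimates.stable {g : ℝ → State n → State n} {h : ℝ → State n → Fin m → ℝ}
    {ε δ δ' V q C β : ℝ} (S : StepEstimates D g f h ε δ δ' V q (overshoot C β)) {η : ℝ}
    (hη : 0 < η) : ∃ r > 0, ∀ x₀ : State n, ‖x₀‖ ≤ δ → ‖x₀‖ < r → ∀ x,
      IsPiSolution D g f h ε x₀ x → ∀ t, 0 ≤ t → ‖x t‖ < η := by
  have h0 : overshoot C β 0 = 0 := by simp [overshoot]
  obtain ⟨r, hr, hr'⟩ := Metric.eventually_nhds_iff.1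
    (((continuous_overshoot C β).tendsto' 0 0 h0).eventually_lt_const hη)
  refine ⟨r, hr, fun x₀ hδ hx₀ x hx t ht => ?_⟩
  obtain ⟨ξ, hξ, hxt⟩ := S.norm_solution_le hx hδ ht
  refine hxt.trans_lt (hr' ?_)
  rw [dist_zero_right, norm_norm]
  exact (hξ.trans (mul_le_of_le_one_left (norm_nonneg _)
    (pow_le_one₀ S.q_nonneg S.q_le_one))).trans_lt hx₀

end Stabilization

end DriftStab

end

/-! ### The main theorem. -/

theorem corollary1 {n m : ℕ} (D : Set (State n)) (hD : IsOpen D) (hD0 : (0 : State n) ∈ D)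
    (f : Fin m → State n → State n) (hf : ∀ i, ContDiffOn ℝ 3 (f i) D)
    (S₁ : Finset (Fin m)) (S₂ : Finset (Fin m × Fin m)) (S₃ : Finset (Fin m × Fin m × Fin m))
    (hrank : RankCondition D f S₁ S₂ S₃)
    (α : ℝ) (hα : 0 < α) (hF : ∀ x ∈ D, ‖matFInv f S₁ S₂ S₃ x‖ ≤ α)
    (g : ℝ → State n → State n) (hg : Caratheodory D g) (hgb : BoundedDrift D g)
    (M_g L_g δ₀ : ℝ) (hM : 0 ≤ M_g) (hL : 0 ≤ L_g) (hδ₀ : 0 < δ₀)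
    (hcubic : ∀ t, 0 ≤ t → ∀ x ∈ Metric.ball (0 : State n) δ₀ ∩ D, ‖g t x‖ ≤ M_g * ‖x‖ ^ 3)
    (hlip : ∀ t, 0 ≤ t → ∀ x ∈ Metric.ball (0 : State n) δ₀ ∩ D,
      ∀ y ∈ Metric.ball (0 : State n) δ₀ ∩ D, ‖g t x - g t y‖ ≤ L_g * ‖x - y‖)
    (κ : Freq S₂ S₃) (hκ : κ.NonResonant)
    (δ : ℝ) (hδ : 0 < δ) (hδD : Metric.closedBall (0 : State n) δ ⊆ D) :
    ∃ γ > 0, ∃ ε₁ > 0, ∃ lam > 0, ∀ ε, 0 < ε → ε ≤ ε₁ →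
      -- solutions from `B_δ(0)` are well defined on `[0, ∞)`
      (∀ x₀ ∈ Metric.ball (0 : State n) δ,
        (∃ x, IsPiSolution D g f (control f κ S₁ γ ε) ε x₀ x) ∧
        ∀ T > 0, ∀ y, IsPiSolutionOn (Set.Ico 0 T) D g f (control f κ S₁ γ ε) ε x₀ y →
          ∃ x, IsPiSolution D g f (control f κ S₁ γ ε) ε x₀ x ∧ Set.EqOn x y (Set.Ico 0 T)) ∧
      -- exponential decay, uniform over `B_δ(0)`
      (∃ C, ∀ x₀ ∈ Metric.ball (0 : State n) δ, ∀ x,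
        IsPiSolution D g f (control f κ S₁ γ ε) ε x₀ x →
          ∀ t, 0 ≤ t → ‖x t‖ ≤ C * Real.exp (-lam * t)) ∧
      -- stability of the origin
      (∀ η > 0, ∃ r > 0, ∀ x₀ ∈ Metric.ball (0 : State n) δ, ‖x₀‖ < r → ∀ x,
        IsPiSolution D g f (control f κ S₁ γ ε) ε x₀ x → ∀ t, 0 ≤ t → ‖x t‖ < η) := by
  -- The slightly larger ball leaves room for the motion between sampling times; all constants are
  -- taken on it.
  obtain ⟨δ', hδ', hδ'D⟩ := exists_closedBall_subset hδ hD hδD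
  obtain ⟨M, hM0, hgM⟩ := hgb.exists_cubic_bound hM hδ₀ hcubic (isCompact_closedBall 0 δ') hδ'D
  obtain ⟨γ, hγ, C, hC, ε₁, hε₁, hstep⟩ :=
    exists_stepEstimates hD hf hrank hα hF hg hδ hδ' hδ'D hM0 hgM hκ
  refine ⟨γ, hγ, ε₁, hε₁, γ / 6, by positivity, fun ε hε hεε₁ => ?_⟩
  obtain ⟨V, S⟩ := hstep ε hε hεε₁
  have hball : ∀ x₀ ∈ Metric.ball (0 : State n) δ, ‖x₀‖ ≤ δ := fun x₀ hx₀ =>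
    (mem_ball_zero_iff.1 hx₀).le
  refine ⟨fun x₀ hx₀ => ⟨S.exists_solution_of_init (hball x₀ hx₀), fun T hT y hy =>
    S.exists_extension hT hy (hball x₀ hx₀)⟩, ⟨_, fun x₀ hx₀ x hx t ht =>
    S.norm_le_exp hγ hC (by positivity) (hball x₀ hx₀) hx ht⟩, fun η hη => ?_⟩
  obtain ⟨r, hr, hr'⟩ := S.stable hη
  exact ⟨r, hr, fun x₀ hx₀ => hr' x₀ (hball x₀ hx₀)⟩
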